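/- **Vertical fusion of binary interface defects for $\mathrm{Vec}(\mathbb Z/p)$.** Let $p$ be a prime, $\mathbb Z_p=\mathbb Z/p\mathbb Z$ and $\omega=e^{2\pi i/p}$. *Domain walls.* The walls are the bimodule categories $T,L,R,F_0,X_k,F_q$ with $k,q\in\mathbb Z_p^\times$. Their simple objects and actions $g\triangleright m\triangleleft h$ are: $T$: $m=(m_1,m_2)\in\mathbb Z_p^2$, $(m_1+g,m_2+h)$; $L$: $m\in\mathbb Z_p$, $m+h$; $R$: $m\in\mathbb Z_p$, $m+g$; $X_k$: $m\in\mathbb Z_p$, $m+g+kh$; $F_0,F_q$: one object $*$. The middle associator is $\Omega_{F_q}(g,h)=\omega^{qgh}$ and $\Omega_W=1$ for all other walls $W$. Put $c_{MN}\big((g,h),(g',h')\big)=\Omega_M(g',h)/\Omega_N(g',h)$. *Annular category.* For walls $M$ (lower) and $N$ (upper), $\mathrm{Ann}(M,N)$ has as objects the pairs $(m,n)$ of simple objects. $\mathrm{Hom}((m,n),(m',n'))$ has as basis the diagrams $[g,h]$ with $g\triangleright m\triangleleft h=m'$ and $g\triangleright n\triangleleft h=n'$. Placing $[s]$ inside $[t]$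 gives $c_{MN}(s,t)[s+t]$. A binary interface defect from $M$ to $N$ is an object $(A,e)$ of the Karoubi envelope of $\mathrm{Ann}(M,N)$. It corresponds to the representation $X\mapsto\{f:A\to X \mid f \text{ absorbs } e \text{ on the inside}\}$. *Table of simple defects.* $a,b,x,y\in\mathbb Z_p$ are labels, $MN$ stands for "lower wall $M$, upper wall $N$", and 'base' is $(0,0)$, $0$ or $*$. The object is (base, base) unless stated. * Identity idempotents: $TT^{a,b}$ at $((0,0),(a,b))$; $TL^a,TR^a,TX_l^a$ at $((0,0),a)$; $TF_0$; $TF_r$; $LT^a$ at $(0,(0,a))$; $RT^a$, $X_kT^a$ at $(0,(a,0))$; $F_0T$; $F_qT$; $LR$; $RL$; $LX_l$; $RX_l$; $X_kL$; $X_kR$; $X_kX_l$ ($k\ne l$). * $\frac1p\sum_g\omega^{gx}[g,0]$: $LL^{a,x}$ at $(0,a)$; $LF_0^x$, $LF_r^x$, $F_0L^x$, $F_qL^x$. * $\frac1p\sum_g\omega^{gx}[0,-g]$: $RR^{a,x}$ at $(0,a)$; $RF_0^x$, $RF_r^x$, $F_0R^x$, $F_qR^x$. * $X_kX_k^{a,x}=\frac1p\sum_g\omega^{gx}[kg,-g]$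 at $(0,a)$; $F_0X_l^x=\frac1p\sum_g\omega^{gx}[g,-l^{-1}g]$; $X_kF_0^x=\frac1p\sum_g\omega^{gx}[g,-k^{-1}g]$. * $X_kF_r^x=\frac1p\sum_g\Theta_{x,kr}(g)[kg,-g]$; $F_qX_l^x=\frac1p\sum_g\Theta_{x,-ql}(g)[lg,-g]$. Here $\Theta_{x,a}(g)=\omega^{gx+ag^2/2}$ for odd $p$ and $\Theta_{x,a}(g)=(-1)^{gx}i^{ag}$ for $p=2$; in the last formula $g,x\in\{0,1\}$, and $a=kr$, resp. $a=-ql$, is the integer formed from representatives of $k,r,q,l$ in $\{1,\dots,p-1\}$. * $F_0F_0^{x,y}$ and $F_qF_q^{x,y}$: $\frac1{p^2}\sum_{g,h}\omega^{gx+hy}[g,-h]$; $F_0F_r$, $F_qF_0$, $F_qF_r$ ($q\neq r$): $\frac1p\sum_g[0,-g]$. *Vertical fusion.* For $\alpha=((m,n),e)$ from $M$ to $N$ and $\beta=((n',t),e')$ from $N$ to $P$, pairs of pants with waist labels $(m'',t'')$ are the combinations of pairs $(s_1,s_2)$, $s_i=(g_i,h_i)$, with $g_1\triangleright m\triangleleft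 h_1=m''$, $g_1\triangleright n\triangleleft h_1=g_2\triangleright n'\triangleleft h_2$ and $g_2\triangleright t\triangleleft h_2=t''$. Inserting $[u]$ in the lower (upper) leg sends $(s_1,s_2)$ to $c_{MN}(u,s_1)(u+s_1,s_2)$ (to $c_{NP}(u,s_2)(s_1,u+s_2)$). Gluing $[u]$ around the waist sends it to $c_{MN}(s_1,u)c_{NP}(s_2,u)(s_1+u,s_2+u)$. The fusion $\alpha\circ\beta$ is the representation of $\mathrm{Ann}(M,P)$ that sends $X$ to the space of pants with waist labels $X$ absorbing $e$ on the lower and $e'$ on the upper leg; annuli act on the waist. **Theorem.** (1) For all walls $M,N$, the listed idempotents from $M$ to $N$ are indecomposable, pairwise inequivalent, and every indecomposable idempotent in $\mathrm{Ann}(M,N)$ is equivalent to one of them. (2) For all listed $\alpha$ from $M$ to $N$ and $\beta$ from $N$ to $P$, the representation $\alpha\circ\beta$ is isomorphic to the direct sum of the representations of the defects in the tables below. For every listed $\gamma$ from $M$ to $P$, the multiplicity of $\gamma$ in that sum is the dimension of the space of pants absorbing $\alpha,\beta$ on the legs and $\gamma$ on the waist. Throughout, $\oplus$ runs over all values in $\mathbb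 Z_p$ of the Greek labels $\mu,\nu$. We write $\Sigma XX_{km}$ for $\oplus_{\mu,\nu}X_kX_k^{\mu,\nu}$ if $k=m$ and $p\cdot X_kX_m$ if $k\ne m$, and $\Sigma FF_{qs}$ for $\oplus_{\mu,\nu}F_qF_q^{\mu,\nu}$ if $q=s$ and $p\cdot F_qF_s$ if $q\ne s$. In each row the left factor $\alpha$ is fixed, and the results for the successive right factors $\beta$ are listed, separated by semicolons. **Along $T$**, right factors $TT^{c,d};\ TL^c;\ TR^c;\ TF_0;\ TX_m^c;\ TF_s$: * $TT^{a,b}$: $TT^{a+c,b+d}$; $TL^{b+c}$; $TR^{a+c}$; $TF_0$; $TX_m^{a+c+mb}$; $TF_s$. * $LT^a$: $LT^{a+d}$; $\oplus_\mu LL^{a+c,\mu}$; $LR$; $\oplus_\mu LF_0^\mu$; $LX_m$; $\oplus_\mu LF_s^\mu$. * $RT^a$: $RT^{a+c}$; $RL$; $\oplus_\mu RR^{a+c,\mu}$; $\oplus_\mu RF_0^\mu$; $RX_m$; $\oplus_\mu RF_s^\mu$. * $F_0T$: $F_0T$; $\oplus_\mu F_0L^\mu$; $\oplus_\mu F_0R^\mu$;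 $\oplus_{\mu,\nu}F_0F_0^{\mu,\nu}$; $\oplus_\mu F_0X_m^\mu$; $p\cdot F_0F_s$. * $X_kT^a$: $X_kT^{a+c+kd}$; $X_kL$; $X_kR$; $\oplus_\mu X_kF_0^\mu$; $\oplus_\mu X_kX_k^{a+c,\mu}$ if $k=m$, $X_kX_m$ if $k\ne m$; $\oplus_\mu X_kF_s^\mu$. * $F_qT$: $F_qT$; $\oplus_\mu F_qL^\mu$; $\oplus_\mu F_qR^\mu$; $p\cdot F_qF_0$; $\oplus_\mu F_qX_m^\mu$; $\Sigma FF_{qs}$. **Along $L$**, right factors $LT^c;\ LL^{c,z};\ LR;\ LF_0^z;\ LX_m;\ LF_s^z$: * $TL^a$: $\oplus_\mu TT^{\mu,a+c}$; $TL^{a+c}$; $\oplus_\mu TR^\mu$; $TF_0$; $\oplus_\mu TX_m^\mu$; $TF_s$. * $LL^{a,x}$: $LT^{a+c}$; $LL^{a+c,x+z}$; $LR$; $LF_0^{x+z}$; $LX_m$; $LF_s^{x+z+sa}$. * $RL$: $\oplus_\mu RT^\mu$; $RL$; $\oplus_{\mu,\nu}RR^{\mu,\nu}$; $\oplus_\mu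 RF_0^\mu$; $p\cdot RX_m$; $\oplus_\mu RF_s^\mu$. * $F_0L^x$: $F_0T$; $F_0L^{x+z}$; $\oplus_\mu F_0R^\mu$; $\oplus_\mu F_0F_0^{x+z,\mu}$; $\oplus_\mu F_0X_m^\mu$; $F_0F_s$. * $X_kL$: $\oplus_\mu X_kT^\mu$; $X_kL$; $p\cdot X_kR$; $\oplus_\mu X_kF_0^\mu$; $\Sigma XX_{km}$; $\oplus_\mu X_kF_s^\mu$. * $F_qL^x$: $F_qT$; $F_qL^{x+z+qc}$; $\oplus_\mu F_qR^\mu$; $F_qF_0$; $\oplus_\mu F_qX_m^\mu$; $\oplus_\mu F_qF_q^{x+z,\mu}$ if $q=s$, $F_qF_s$ if $q\neq s$. **Along $R$**, right factors $RT^c;\ RL;\ RR^{c,z};\ RF_0^z;\ RX_m;\ RF_s^z$: * $TR^a$: $\oplus_\mu TT^{a+c,\mu}$; $\oplus_\mu TL^\mu$; $TR^{a+c}$; $TF_0$; $\oplus_\mu TX_m^\mu$; $TF_s$. * $LR$: $\oplus_\mu LT^\mu$; $\oplus_{\mu,\nu}LL^{\mu,\nu}$; $LR$; $\oplus_\mu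 LF_0^\mu$; $p\cdot LX_m$; $\oplus_\mu LF_s^\mu$. * $RR^{a,x}$: $RT^{a+c}$; $RL$; $RR^{a+c,x+z}$; $RF_0^{x+z}$; $RX_m$; $RF_s^{x+z+sa}$. * $F_0R^x$: $F_0T$; $\oplus_\mu F_0L^\mu$; $F_0R^{x+z}$; $\oplus_\mu F_0F_0^{\mu,x+z}$; $\oplus_\mu F_0X_m^\mu$; $F_0F_s$. * $X_kR$: $\oplus_\mu X_kT^\mu$; $p\cdot X_kL$; $X_kR$; $\oplus_\mu X_kF_0^\mu$; $\Sigma XX_{km}$; $\oplus_\mu X_kF_s^\mu$. * $F_qR^x$: $F_qT$; $\oplus_\mu F_qL^\mu$; $F_qR^{x+z+qc}$; $F_qF_0$; $\oplus_\mu F_qX_m^\mu$; $\oplus_\mu F_qF_q^{\mu,x+z}$ if $q=s$, $F_qF_s$ if $q\ne s$. **Along $F_0$**, right factors $F_0T;\ F_0L^z;\ F_0R^z;\ F_0F_0^{z,w};\ F_0X_m^z;\ F_0F_s$: * $TF_0$: $\oplus_{\mu,\nu}TT^{\mu,\nu}$; $\oplus_\mu TL^\mu$; $\oplus_\mu TR^\mu$;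 $TF_0$; $\oplus_\mu TX_m^\mu$; $p\cdot TF_s$. * $LF_0^x$: $\oplus_\mu LT^\mu$; $\oplus_\mu LL^{\mu,x+z}$; $LR$; $LF_0^{x+z}$; $LX_m$; $\oplus_\mu LF_s^\mu$. * $RF_0^x$: $\oplus_\mu RT^\mu$; $RL$; $\oplus_\mu RR^{\mu,x+z}$; $RF_0^{x+w}$; $RX_m$; $\oplus_\mu RF_s^\mu$. * $F_0F_0^{x,y}$: $F_0T$; $F_0L^{x+z}$; $F_0R^{y+z}$; $F_0F_0^{x+z,y+w}$; $F_0X_m^{x+z+m^{-1}y}$; $F_0F_s$. * $X_kF_0^x$: $\oplus_\mu X_kT^\mu$; $X_kL$; $X_kR$; $X_kF_0^{x+z+k^{-1}w}$; $\oplus_\mu X_kX_k^{\mu,k(x+z)}$ if $k=m$, $X_kX_m$ if $k\ne m$; $\oplus_\mu X_kF_s^\mu$. * $F_qF_0$: $p\cdot F_qT$; $\oplus_\mu F_qL^\mu$; $\oplus_\mu F_qR^\mu$; $F_qF_0$; $\oplus_\mu F_qX_m^\mu$; $\Sigma FF_{qs}$. **Along $X_l$**, right factors $X_lT^c;\ X_lL;\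 X_lR;\ X_lF_0^z;\ X_lX_l^{c,z};\ X_lX_m\,(m\ne l);\ X_lF_s^z$: * $TX_l^a$: $\oplus_\mu TT^{a+c-l\mu,\mu}$; $\oplus_\mu TL^\mu$; $\oplus_\mu TR^\mu$; $TF_0$; $TX_l^{a+c}$; $\oplus_\mu TX_m^\mu$; $TF_s$. * $LX_l$: $\oplus_\mu LT^\mu$; $\oplus_{\mu,\nu}LL^{\mu,\nu}$; $p\cdot LR$; $\oplus_\mu LF_0^\mu$; $LX_l$; $p\cdot LX_m$; $\oplus_\mu LF_s^\mu$. * $RX_l$: $\oplus_\mu RT^\mu$; $p\cdot RL$; $\oplus_{\mu,\nu}RR^{\mu,\nu}$; $\oplus_\mu RF_0^\mu$; $RX_l$; $p\cdot RX_m$; $\oplus_\mu RF_s^\mu$. * $F_0X_l^x$: $F_0T$; $\oplus_\mu F_0L^\mu$; $\oplus_\mu F_0R^\mu$; $\oplus_\mu F_0F_0^{x+z-l^{-1}\mu,\mu}$; $F_0X_l^{x+l^{-1}z}$; $\oplus_\mu F_0X_m^\mu$; $F_0F_s$. * $X_lX_l^{a,x}$: $X_lT^{a+c}$; $X_lL$;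 $X_lR$; $X_lF_0^{l^{-1}x+z}$; $X_lX_l^{a+c,x+z}$; $X_lX_m$; $X_lF_s^{x+z+as}$. * $X_kX_l$ ($k\ne l$): $\oplus_\mu X_kT^\mu$; $p\cdot X_kL$; $p\cdot X_kR$; $\oplus_\mu X_kF_0^\mu$; $X_kX_l$; $\Sigma XX_{km}$; $\oplus_\mu X_kF_s^\mu$. * $F_qX_l^x$: $F_qT$; $\oplus_\mu F_qL^\mu$; $\oplus_\mu F_qR^\mu$; $F_qF_0$; $F_qX_l^{x+z+qc}$; $\oplus_\mu F_qX_m^\mu$; $\oplus_\mu F_qF_q^{\mu,x+z-l\mu}$ if $q=s$, $F_qF_s$ if $q\ne s$. **Along $F_r$**, right factors $F_rT;\ F_rL^z;\ F_rR^z;\ F_rF_0;\ F_rX_m^z;\ F_rF_r^{z,w};\ F_rF_s\,(s\neq r)$: * $TF_r$: $\oplus_{\mu,\nu}TT^{\mu,\nu}$; $\oplus_\mu TL^\mu$; $\oplus_\mu TR^\mu$; $p\cdot TF_0$; $\oplus_\mu TX_m^\mu$; $TF_r$; $p\cdot TF_s$. * $LF_r^x$: $\oplus_\mu LT^\mu$;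 $\oplus_\mu LL^{\mu,x+z-r\mu}$; $LR$; $\oplus_\mu LF_0^\mu$; $LX_m$; $LF_r^{x+z}$; $\oplus_\mu LF_s^\mu$. * $RF_r^x$: $\oplus_\mu RT^\mu$; $RL$; $\oplus_\mu RR^{\mu,x+z-r\mu}$; $\oplus_\mu RF_0^\mu$; $RX_m$; $RF_r^{x+w}$; $\oplus_\mu RF_s^\mu$. * $F_0F_r$: $p\cdot F_0T$; $\oplus_\mu F_0L^\mu$; $\oplus_\mu F_0R^\mu$; $\oplus_{\mu,\nu}F_0F_0^{\mu,\nu}$; $\oplus_\mu F_0X_m^\mu$; $F_0F_r$; $p\cdot F_0F_s$. * $X_kF_r^x$: $\oplus_\mu X_kT^\mu$; $X_kL$; $X_kR$; $\oplus_\mu X_kF_0^\mu$; $\oplus_\mu X_kX_k^{\mu,x+z-r\mu}$ if $k=m$, $X_kX_m$ if $k\ne m$; $X_kF_r^{w+x+kz}$; $\oplus_\mu X_kF_s^\mu$. * $F_rF_r^{x,y}$: $F_rT$; $F_rL^{x+z}$; $F_rR^{y+z}$; $F_rF_0$; $F_rX_m^{y+z+mx}$; $F_rF_r^{x+z,y+w}$;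 $F_rF_s$. * $F_qF_r$ ($q\ne r$): $p\cdot F_qT$; $\oplus_\mu F_qL^\mu$; $\oplus_\mu F_qR^\mu$; $p\cdot F_qF_0$; $\oplus_\mu F_qX_m^\mu$; $F_qF_r$; $\Sigma FF_{qs}$. -/

import Mathlib

open CategoryTheory CategoryTheory.Idempotents CategoryTheory.Limits

noncomputable section

namespace VecZp

/-! ## Domain walls: the indecomposable bimodule categories over `Vec(ℤ/p)` -/

/-- Labels of the indecomposable bimodule categories `T, L, R, F₀, X_k, F_q` (`k, q ≠ 0`). -/
inductive Wall (p : ℕ) : Type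
  | T | L | R | F₀
  | X (k : (ZMod p)ˣ)
  | F (q : (ZMod p)ˣ)

/-- A pair of string labels: a string `g` ending on a wall from the left, and a string `h`
ending on it from the right. -/
abbrev Strings (p : ℕ) : Type := ZMod p × ZMod p

variable {p : ℕ}

/-- The set of (isomorphism classes of) simple objects of a bimodule category. -/
def Wall.Obj : Wall p → Type
  | .T => ZMod p × ZMod p
  | .L => ZMod p
  | .R => ZMod p
  | .F₀ => Unit
  | .X _ => ZMod p
  | .F _ => Unit

/-- The simple object `(0,0)`, `0` or `*`. -/
def Wall.base : (W : Wall p) → W.Obj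
  | .T => ((0 : ZMod p), (0 : ZMod p))
  | .L => (0 : ZMod p)
  | .R => (0 : ZMod p)
  | .F₀ => ()
  | .X _ => (0 : ZMod p)
  | .F _ => ()

/-- The bimodule action on simple objects: `W.act (g, h) m = g ▹ m ◃ h`. -/
def Wall.act : (W : Wall p) → Strings p → W.Obj → W.Obj
  | .T => fun s (m : ZMod p × ZMod p) => (m.1 + s.1, m.2 + s.2)
  | .L => fun s (m : ZMod p) => m + s.2
  | .R => fun s (m : ZMod p) => m + s.1
  | .F₀ => fun _ _ => ()
  | .X k => fun s (m : ZMod p) => m + s.1 + (k : ZMod p) * s.2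
  | .F _ => fun _ _ => ()

theorem Wall.act_zero (W : Wall p) (m : W.Obj) : W.act 0 m = m := by
  cases W <;> first | rfl | skip
  · exact Prod.ext (add_zero (M := ZMod p) _) (add_zero (M := ZMod p) _)
  · exact add_zero (M := ZMod p) _
  · exact add_zero (M := ZMod p) _
  · rename_i k
    change (show ZMod p from m) + 0 + (k : ZMod p) * 0 = (show ZMod p from m)
    ring

theorem Wall.act_add (W : Wall p) (s t : Strings p) (m : W.Obj) :
    W.act (s + t) m = W.act t (W.act s m) := by
  cases W <;> first | rfl | skip
  · exact Prod.ext (add_assoc (G := ZMod p) _ _ _).symm (add_assoc (G := ZMod p) _ _ _).symm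
  · exact (add_assoc (G := ZMod p) _ _ _).symm
  · exact (add_assoc (G := ZMod p) _ _ _).symm
  · rename_i k
    change (show ZMod p from m) + (s.1 + t.1) + (k : ZMod p) * (s.2 + t.2) =
      (show ZMod p from m) + s.1 + (k : ZMod p) * s.2 + t.1 + (k : ZMod p) * t.2
    ring

variable [Fact p.Prime]

/-- `root n = ω ^ n`, with `ω = exp (2πi/p)`. -/
def root (n : ZMod p) : ℂ := ZMod.stdAddChar n

/-- The middle associator `(g ▹ m) ◃ h → g ▹ (m ◃ h)` of a bimodule category, which is
`ω ^ (q g h)` for `F_q` and trivial for the others. -/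
def Wall.assoc : Wall p → ZMod p → ZMod p → ℂ
  | .F q, g, h => root ((q : ZMod p) * g * h)
  | _, _, _ => 1

theorem root_ne_zero (n : ZMod p) : root n ≠ 0 := by
  intro h
  have h1 : root n * root (-n) = 1 := by
    unfold root; rw [← AddChar.map_add_eq_mul]; simp
  rw [h, zero_mul] at h1
  exact zero_ne_one h1

theorem root_add (m n : ZMod p) : root (m + n) = root m * root n :=
  AddChar.map_add_eq_mul _ _ _

theorem root_zero : root (0 : ZMod p) = 1 := AddChar.map_zero_eq_one _

theorem Wall.assoc_ne_zero (W : Wall p) (g h : ZMod p) : W.assoc g h ≠ 0 := by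
  cases W <;> simp [Wall.assoc, root_ne_zero]

theorem Wall.assoc_add_left (W : Wall p) (g g' h : ZMod p) :
    W.assoc (g + g') h = W.assoc g h * W.assoc g' h := by
  cases W <;> simp [Wall.assoc, ← root_add]; ring_nf

theorem Wall.assoc_add_right (W : Wall p) (g h h' : ZMod p) :
    W.assoc g (h + h') = W.assoc g h * W.assoc g h' := by
  cases W <;> simp [Wall.assoc, ← root_add]; ring_nf

/-- The phase obtained when the annulus with strings `s` is placed inside the annulus with
strings `t` (`M` the lower wall, `N` the upper wall) and the result is brought to standard form. -/
def phase (M N : Wall p) (s t : Strings p) : ℂ := M.assoc t.1 s.2 / N.assoc t.1 s.2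

theorem phase_add_left (M N : Wall p) (s s' t : Strings p) :
    phase M N (s + s') t = phase M N s t * phase M N s' t := by
  simp only [phase, Prod.snd_add, Wall.assoc_add_right]; ring

theorem phase_add_right (M N : Wall p) (s t t' : Strings p) :
    phase M N s (t + t') = phase M N s t * phase M N s t' := by
  simp only [phase, Prod.fst_add, Wall.assoc_add_left]; ring

theorem phase_mul (M N P : Wall p) (s t : Strings p) :
    phase M N s t * phase N P s t = phase M P s t := by
  have := N.assoc_ne_zero t.1 s.2
  simp only [phase]; field_simp

theorem phase_zero_left (M N : Wall p) (t : Strings p) : phase M N 0 t = 1 := by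
  have h := phase_add_left M N 0 0 t
  have h0 : phase M N 0 t ≠ 0 := div_ne_zero (M.assoc_ne_zero _ _) (N.assoc_ne_zero _ _)
  rw [add_zero] at h
  exact (mul_left_cancel₀ h0 (by rw [mul_one]; exact h)).symm

theorem phase_zero_right (M N : Wall p) (s : Strings p) : phase M N s 0 = 1 := by
  have h := phase_add_right M N s 0 0
  have h0 : phase M N s 0 ≠ 0 := div_ne_zero (M.assoc_ne_zero _ _) (N.assoc_ne_zero _ _)
  rw [add_zero] at h
  exact (mul_left_cancel₀ h0 (by rw [mul_one]; exact h)).symm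

/-! ## The annular category of two walls -/

/-- Objects of the annular category: a simple object on the lower string, labelled by `M`, and
one on the upper string, labelled by `N`. -/
@[ext] structure Ann (M N : Wall p) where
  low : M.Obj
  up : N.Obj

variable {M N P : Wall p}

/-- The annular diagrams with inner labels `A` and outer labels `B`: formal complex combinations
of pairs of strings `(g, h)` that carry the labels `A` to the labels `B`. -/
def annuli (A B : Ann M N) : Submodule ℂ (Strings p → ℂ) where
  carrier := {f | ∀ s, f s ≠ 0 → M.act s A.low = B.low ∧ N.act s A.up = B.up}
  zero_mem' := by intro s hs; simp at hs
  add_mem' := by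
    intro f g hf hg s hs
    by_cases h : f s = 0
    · exact hg s (by intro h'; simp [h, h'] at hs)
    · exact hf s h
  smul_mem' := by
    intro c f hf s hs
    exact hf s (by intro h; simp [h] at hs)

/-- Gluing of annuli: `f` is placed inside `g`. -/
def glue (M N : Wall p) (f g : Strings p → ℂ) : Strings p → ℂ :=
  fun k => ∑ s, phase M N s (k - s) * f s * g (k - s)

theorem glue_mem {A B C : Ann M N} {f g : Strings p → ℂ} (hf : f ∈ annuli A B)
    (hg : g ∈ annuli B C) : glue M N f g ∈ annuli A C := by
  intro k hk
  obtain ⟨s, -, hs⟩ := Finset.exists_ne_zero_of_sum_ne_zero hk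
  have h1 := hf s (by intro h; simp [h] at hs)
  have h2 := hg (k - s) (by intro h; simp [h] at hs)
  rw [← h1.1, ← h1.2, ← Wall.act_add, ← Wall.act_add, add_sub_cancel] at h2
  exact h2

theorem glue_assoc (f g h : Strings p → ℂ) :
    glue M N (glue M N f g) h = glue M N f (glue M N g h) := by
  funext k
  simp only [glue, Finset.mul_sum, Finset.sum_mul]
  rw [Finset.sum_comm]
  refine Finset.sum_congr rfl fun a _ => ?_
  refine Fintype.sum_equiv (Equiv.subRight a) _ _ fun b => ?_
  simp only [Equiv.subRight_apply]
  have e : k - a - (b - a) = k - b := by abel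
  have h1 : phase M N b (k - b) = phase M N a (k - b) * phase M N (b - a) (k - b) := by
    rw [← phase_add_left, add_sub_cancel]
  have h2 : phase M N a (k - a) = phase M N a (b - a) * phase M N a (k - b) := by
    rw [← phase_add_right]; congr 1; abel
  rw [e, h1, h2]; ring

theorem unit_glue (f : Strings p → ℂ) : glue M N (Pi.single 0 1) f = f := by
  funext k
  rw [glue, Finset.sum_eq_single 0]
  · simp [phase_zero_left]
  · intro s _ hs; simp [Pi.single_eq_of_ne hs]
  · simp

theorem glue_unit (f : Strings p → ℂ) : glue M N f (Pi.single 0 1) = f := by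
  funext k
  rw [glue, Finset.sum_eq_single k]
  · simp [phase_zero_right]
  · intro s _ hs
    rw [Pi.single_eq_of_ne (sub_ne_zero.mpr hs.symm)]; simp
  · simp

theorem unit_mem (A : Ann M N) : (Pi.single 0 1 : Strings p → ℂ) ∈ annuli A A := by
  intro s hs
  have : s = 0 := by
    by_contra h; exact hs (Pi.single_eq_of_ne h _)
  subst this
  exact ⟨Wall.act_zero _ _, Wall.act_zero _ _⟩

theorem add_glue (f f' g : Strings p → ℂ) :
    glue M N (f + f') g = glue M N f g + glue M N f' g := by
  funext k; simp [glue, mul_add, add_mul, Finset.sum_add_distrib]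

theorem glue_add (f g g' : Strings p → ℂ) :
    glue M N f (g + g') = glue M N f g + glue M N f g' := by
  funext k; simp [glue, mul_add, Finset.sum_add_distrib]

theorem smul_glue (c : ℂ) (f g : Strings p → ℂ) : glue M N (c • f) g = c • glue M N f g := by
  funext k
  simp only [glue, Pi.smul_apply, smul_eq_mul, Finset.mul_sum]
  exact Finset.sum_congr rfl fun s _ => by ring

theorem glue_smul (c : ℂ) (f g : Strings p → ℂ) : glue M N f (c • g) = c • glue M N f g := by
  funext k
  simp only [glue, Pi.smul_apply, smul_eq_mul, Finset.mul_sum]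
  exact Finset.sum_congr rfl fun s _ => by ring

/-- The annular category; `f ≫ g` is the annulus `f` placed inside the annulus `g`. -/
instance : Category (Ann M N) where
  Hom A B := annuli A B
  id A := ⟨Pi.single 0 1, unit_mem A⟩
  comp f g := ⟨glue M N f.1 g.1, glue_mem f.2 g.2⟩
  id_comp f := Subtype.ext (unit_glue f.1)
  comp_id f := Subtype.ext (glue_unit f.1)
  assoc f g h := Subtype.ext (glue_assoc f.1 g.1 h.1)

instance : Preadditive (Ann M N) where
  homGroup A B := inferInstanceAs (AddCommGroup (annuli A B))
  add_comp _ _ _ f f' g := Subtype.ext (add_glue f.1 f'.1 g.1)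
  comp_add _ _ _ f g g' := Subtype.ext (glue_add f.1 g.1 g'.1)

instance : Linear ℂ (Ann M N) where
  homModule A B := inferInstanceAs (Module ℂ (annuli A B))
  smul_comp _ _ _ c f g := Subtype.ext (smul_glue c f.1 g.1)
  comp_smul _ _ _ f c g := Subtype.ext (glue_smul c f.1 g.1)

/-! ## Defects -/

/-- Binary interface defects from the lower wall `M` to the upper wall `N` (possibly decomposable):
idempotents in the annular category, i.e. objects of its Karoubi envelope. -/
abbrev Interface (M N : Wall p) : Type := Karoubi (Ann M N)

/-- A nonzero idempotent which is not a sum of two nonzero orthogonal idempotents. -/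
def IsIndecomposable (E : Interface M N) : Prop :=
  𝟙 E ≠ 0 ∧ ∀ f : E ⟶ E, f ≫ f = f → f = 0 ∨ f = 𝟙 E

/-- The diagrams with outer labels `X` that absorb the idempotent `E` on the inside. -/
def absorbing (E : Interface M N) (X : Ann M N) : Submodule ℂ (E.X ⟶ X) where
  carrier := {f | E.p ≫ f = f}
  zero_mem' := comp_zero
  add_mem' := by
    intro f g hf hg
    change E.p ≫ (f + g) = f + g
    rw [Preadditive.comp_add, hf, hg]
  smul_mem' := by
    intro c f hf
    change E.p ≫ (c • f) = c • f
    rw [Linear.comp_smul, hf]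

/-- The representation of the annular category (equivalently, the bimodule functor) that belongs
to an interface defect. Annuli act by gluing on the outside. -/
def rep (E : Interface M N) : Ann M N ⥤ ModuleCat.{0} ℂ where
  obj X := ModuleCat.of ℂ (absorbing E X)
  map {X Y} g := ModuleCat.ofHom
    { toFun := fun f => ⟨f.1 ≫ g, by
        change E.p ≫ f.1 ≫ g = f.1 ≫ g
        rw [← Category.assoc, f.2]⟩
      map_add' := fun f f' => Subtype.ext (Preadditive.add_comp _ _ _ _ _ _)
      map_smul' := fun c f => Subtype.ext (Linear.smul_comp _ _ _ _ _ _) }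
  map_id X := by
    exact ModuleCat.hom_ext (LinearMap.ext fun f => Subtype.ext (Category.comp_id f.1))
  map_comp g h := by
    exact ModuleCat.hom_ext (LinearMap.ext fun f => Subtype.ext (Category.assoc f.1 g h).symm)

/-! ## Vertical fusion: pairs of pants -/

/-- Pairs of pants in standard form: a formal combination of pairs `(a, b)`, where `a` are the
strings around the lower leg and `b` the strings around the upper leg. -/
abbrev PantsDiagram (p : ℕ) : Type := Strings p × Strings p → ℂ

/-- The pairs of pants with labels `A` on the lower leg, `B` on the upper leg and `X` on the
waist. The wall `N` runs from the top of the lower leg to the bottom of the upper leg. -/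
def pants (A : Ann M N) (B : Ann N P) (X : Ann M P) : Submodule ℂ (PantsDiagram p) where
  carrier := {f | ∀ a b, f (a, b) ≠ 0 →
    M.act a A.low = X.low ∧ N.act a A.up = N.act b B.low ∧ P.act b B.up = X.up}
  zero_mem' := by intro a b hs; simp at hs
  add_mem' := by
    intro f g hf hg a b hs
    by_cases h : f (a, b) = 0
    · exact hg a b (by intro h'; simp [h, h'] at hs)
    · exact hf a b h
  smul_mem' := by
    intro c f hf a b hs
    exact hf a b (by intro h; simp [h] at hs)

/-- Insert an annulus into the lower leg. -/
def glueLow (M N : Wall p) (e : Strings p → ℂ) (f : PantsDiagram p) : PantsDiagram p :=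
  fun x => ∑ s, phase M N s (x.1 - s) * e s * f (x.1 - s, x.2)

/-- Insert an annulus into the upper leg. -/
def glueUp (N P : Wall p) (e : Strings p → ℂ) (f : PantsDiagram p) : PantsDiagram p :=
  fun x => ∑ s, phase N P s (x.2 - s) * e s * f (x.1, x.2 - s)

/-- Glue an annulus around the waist. -/
def glueWaist (M N P : Wall p) (f : PantsDiagram p) (g : Strings p → ℂ) : PantsDiagram p :=
  fun x => ∑ s, phase M N (x.1 - s) s * phase N P (x.2 - s) s * f (x.1 - s, x.2 - s) * g s

theorem glueLow_add (e : Strings p → ℂ) (f g : PantsDiagram p) :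
    glueLow M N e (f + g) = glueLow M N e f + glueLow M N e g := by
  funext x; simp [glueLow, mul_add, Finset.sum_add_distrib]

theorem glueLow_smul (c : ℂ) (e : Strings p → ℂ) (f : PantsDiagram p) :
    glueLow M N e (c • f) = c • glueLow M N e f := by
  funext x
  simp only [glueLow, Pi.smul_apply, smul_eq_mul, Finset.mul_sum]
  exact Finset.sum_congr rfl fun s _ => by ring

theorem glueUp_add (e : Strings p → ℂ) (f g : PantsDiagram p) :
    glueUp N P e (f + g) = glueUp N P e f + glueUp N P e g := by
  funext x; simp [glueUp, mul_add, Finset.sum_add_distrib]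

theorem glueUp_smul (c : ℂ) (e : Strings p → ℂ) (f : PantsDiagram p) :
    glueUp N P e (c • f) = c • glueUp N P e f := by
  funext x
  simp only [glueUp, Pi.smul_apply, smul_eq_mul, Finset.mul_sum]
  exact Finset.sum_congr rfl fun s _ => by ring

theorem glueWaist_add (f f' : PantsDiagram p) (g : Strings p → ℂ) :
    glueWaist M N P (f + f') g = glueWaist M N P f g + glueWaist M N P f' g := by
  funext x; simp [glueWaist, mul_add, add_mul, Finset.sum_add_distrib]

theorem glueWaist_smul (c : ℂ) (f : PantsDiagram p) (g : Strings p → ℂ) :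
    glueWaist M N P (c • f) g = c • glueWaist M N P f g := by
  funext x
  simp only [glueWaist, Pi.smul_apply, smul_eq_mul, Finset.mul_sum]
  exact Finset.sum_congr rfl fun s _ => by ring

theorem glueWaist_unit (f : PantsDiagram p) : glueWaist M N P f (Pi.single 0 1) = f := by
  funext x
  rw [glueWaist, Finset.sum_eq_single 0]
  · simp [phase_zero_right]
  · intro s _ hs; simp [Pi.single_eq_of_ne hs]
  · simp

theorem glueWaist_glue (f : PantsDiagram p) (g h : Strings p → ℂ) :
    glueWaist M N P f (glue M P g h) = glueWaist M N P (glueWaist M N P f g) h := by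
  funext x
  simp only [glueWaist, glue, Finset.mul_sum, Finset.sum_mul]
  conv_lhs => rw [Finset.sum_comm]
  conv_rhs => rw [Finset.sum_comm]
  refine Finset.sum_congr rfl fun a _ => ?_
  refine Fintype.sum_equiv (Equiv.subRight a) _ _ fun b => ?_
  simp only [Equiv.subRight_apply]
  have e1 : x.1 - (b - a) - a = x.1 - b := by abel
  have e2 : x.2 - (b - a) - a = x.2 - b := by abel
  have h1 (M N : Wall p) (y : Strings p) : phase M N (y - b) b =
      phase M N (y - b) a * phase M N (y - b) (b - a) := by
    rw [← phase_add_right, add_sub_cancel]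
  have h2 (M N : Wall p) (y : Strings p) : phase M N (y - (b - a)) (b - a) =
      phase M N (y - b) (b - a) * phase M N a (b - a) := by
    rw [← phase_add_left]; congr 1; abel
  rw [e1, e2, h1, h1, h2, h2, ← phase_mul M N P]; ring

theorem glueLow_glueWaist (e : Strings p → ℂ) (f : PantsDiagram p) (g : Strings p → ℂ) :
    glueLow M N e (glueWaist M N P f g) = glueWaist M N P (glueLow M N e f) g := by
  funext x
  simp only [glueLow, glueWaist, Finset.mul_sum, Finset.sum_mul]
  rw [Finset.sum_comm]
  refine Finset.sum_congr rfl fun t _ => Finset.sum_congr rfl fun s _ => ?_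
  have e1 : x.1 - s - t = x.1 - t - s := by abel
  have h1 : phase M N s (x.1 - s) = phase M N s (x.1 - t - s) * phase M N s t := by
    rw [← phase_add_right]; congr 1; abel
  have h2 : phase M N (x.1 - t) t = phase M N (x.1 - t - s) t * phase M N s t := by
    rw [← phase_add_left, sub_add_cancel]
  rw [e1, h1, h2]; ring

theorem glueUp_glueWaist (e : Strings p → ℂ) (f : PantsDiagram p) (g : Strings p → ℂ) :
    glueUp N P e (glueWaist M N P f g) = glueWaist M N P (glueUp N P e f) g := by
  funext x
  simp only [glueUp, glueWaist, Finset.mul_sum, Finset.sum_mul]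
  rw [Finset.sum_comm]
  refine Finset.sum_congr rfl fun t _ => Finset.sum_congr rfl fun s _ => ?_
  have e1 : x.2 - s - t = x.2 - t - s := by abel
  have h1 : phase N P s (x.2 - s) = phase N P s (x.2 - t - s) * phase N P s t := by
    rw [← phase_add_right]; congr 1; abel
  have h2 : phase N P (x.2 - t) t = phase N P (x.2 - t - s) t * phase N P s t := by
    rw [← phase_add_left, sub_add_cancel]
  rw [e1, h1, h2]; ring

theorem glueWaist_mem {A : Ann M N} {B : Ann N P} {X Y : Ann M P} {f : PantsDiagram p}
    {g : Strings p → ℂ} (hf : f ∈ pants A B X) (hg : g ∈ annuli X Y) :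
    glueWaist M N P f g ∈ pants A B Y := by
  intro a b hab
  obtain ⟨s, -, hs⟩ := Finset.exists_ne_zero_of_sum_ne_zero hab
  have h1 := hf (a - s) (b - s) (by intro h; simp [h] at hs)
  have h2 := hg s (by intro h; simp [h] at hs)
  refine ⟨?_, ?_, ?_⟩
  · rw [← h2.1, ← h1.1, ← Wall.act_add, sub_add_cancel]
  · have := congrArg (N.act s) h1.2.1
    rwa [← Wall.act_add, ← Wall.act_add, sub_add_cancel, sub_add_cancel] at this
  · rw [← h2.2, ← h1.2.2, ← Wall.act_add, sub_add_cancel]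

/-- The pairs of pants that absorb the idempotent `E` on the lower leg and `E'` on the upper leg,
with labels `X` on the waist. -/
def legPants (E : Interface M N) (E' : Interface N P) (X : Ann M P) :
    Submodule ℂ (PantsDiagram p) where
  carrier := {f | f ∈ pants E.X E'.X X ∧ glueLow M N E.p.1 f = f ∧ glueUp N P E'.p.1 f = f}
  zero_mem' := ⟨zero_mem _, by funext x; simp [glueLow], by funext x; simp [glueUp]⟩
  add_mem' := by
    rintro f g ⟨hf, hf1, hf2⟩ ⟨hg, hg1, hg2⟩
    exact ⟨add_mem hf hg, by rw [glueLow_add, hf1, hg1], by rw [glueUp_add, hf2, hg2]⟩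
  smul_mem' := by
    rintro c f ⟨hf, hf1, hf2⟩
    exact ⟨Submodule.smul_mem _ c hf, by rw [glueLow_smul, hf1], by rw [glueUp_smul, hf2]⟩

/-- The vertical fusion `E ∘ E'` of the lower defect `E` with the upper defect `E'`, as a
representation of the annular category of `M` and `P`. Annuli act by gluing on the waist. -/
def verticalFusion (E : Interface M N) (E' : Interface N P) : Ann M P ⥤ ModuleCat.{0} ℂ where
  obj X := ModuleCat.of ℂ (legPants E E' X)
  map {X Y} g := ModuleCat.ofHom
    { toFun := fun f => ⟨glueWaist M N P f.1 g.1, glueWaist_mem f.2.1 g.2, by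
          rw [glueLow_glueWaist, f.2.2.1], by rw [glueUp_glueWaist, f.2.2.2]⟩
      map_add' := fun f f' => Subtype.ext (glueWaist_add f.1 f'.1 g.1)
      map_smul' := fun c f => Subtype.ext (glueWaist_smul c f.1 g.1) }
  map_id X := by
    exact ModuleCat.hom_ext (LinearMap.ext fun f => Subtype.ext (glueWaist_unit f.1))
  map_comp g h := by
    exact ModuleCat.hom_ext (LinearMap.ext fun f => Subtype.ext (glueWaist_glue f.1 g.1 h.1))

/-- Representations of the annular category have finite direct sums. -/
instance : HasFiniteBiproducts (Ann M N ⥤ ModuleCat.{0} ℂ) :=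
  HasFiniteBiproducts.of_hasFiniteProducts

/-- The pairs of pants that absorb `E` and `E'` on the legs and `G` on the waist. -/
def fusionSpace (E : Interface M N) (E' : Interface N P) (G : Interface M P) :
    Submodule ℂ (PantsDiagram p) where
  carrier := {f | f ∈ legPants E E' G.X ∧ glueWaist M N P f G.p.1 = f}
  zero_mem' := ⟨zero_mem _, by funext x; simp [glueWaist]⟩
  add_mem' := by
    rintro f g ⟨hf, hf1⟩ ⟨hg, hg1⟩
    exact ⟨add_mem hf hg, by rw [glueWaist_add, hf1, hg1]⟩
  smul_mem' := by
    rintro c f ⟨hf, hf1⟩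
    exact ⟨Submodule.smul_mem _ c hf, by rw [glueWaist_smul, hf1]⟩

/-! ## The simple binary interface defects -/

/-- Labels of the simple defects. `XX` and `FF` are the defects `X_k|X_k` and `F_q|F_q` with two
labels, `XX'` and `FF'` are the unlabelled defects between different walls. -/
inductive Defect (p : ℕ) : Wall p → Wall p → Type
  | TT (a b : ZMod p) : Defect p .T .T
  | TL (a : ZMod p) : Defect p .T .L
  | TR (a : ZMod p) : Defect p .T .R
  | TF₀ : Defect p .T .F₀
  | TX (l : (ZMod p)ˣ) (a : ZMod p) : Defect p .T (.X l)
  | TF (r : (ZMod p)ˣ) : Defect p .T (.F r)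
  | LT (a : ZMod p) : Defect p .L .T
  | LL (a x : ZMod p) : Defect p .L .L
  | LR : Defect p .L .R
  | LF₀ (x : ZMod p) : Defect p .L .F₀
  | LX (l : (ZMod p)ˣ) : Defect p .L (.X l)
  | LF (r : (ZMod p)ˣ) (x : ZMod p) : Defect p .L (.F r)
  | RT (a : ZMod p) : Defect p .R .T
  | RL : Defect p .R .L
  | RR (a x : ZMod p) : Defect p .R .R
  | RF₀ (x : ZMod p) : Defect p .R .F₀
  | RX (l : (ZMod p)ˣ) : Defect p .R (.X l)
  | RF (r : (ZMod p)ˣ) (x : ZMod p) : Defect p .R (.F r)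
  | F₀T : Defect p .F₀ .T
  | F₀L (x : ZMod p) : Defect p .F₀ .L
  | F₀R (x : ZMod p) : Defect p .F₀ .R
  | F₀F₀ (x y : ZMod p) : Defect p .F₀ .F₀
  | F₀X (l : (ZMod p)ˣ) (x : ZMod p) : Defect p .F₀ (.X l)
  | F₀F (r : (ZMod p)ˣ) : Defect p .F₀ (.F r)
  | XT (k : (ZMod p)ˣ) (a : ZMod p) : Defect p (.X k) .T
  | XL (k : (ZMod p)ˣ) : Defect p (.X k) .L
  | XR (k : (ZMod p)ˣ) : Defect p (.X k) .R
  | XF₀ (k : (ZMod p)ˣ) (x : ZMod p) : Defect p (.X k) .F₀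
  | XX (k l : (ZMod p)ˣ) (h : k = l) (a x : ZMod p) : Defect p (.X k) (.X l)
  | XX' (k l : (ZMod p)ˣ) (h : k ≠ l) : Defect p (.X k) (.X l)
  | XF (k r : (ZMod p)ˣ) (x : ZMod p) : Defect p (.X k) (.F r)
  | FT (q : (ZMod p)ˣ) : Defect p (.F q) .T
  | FL (q : (ZMod p)ˣ) (x : ZMod p) : Defect p (.F q) .L
  | FR (q : (ZMod p)ˣ) (x : ZMod p) : Defect p (.F q) .R
  | FF₀ (q : (ZMod p)ˣ) : Defect p (.F q) .F₀
  | FX (q l : (ZMod p)ˣ) (x : ZMod p) : Defect p (.F q) (.X l)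
  | FF (q r : (ZMod p)ˣ) (h : q = r) (x y : ZMod p) : Defect p (.F q) (.F r)
  | FF' (q r : (ZMod p)ˣ) (h : q ≠ r) : Defect p (.F q) (.F r)

/-- The cochain `Θ_{x,a}`: `(-1)^(g x) i^(a g)` for `p = 2` (with `g, x ∈ {0, 1}`) and
`ω^(g x + a g² / 2)` for odd `p`. -/
def Theta (x : ZMod p) (a : ℤ) (g : ZMod p) : ℂ :=
  if p = 2 then (-1) ^ (g.val * x.val) * Complex.I ^ (a * g.val)
  else root (g * x + (a : ZMod p) * g ^ 2 * (2 : ZMod p)⁻¹)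

/-- The combination of strings `1/|G| ∑ g, χ g • [φ g]`. -/
def average {G : Type} [Fintype G] (φ : G → Strings p) (χ : G → ℂ) : Strings p → ℂ :=
  (Fintype.card G : ℂ)⁻¹ • ∑ g, χ g • Pi.single (φ g) 1

/-- The combination of strings `1/p ∑ g, χ g • [u g, v g]`. -/
def lineAverage (u v : ZMod p) (χ : ZMod p → ℂ) : Strings p → ℂ :=
  average (fun g : ZMod p => (u * g, v * g)) χ

/-- The pair of simple objects that carries the idempotent of a defect. -/
def Defect.obj : {M N : Wall p} → Defect p M N → Ann M N
  | _, _, .TT a b => ⟨Wall.base _, (a, b)⟩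
  | _, _, .TL a => ⟨Wall.base _, a⟩
  | _, _, .TR a => ⟨Wall.base _, a⟩
  | _, _, .TX _ a => ⟨Wall.base _, a⟩
  | _, _, .LT a => ⟨Wall.base _, (0, a)⟩
  | _, _, .RT a => ⟨Wall.base _, (a, 0)⟩
  | _, _, .XT _ a => ⟨Wall.base _, (a, 0)⟩
  | _, _, .LL a _ => ⟨Wall.base _, a⟩
  | _, _, .RR a _ => ⟨Wall.base _, a⟩
  | _, _, .XX _ _ _ a _ => ⟨Wall.base _, a⟩
  | _, _, _ => ⟨Wall.base _, Wall.base _⟩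

/-- The annular diagram of a defect; the annulus without strings is `Pi.single 0 1`. -/
def Defect.diagram : {M N : Wall p} → Defect p M N → Strings p → ℂ
  | _, _, .LL _ x => lineAverage 1 0 fun g => root (g * x)
  | _, _, .LF₀ x => lineAverage 1 0 fun g => root (g * x)
  | _, _, .LF _ x => lineAverage 1 0 fun g => root (g * x)
  | _, _, .RR _ x => lineAverage 0 (-1) fun g => root (g * x)
  | _, _, .RF₀ x => lineAverage 0 (-1) fun g => root (g * x)
  | _, _, .RF _ x => lineAverage 0 (-1) fun g => root (g * x)
  | _, _, .F₀L x => lineAverage 1 0 fun g => root (g * x)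
  | _, _, .F₀R x => lineAverage 0 (-1) fun g => root (g * x)
  | _, _, .F₀F₀ x y =>
      average (fun g : ZMod p × ZMod p => (g.1, -g.2)) fun g => root (g.1 * x + g.2 * y)
  | _, _, .F₀X l x => lineAverage 1 (-(l⁻¹ : (ZMod p)ˣ)) fun g => root (g * x)
  | _, _, .F₀F _ => lineAverage 0 (-1) fun _ => 1
  | _, _, .XF₀ k x => lineAverage 1 (-(k⁻¹ : (ZMod p)ˣ)) fun g => root (g * x)
  | _, _, .XX k _ _ _ x => lineAverage k (-1) fun g => root (g * x)
  | _, _, .XF k r x => lineAverage k (-1) (Theta x ((k : ZMod p).val * (r : ZMod p).val))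
  | _, _, .FL _ x => lineAverage 1 0 fun g => root (g * x)
  | _, _, .FR _ x => lineAverage 0 (-1) fun g => root (g * x)
  | _, _, .FF₀ _ => lineAverage 0 (-1) fun _ => 1
  | _, _, .FX q l x => lineAverage l (-1) (Theta x (-((q : ZMod p).val * (l : ZMod p).val)))
  | _, _, .FF _ _ _ x y =>
      average (fun g : ZMod p × ZMod p => (g.1, -g.2)) fun g => root (g.1 * x + g.2 * y)
  | _, _, .FF' _ _ _ => lineAverage 0 (-1) fun _ => 1
  | _, _, _ => Pi.single 0 1

theorem average_mem {G : Type} [Fintype G] {A : Ann M N} (φ : G → Strings p) (χ : G → ℂ)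
    (h : ∀ g, M.act (φ g) A.low = A.low ∧ N.act (φ g) A.up = A.up) :
    average φ χ ∈ annuli A A := by
  refine Submodule.smul_mem _ _ (Submodule.sum_mem _ fun g _ => Submodule.smul_mem _ _ ?_)
  intro s hs
  have : s = φ g := by
    by_contra h'; exact hs (Pi.single_eq_of_ne h' _)
  rw [this]; exact h g

theorem single_glue_single (s t : Strings p) :
    glue M N (Pi.single s 1) (Pi.single t 1) = phase M N s t • Pi.single (s + t) 1 := by
  funext k
  rw [glue, Finset.sum_eq_single s]
  · by_cases h : k = s + t
    · subst h; simp
    · have : k - s ≠ t := fun h' => h (by rw [← h', add_sub_cancel])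
      simp [Pi.single_eq_of_ne this, Pi.single_eq_of_ne h]
  · intro u _ hu; simp [Pi.single_eq_of_ne hu]
  · simp

theorem sum_glue {ι : Type} (S : Finset ι) (f : ι → Strings p → ℂ) (g : Strings p → ℂ) :
    glue M N (∑ i ∈ S, f i) g = ∑ i ∈ S, glue M N (f i) g := by
  classical
  induction S using Finset.induction_on with
  | empty => funext k; simp [glue]
  | insert a S ha ih => rw [Finset.sum_insert ha, Finset.sum_insert ha, add_glue, ih]

theorem glue_sum {ι : Type} (S : Finset ι) (f : Strings p → ℂ) (g : ι → Strings p → ℂ) :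
    glue M N f (∑ i ∈ S, g i) = ∑ i ∈ S, glue M N f (g i) := by
  classical
  induction S using Finset.induction_on with
  | empty => funext k; simp [glue]
  | insert a S ha ih => rw [Finset.sum_insert ha, Finset.sum_insert ha, glue_add, ih]

theorem average_idem {G : Type} [AddCommGroup G] [Fintype G] (φ : G → Strings p) (χ : G → ℂ)
    (hφ : ∀ g h, φ (g + h) = φ g + φ h)
    (hχ : ∀ g h, χ g * χ h * phase M N (φ g) (φ h) = χ (g + h)) :
    glue M N (average φ χ) (average φ χ) = average φ χ := by
  have hc : (Fintype.card G : ℂ) ≠ 0 := by simp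
  have key : glue M N (∑ g, χ g • Pi.single (φ g) 1) (∑ g, χ g • Pi.single (φ g) 1) =
      (Fintype.card G : ℂ) • ∑ g, χ g • (Pi.single (φ g) 1 : Strings p → ℂ) := by
    rw [sum_glue]
    have : ∀ g : G, glue M N (χ g • Pi.single (φ g) 1) (∑ g, χ g • Pi.single (φ g) 1) =
        ∑ g, χ g • (Pi.single (φ g) 1 : Strings p → ℂ) := by
      intro g
      rw [glue_sum]
      refine Fintype.sum_equiv (Equiv.addLeft g) _ _ fun h => ?_
      rw [smul_glue, glue_smul, single_glue_single, Equiv.coe_addLeft, ← hχ, hφ, smul_smul,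
        smul_smul]
    rw [Finset.sum_congr rfl fun g _ => this g, Finset.sum_const, Finset.card_univ,
      ← Nat.cast_smul_eq_nsmul ℂ]
  rw [average, smul_glue, glue_smul, key, smul_smul _ (Fintype.card G : ℂ), inv_mul_cancel₀ hc,
    one_smul]

theorem sign_mod_two : ∀ g h x : ZMod 2, (-1 : ℤ) ^ (g.val * x.val) * (-1) ^ (h.val * x.val) =
    (-1) ^ ((g + h).val * x.val) := by decide

theorem zero_or_one : ∀ g : ZMod 2, g = 0 ∨ g = 1 := by decide

theorem Theta_mul (x : ZMod p) (a : ℤ) (g h : ZMod p) :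
    Theta x a g * Theta x a h * root ((a : ZMod p) * (g * h)) = Theta x a (g + h) := by
  unfold Theta
  split_ifs with hp
  · subst hp
    have hr : root (1 : ZMod 2) = -1 := by
      have := ZMod.stdAddChar_coe (N := 2) 1
      simp only [Int.cast_one, Nat.cast_ofNat, mul_one] at this
      rw [root, this, mul_assoc, mul_div_cancel_left₀ _ (two_ne_zero), Complex.exp_pi_mul_I]
    have key : (-1 : ℂ) ^ (g.val * x.val) * (-1) ^ (h.val * x.val) =
        (-1) ^ ((g + h).val * x.val) := by
      exact_mod_cast congrArg (Int.cast : ℤ → ℂ) (sign_mod_two g h x)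
    have key2 : Complex.I ^ (a * g.val) * Complex.I ^ (a * h.val) * root ((a : ZMod 2) * (g * h)) =
        Complex.I ^ (a * (g + h).val) := by
      have hI : Complex.I ^ a * Complex.I ^ a * root (a : ZMod 2) = 1 := by
        rw [← mul_zpow, Complex.I_mul_I]
        rcases Int.even_or_odd a with ha | ha
        · rw [ha.neg_one_zpow, (ZMod.intCast_eq_zero_iff_even).2 ha, root_zero, mul_one]
        · rw [ha.neg_one_zpow, (ZMod.intCast_eq_one_iff_odd).2 ha, hr]; norm_num
      have v0 : (0 : ZMod 2).val = 0 := rfl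
      have v1 : (1 : ZMod 2).val = 1 := rfl
      have v2 : (1 : ZMod 2) + 1 = 0 := rfl
      rcases zero_or_one g with rfl | rfl <;> rcases zero_or_one h with rfl | rfl
      · rw [add_zero, v0, mul_zero, mul_zero, root_zero]; simp
      · rw [zero_add, zero_mul, mul_zero, root_zero, v0]; simp
      · rw [add_zero, mul_zero, mul_zero, root_zero, v0]; simp
      · rw [v2, mul_one, mul_one, v0, v1]; simpa using hI
    rw [← key, ← key2]; ring
  · have h2 : (2 : ZMod p) ≠ 0 := by
      intro h
      have : ((2 : ℕ) : ZMod p) = 0 := by exact_mod_cast h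
      rw [ZMod.natCast_eq_zero_iff] at this
      exact hp ((Nat.prime_dvd_prime_iff_eq (Fact.out : p.Prime) Nat.prime_two).1 this)
    rw [← root_add, ← root_add]
    congr 1
    field_simp
    ring

theorem root_char (x g h : ZMod p) : root (g * x) * root (h * x) = root ((g + h) * x) := by
  rw [← root_add]; congr 1; ring

theorem Defect.diagram_mem (d : Defect p M N) : d.diagram ∈ annuli d.obj d.obj := by
  cases d
  case F₀X l x =>
    refine average_mem _ _ fun g => ⟨rfl, ?_⟩
    change (0 : ZMod p) + 1 * g + (l : ZMod p) * (-((l⁻¹ : (ZMod p)ˣ) : ZMod p) * g) = 0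
    have := l.mul_inv; linear_combination (-g) * this
  case XF₀ l x =>
    refine average_mem _ _ fun g => ⟨?_, rfl⟩
    change (0 : ZMod p) + 1 * g + (l : ZMod p) * (-((l⁻¹ : (ZMod p)ˣ) : ZMod p) * g) = 0
    have := l.mul_inv; linear_combination (-g) * this
  case XX k l h a x =>
    subst h
    refine average_mem _ _ fun g => ⟨?_, ?_⟩
    · change (0 : ZMod p) + k * g + (k : ZMod p) * (-1 * g) = 0
      ring
    · change a + k * g + (k : ZMod p) * (-1 * g) = a
      ring
  case XF k r x =>
    refine average_mem _ _ fun g => ⟨?_, rfl⟩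
    change (0 : ZMod p) + k * g + (k : ZMod p) * (-1 * g) = 0
    ring
  case FX k r x =>
    refine average_mem _ _ fun g => ⟨rfl, ?_⟩
    change (0 : ZMod p) + r * g + (r : ZMod p) * (-1 * g) = 0
    ring
  case LL a x =>
    exact average_mem _ _ fun g => ⟨by change (0 : ZMod p) + 0 * g = 0; ring,
      by change a + 0 * g = a; ring⟩
  case RR a x =>
    exact average_mem _ _ fun g => ⟨by change (0 : ZMod p) + 0 * g = 0; ring,
      by change a + 0 * g = a; ring⟩
  all_goals first
    | exact unit_mem _
    | exact average_mem _ _ fun g => ⟨rfl, rfl⟩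
    | exact average_mem _ _ fun g => ⟨by change (0 : ZMod p) + 0 * g = 0; ring, rfl⟩
    | exact average_mem _ _ fun g => ⟨rfl, by change (0 : ZMod p) + 0 * g = 0; ring⟩

theorem lineAverage_idem (u v : ZMod p) (χ : ZMod p → ℂ)
    (hχ : ∀ g h, χ g * χ h * phase M N (u * g, v * g) (u * h, v * h) = χ (g + h)) :
    glue M N (lineAverage u v χ) (lineAverage u v χ) = lineAverage u v χ :=
  average_idem _ _ (fun g h => by ext <;> simp [mul_add]) hχ

theorem Defect.diagram_idem (d : Defect p M N) : glue M N d.diagram d.diagram = d.diagram := by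
  cases d <;> simp only [Defect.diagram]
  case XF k r x =>
    refine lineAverage_idem _ _ _ fun g h => ?_
    rw [← Theta_mul]
    congr 1
    simp only [phase, Wall.assoc]
    rw [one_div, eq_comm]
    refine eq_inv_of_mul_eq_one_left ?_
    rw [← root_add, ← root_zero (p := p)]
    congr 1
    simp only [Int.cast_mul, Int.cast_natCast, ZMod.natCast_zmod_val]
    ring
  case FX q l x =>
    refine lineAverage_idem _ _ _ fun g h => ?_
    rw [← Theta_mul]
    congr 1
    simp only [phase, Wall.assoc, div_one]
    congr 1
    simp only [Int.cast_neg, Int.cast_mul, Int.cast_natCast, ZMod.natCast_zmod_val]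
    ring
  case F₀F₀ x y =>
    refine average_idem _ _ (fun g h => by ext <;> simp; ring) fun g h => ?_
    rw [← root_add]; simp only [phase, Wall.assoc, div_one, mul_one]
    congr 1; simp only [Prod.fst_add, Prod.snd_add]; ring
  case FF q r h x y =>
    subst h
    refine average_idem _ _ (fun g h => by ext <;> simp; ring) fun g h => ?_
    rw [← root_add, phase, div_self (Wall.assoc_ne_zero _ _ _), mul_one]
    congr 1; simp only [Prod.fst_add, Prod.snd_add]; ring
  all_goals first
    | rw [unit_glue]
    | exact lineAverage_idem _ _ _ fun g h => by
        rw [root_char]; simp [phase, Wall.assoc, root_zero]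
    | exact lineAverage_idem _ _ _ fun g h => by
        simp [phase, Wall.assoc, root_zero]

/-- The idempotent of a defect, as an object of the Karoubi envelope. -/
def Defect.interface (d : Defect p M N) : Interface M N where
  X := d.obj
  p := ⟨d.diagram, d.diagram_mem⟩
  idem := Subtype.ext d.diagram_idem

instance : DecidableEq (Defect p M N) := Classical.decEq _

/-! ## The vertical fusion tables -/

/-- The direct sum over all values of one label. -/
def each {p : ℕ} [Fact p.Prime] {M N : Wall p} (f : ZMod p → Defect p M N) :
    Multiset (Defect p M N) := (Finset.univ : Finset (ZMod p)).val.map f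

/-- The direct sum over all values of two labels. -/
def each₂ {p : ℕ} [Fact p.Prime] {M N : Wall p} (f : ZMod p → ZMod p → Defect p M N) :
    Multiset (Defect p M N) :=
  (Finset.univ : Finset (ZMod p × ZMod p)).val.map fun x => f x.1 x.2

/-- `⊕_{α,ζ} X_k|X_k` if `k = m`, and `p · X_k|X_m` if `k ≠ m`. -/
def sumXX (k m : (ZMod p)ˣ) : Multiset (Defect p (.X k) (.X m)) :=
  if h : k = m then each₂ fun α ζ => .XX k m h α ζ else p • {.XX' k m h}

/-- `⊕_{ζ,η} F_q|F_q` if `q = s`, and `p · F_q|F_s` if `q ≠ s`. -/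
def sumFF (q s : (ZMod p)ˣ) : Multiset (Defect p (.F q) (.F s)) :=
  if h : q = s then each₂ fun ζ η => .FF q s h ζ η else p • {.FF' q s h}

/-- `⊕_α X_k|X_k` with labels `f α` if `k = m`, and one `X_k|X_m` if `k ≠ m`. -/
def lineXX (k m : (ZMod p)ˣ) (f : ZMod p → ZMod p × ZMod p) : Multiset (Defect p (.X k) (.X m)) :=
  if h : k = m then each fun α => .XX k m h (f α).1 (f α).2 else {.XX' k m h}

/-- `⊕_ζ F_q|F_q` with labels `f ζ` if `q = s`, and one `F_q|F_s` if `q ≠ s`. -/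
def lineFF (q s : (ZMod p)ˣ) (f : ZMod p → ZMod p × ZMod p) : Multiset (Defect p (.F q) (.F s)) :=
  if h : q = s then each fun ζ => .FF q s h (f ζ).1 (f ζ).2 else {.FF' q s h}

/-- Fusion along `T`. -/
def fuseT : {M P : Wall p} → Defect p M .T → Defect p .T P → Multiset (Defect p M P)
  | _, _, .TT a b, .TT c d => {.TT (a + c) (b + d)}
  | _, _, .TT _ b, .TL c => {.TL (b + c)}
  | _, _, .TT a _, .TR c => {.TR (a + c)}
  | _, _, .TT _ _, .TF₀ => {.TF₀}
  | _, _, .TT a b, .TX m c => {.TX m (a + c + m * b)}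
  | _, _, .TT _ _, .TF s => {.TF s}
  | _, _, .LT a, .TT _ d => {.LT (a + d)}
  | _, _, .LT a, .TL c => each fun β => .LL (a + c) β
  | _, _, .LT _, .TR _ => {.LR}
  | _, _, .LT _, .TF₀ => each fun α => .LF₀ α
  | _, _, .LT _, .TX m _ => {.LX m}
  | _, _, .LT _, .TF s => each fun α => .LF s α
  | _, _, .RT a, .TT c _ => {.RT (a + c)}
  | _, _, .RT _, .TL _ => {.RL}
  | _, _, .RT a, .TR c => each fun β => .RR (a + c) β
  | _, _, .RT _, .TF₀ => each fun α => .RF₀ α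
  | _, _, .RT _, .TX m _ => {.RX m}
  | _, _, .RT _, .TF s => each fun α => .RF s α
  | _, _, .F₀T, .TT _ _ => {.F₀T}
  | _, _, .F₀T, .TL _ => each fun α => .F₀L α
  | _, _, .F₀T, .TR _ => each fun α => .F₀R α
  | _, _, .F₀T, .TF₀ => each₂ fun α β => .F₀F₀ α β
  | _, _, .F₀T, .TX m _ => each fun α => .F₀X m α
  | _, _, .F₀T, .TF s => p • {.F₀F s}
  | _, _, .XT k a, .TT c d => {.XT k (a + c + k * d)}
  | _, _, .XT k _, .TL _ => {.XL k}
  | _, _, .XT k _, .TR _ => {.XR k}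
  | _, _, .XT k _, .TF₀ => each fun α => .XF₀ k α
  | _, _, .XT k a, .TX m c => lineXX k m fun β => (a + c, β)
  | _, _, .XT k _, .TF s => each fun α => .XF k s α
  | _, _, .FT q, .TT _ _ => {.FT q}
  | _, _, .FT q, .TL _ => each fun α => .FL q α
  | _, _, .FT q, .TR _ => each fun α => .FR q α
  | _, _, .FT q, .TF₀ => p • {.FF₀ q}
  | _, _, .FT q, .TX m _ => each fun α => .FX q m α
  | _, _, .FT q, .TF s => sumFF q s

/-- Fusion along `L`. -/
def fuseL : {M P : Wall p} → Defect p M .L → Defect p .L P → Multiset (Defect p M P)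
  | _, _, .TL a, .LT c => each fun α => .TT α (a + c)
  | _, _, .TL a, .LL c _ => {.TL (a + c)}
  | _, _, .TL _, .LR => each fun α => .TR α
  | _, _, .TL _, .LF₀ _ => {.TF₀}
  | _, _, .TL _, .LX m => each fun α => .TX m α
  | _, _, .TL _, .LF s _ => {.TF s}
  | _, _, .LL a _, .LT c => {.LT (a + c)}
  | _, _, .LL a x, .LL c z => {.LL (a + c) (x + z)}
  | _, _, .LL _ _, .LR => {.LR}
  | _, _, .LL _ x, .LF₀ z => {.LF₀ (x + z)}
  | _, _, .LL _ _, .LX m => {.LX m}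
  | _, _, .LL a x, .LF s z => {.LF s (x + z + s * a)}
  | _, _, .RL, .LT _ => each fun α => .RT α
  | _, _, .RL, .LL _ _ => {.RL}
  | _, _, .RL, .LR => each₂ fun α ζ => .RR α ζ
  | _, _, .RL, .LF₀ _ => each fun ζ => .RF₀ ζ
  | _, _, .RL, .LX m => p • {.RX m}
  | _, _, .RL, .LF s _ => each fun ζ => .RF s ζ
  | _, _, .F₀L _, .LT _ => {.F₀T}
  | _, _, .F₀L x, .LL _ z => {.F₀L (x + z)}
  | _, _, .F₀L _, .LR => each fun ζ => .F₀R ζ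
  | _, _, .F₀L x, .LF₀ z => each fun η => .F₀F₀ (x + z) η
  | _, _, .F₀L _, .LX m => each fun ζ => .F₀X m ζ
  | _, _, .F₀L _, .LF s _ => {.F₀F s}
  | _, _, .XL k, .LT _ => each fun α => .XT k α
  | _, _, .XL k, .LL _ _ => {.XL k}
  | _, _, .XL k, .LR => p • {.XR k}
  | _, _, .XL k, .LF₀ _ => each fun ζ => .XF₀ k ζ
  | _, _, .XL k, .LX m => sumXX k m
  | _, _, .XL k, .LF s _ => each fun α => .XF k s α
  | _, _, .FL q _, .LT _ => {.FT q}
  | _, _, .FL q x, .LL c z => {.FL q (x + z + q * c)}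
  | _, _, .FL q _, .LR => each fun ζ => .FR q ζ
  | _, _, .FL q _, .LF₀ _ => {.FF₀ q}
  | _, _, .FL q _, .LX m => each fun ζ => .FX q m ζ
  | _, _, .FL q x, .LF s z => lineFF q s fun α => (x + z, α)

/-- Fusion along `R`. -/
def fuseR : {M P : Wall p} → Defect p M .R → Defect p .R P → Multiset (Defect p M P)
  | _, _, .TR a, .RT c => each fun β => .TT (a + c) β
  | _, _, .TR _, .RL => each fun α => .TL α
  | _, _, .TR a, .RR c _ => {.TR (a + c)}
  | _, _, .TR _, .RF₀ _ => {.TF₀}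
  | _, _, .TR _, .RX m => each fun α => .TX m α
  | _, _, .TR _, .RF s _ => {.TF s}
  | _, _, .LR, .RT _ => each fun α => .LT α
  | _, _, .LR, .RL => each₂ fun α ζ => .LL α ζ
  | _, _, .LR, .RR _ _ => {.LR}
  | _, _, .LR, .RF₀ _ => each fun ζ => .LF₀ ζ
  | _, _, .LR, .RX m => p • {.LX m}
  | _, _, .LR, .RF s _ => each fun ζ => .LF s ζ
  | _, _, .RR a _, .RT c => {.RT (a + c)}
  | _, _, .RR _ _, .RL => {.RL}
  | _, _, .RR a x, .RR c z => {.RR (a + c) (x + z)}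
  | _, _, .RR _ x, .RF₀ z => {.RF₀ (x + z)}
  | _, _, .RR _ _, .RX m => {.RX m}
  | _, _, .RR a x, .RF s z => {.RF s (x + z + s * a)}
  | _, _, .F₀R _, .RT _ => {.F₀T}
  | _, _, .F₀R _, .RL => each fun ζ => .F₀L ζ
  | _, _, .F₀R x, .RR _ z => {.F₀R (x + z)}
  | _, _, .F₀R x, .RF₀ z => each fun ζ => .F₀F₀ ζ (x + z)
  | _, _, .F₀R _, .RX m => each fun ζ => .F₀X m ζ
  | _, _, .F₀R _, .RF s _ => {.F₀F s}
  | _, _, .XR k, .RT _ => each fun α => .XT k α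
  | _, _, .XR k, .RL => p • {.XL k}
  | _, _, .XR k, .RR _ _ => {.XR k}
  | _, _, .XR k, .RF₀ _ => each fun ζ => .XF₀ k ζ
  | _, _, .XR k, .RX m => sumXX k m
  | _, _, .XR k, .RF s _ => each fun ζ => .XF k s ζ
  | _, _, .FR q _, .RT _ => {.FT q}
  | _, _, .FR q _, .RL => each fun ζ => .FL q ζ
  | _, _, .FR q x, .RR c z => {.FR q (x + z + q * c)}
  | _, _, .FR q _, .RF₀ _ => {.FF₀ q}
  | _, _, .FR q _, .RX m => each fun ζ => .FX q m ζ
  | _, _, .FR q x, .RF s z => lineFF q s fun ζ => (ζ, x + z)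

/-- Fusion along `F₀`. -/
def fuseF₀ : {M P : Wall p} → Defect p M .F₀ → Defect p .F₀ P → Multiset (Defect p M P)
  | _, _, .TF₀, .F₀T => each₂ fun α β => .TT α β
  | _, _, .TF₀, .F₀L _ => each fun α => .TL α
  | _, _, .TF₀, .F₀R _ => each fun α => .TR α
  | _, _, .TF₀, .F₀F₀ _ _ => {.TF₀}
  | _, _, .TF₀, .F₀X m _ => each fun α => .TX m α
  | _, _, .TF₀, .F₀F s => p • {.TF s}
  | _, _, .LF₀ _, .F₀T => each fun α => .LT α
  | _, _, .LF₀ x, .F₀L z => each fun α => .LL α (x + z)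
  | _, _, .LF₀ _, .F₀R _ => {.LR}
  | _, _, .LF₀ x, .F₀F₀ z _ => {.LF₀ (x + z)}
  | _, _, .LF₀ _, .F₀X m _ => {.LX m}
  | _, _, .LF₀ _, .F₀F s => each fun ζ => .LF s ζ
  | _, _, .RF₀ _, .F₀T => each fun α => .RT α
  | _, _, .RF₀ _, .F₀L _ => {.RL}
  | _, _, .RF₀ x, .F₀R z => each fun α => .RR α (x + z)
  | _, _, .RF₀ x, .F₀F₀ _ w => {.RF₀ (x + w)}
  | _, _, .RF₀ _, .F₀X m _ => {.RX m}
  | _, _, .RF₀ _, .F₀F s => each fun ζ => .RF s ζ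
  | _, _, .F₀F₀ _ _, .F₀T => {.F₀T}
  | _, _, .F₀F₀ x _, .F₀L z => {.F₀L (x + z)}
  | _, _, .F₀F₀ _ y, .F₀R z => {.F₀R (y + z)}
  | _, _, .F₀F₀ x y, .F₀F₀ z w => {.F₀F₀ (x + z) (y + w)}
  | _, _, .F₀F₀ x y, .F₀X m z => {.F₀X m (x + z + (m⁻¹ : (ZMod p)ˣ) * y)}
  | _, _, .F₀F₀ _ _, .F₀F s => {.F₀F s}
  | _, _, .XF₀ k _, .F₀T => each fun α => .XT k α
  | _, _, .XF₀ k _, .F₀L _ => {.XL k}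
  | _, _, .XF₀ k _, .F₀R _ => {.XR k}
  | _, _, .XF₀ k x, .F₀F₀ z w => {.XF₀ k (x + z + (k⁻¹ : (ZMod p)ˣ) * w)}
  | _, _, .XF₀ k x, .F₀X m z => lineXX k m fun α => (α, k * (x + z))
  | _, _, .XF₀ k _, .F₀F s => each fun ζ => .XF k s ζ
  | _, _, .FF₀ q, .F₀T => p • {.FT q}
  | _, _, .FF₀ q, .F₀L _ => each fun ζ => .FL q ζ
  | _, _, .FF₀ q, .F₀R _ => each fun ζ => .FR q ζ
  | _, _, .FF₀ q, .F₀F₀ _ _ => {.FF₀ q}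
  | _, _, .FF₀ q, .F₀X m _ => each fun ζ => .FX q m ζ
  | _, _, .FF₀ q, .F₀F s => sumFF q s

/-- Fusion along `X_l`. -/
def fuseX {l : (ZMod p)ˣ} :
    {M P : Wall p} → Defect p M (.X l) → Defect p (.X l) P → Multiset (Defect p M P)
  | _, _, .TX _ a, .XT _ c => each fun β => .TT (a + c - l * β) β
  | _, _, .TX _ _, .XL _ => each fun α => .TL α
  | _, _, .TX _ _, .XR _ => each fun α => .TR α
  | _, _, .TX _ _, .XF₀ _ _ => {.TF₀}
  | _, _, .TX _ a, .XX _ m _ c _ => {.TX m (a + c)}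
  | _, _, .TX _ _, .XX' _ m _ => each fun α => .TX m α
  | _, _, .TX _ _, .XF _ s _ => {.TF s}
  | _, _, .LX _, .XT _ _ => each fun α => .LT α
  | _, _, .LX _, .XL _ => each₂ fun α ζ => .LL α ζ
  | _, _, .LX _, .XR _ => p • {.LR}
  | _, _, .LX _, .XF₀ _ _ => each fun ζ => .LF₀ ζ
  | _, _, .LX _, .XX _ m _ _ _ => {.LX m}
  | _, _, .LX _, .XX' _ m _ => p • {.LX m}
  | _, _, .LX _, .XF _ s _ => each fun ζ => .LF s ζ
  | _, _, .RX _, .XT _ _ => each fun α => .RT α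
  | _, _, .RX _, .XL _ => p • {.RL}
  | _, _, .RX _, .XR _ => each₂ fun α ζ => .RR α ζ
  | _, _, .RX _, .XF₀ _ _ => each fun ζ => .RF₀ ζ
  | _, _, .RX _, .XX _ m _ _ _ => {.RX m}
  | _, _, .RX _, .XX' _ m _ => p • {.RX m}
  | _, _, .RX _, .XF _ s _ => each fun ζ => .RF s ζ
  | _, _, .F₀X _ _, .XT _ _ => {.F₀T}
  | _, _, .F₀X _ _, .XL _ => each fun ζ => .F₀L ζ
  | _, _, .F₀X _ _, .XR _ => each fun ζ => .F₀R ζ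
  | _, _, .F₀X _ x, .XF₀ _ z => each fun η => .F₀F₀ (x + z - (l⁻¹ : (ZMod p)ˣ) * η) η
  | _, _, .F₀X _ x, .XX _ m _ _ z => {.F₀X m (x + (l⁻¹ : (ZMod p)ˣ) * z)}
  | _, _, .F₀X _ _, .XX' _ m _ => each fun ζ => .F₀X m ζ
  | _, _, .F₀X _ _, .XF _ s _ => {.F₀F s}
  | _, _, .XX k _ _ a _, .XT _ c => {.XT k (a + c)}
  | _, _, .XX k _ _ _ _, .XL _ => {.XL k}
  | _, _, .XX k _ _ _ _, .XR _ => {.XR k}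
  | _, _, .XX k _ _ _ x, .XF₀ _ z => {.XF₀ k ((l⁻¹ : (ZMod p)ˣ) * x + z)}
  | _, _, .XX k _ h a x, .XX _ m h' c z => {.XX k m (h.trans h') (a + c) (x + z)}
  | _, _, .XX k _ h _ _, .XX' _ m h' => {.XX' k m (fun e => h' (h.symm.trans e))}
  | _, _, .XX k _ _ a x, .XF _ s z => {.XF k s (x + z + a * s)}
  | _, _, .XX' k _ _, .XT _ _ => each fun α => .XT k α
  | _, _, .XX' k _ _, .XL _ => p • {.XL k}
  | _, _, .XX' k _ _, .XR _ => p • {.XR k}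
  | _, _, .XX' k _ _, .XF₀ _ _ => each fun ζ => .XF₀ k ζ
  | _, _, .XX' k _ h, .XX _ m h' _ _ => {.XX' k m (fun e => h (e.trans h'.symm))}
  | _, _, .XX' k _ _, .XX' _ m _ => sumXX k m
  | _, _, .XX' k _ _, .XF _ s _ => each fun ζ => .XF k s ζ
  | _, _, .FX q _ _, .XT _ _ => {.FT q}
  | _, _, .FX q _ _, .XL _ => each fun ζ => .FL q ζ
  | _, _, .FX q _ _, .XR _ => each fun ζ => .FR q ζ
  | _, _, .FX q _ _, .XF₀ _ _ => {.FF₀ q}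
  | _, _, .FX q _ x, .XX _ m _ c z => {.FX q m (x + z + q * c)}
  | _, _, .FX q _ _, .XX' _ m _ => each fun ζ => .FX q m ζ
  | _, _, .FX q _ x, .XF _ s z => lineFF q s fun ζ => (ζ, x + z - l * ζ)

/-- Fusion along `F_r`. -/
def fuseF {r : (ZMod p)ˣ} :
    {M P : Wall p} → Defect p M (.F r) → Defect p (.F r) P → Multiset (Defect p M P)
  | _, _, .TF _, .FT _ => each₂ fun α β => .TT α β
  | _, _, .TF _, .FL _ _ => each fun α => .TL α
  | _, _, .TF _, .FR _ _ => each fun α => .TR α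
  | _, _, .TF _, .FF₀ _ => p • {.TF₀}
  | _, _, .TF _, .FX _ m _ => each fun α => .TX m α
  | _, _, .TF _, .FF _ s _ _ _ => {.TF s}
  | _, _, .TF _, .FF' _ s _ => p • {.TF s}
  | _, _, .LF _ _, .FT _ => each fun α => .LT α
  | _, _, .LF _ x, .FL _ z => each fun α => .LL α (x + z - r * α)
  | _, _, .LF _ _, .FR _ _ => {.LR}
  | _, _, .LF _ _, .FF₀ _ => each fun ζ => .LF₀ ζ
  | _, _, .LF _ _, .FX _ m _ => {.LX m}
  | _, _, .LF _ x, .FF _ s _ z _ => {.LF s (x + z)}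
  | _, _, .LF _ _, .FF' _ s _ => each fun ζ => .LF s ζ
  | _, _, .RF _ _, .FT _ => each fun α => .RT α
  | _, _, .RF _ _, .FL _ _ => {.RL}
  | _, _, .RF _ x, .FR _ z => each fun α => .RR α (x + z - r * α)
  | _, _, .RF _ _, .FF₀ _ => each fun ζ => .RF₀ ζ
  | _, _, .RF _ _, .FX _ m _ => {.RX m}
  | _, _, .RF _ x, .FF _ s _ _ w => {.RF s (x + w)}
  | _, _, .RF _ _, .FF' _ s _ => each fun ζ => .RF s ζ
  | _, _, .F₀F _, .FT _ => p • {.F₀T}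
  | _, _, .F₀F _, .FL _ _ => each fun ζ => .F₀L ζ
  | _, _, .F₀F _, .FR _ _ => each fun ζ => .F₀R ζ
  | _, _, .F₀F _, .FF₀ _ => each₂ fun ζ η => .F₀F₀ ζ η
  | _, _, .F₀F _, .FX _ m _ => each fun α => .F₀X m α
  | _, _, .F₀F _, .FF _ s _ _ _ => {.F₀F s}
  | _, _, .F₀F _, .FF' _ s _ => p • {.F₀F s}
  | _, _, .XF k _ _, .FT _ => each fun α => .XT k α
  | _, _, .XF k _ _, .FL _ _ => {.XL k}
  | _, _, .XF k _ _, .FR _ _ => {.XR k}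
  | _, _, .XF k _ _, .FF₀ _ => each fun ζ => .XF₀ k ζ
  | _, _, .XF k _ x, .FX _ m z => lineXX k m fun α => (α, x + z - r * α)
  | _, _, .XF k _ x, .FF _ s _ z w => {.XF k s (w + x + k * z)}
  | _, _, .XF k _ _, .FF' _ s _ => each fun ζ => .XF k s ζ
  | _, _, .FF q _ _ _ _, .FT _ => {.FT q}
  | _, _, .FF q _ _ x _, .FL _ z => {.FL q (x + z)}
  | _, _, .FF q _ _ _ y, .FR _ z => {.FR q (y + z)}
  | _, _, .FF q _ _ _ _, .FF₀ _ => {.FF₀ q}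
  | _, _, .FF q _ _ x y, .FX _ m z => {.FX q m (y + z + m * x)}
  | _, _, .FF q _ h x y, .FF _ s h' z w => {.FF q s (h.trans h') (x + z) (y + w)}
  | _, _, .FF q _ h _ _, .FF' _ s h' => {.FF' q s (fun e => h' (h.symm.trans e))}
  | _, _, .FF' q _ _, .FT _ => p • {.FT q}
  | _, _, .FF' q _ _, .FL _ _ => each fun ζ => .FL q ζ
  | _, _, .FF' q _ _, .FR _ _ => each fun ζ => .FR q ζ
  | _, _, .FF' q _ _, .FF₀ _ => p • {.FF₀ q}
  | _, _, .FF' q _ _, .FX _ m _ => each fun ζ => .FX q m ζ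
  | _, _, .FF' q _ h, .FF _ s h' _ _ => {.FF' q s (fun e => h (e.trans h'.symm))}
  | _, _, .FF' q _ _, .FF' _ s _ => sumFF q s

/-- The multiset of simple summands, listed with multiplicity, of the fusion `α ∘ β`. -/
def fusionTable {M P : Wall p} :
    {N : Wall p} → Defect p M N → Defect p N P → Multiset (Defect p M P)
  | .T => fuseT
  | .L => fuseL
  | .R => fuseR
  | .F₀ => fuseF₀
  | .X _ => fuseX
  | .F _ => fuseF

end VecZp

end

/-! ### Semisimplicity: from a complete orthogonal family to classification and decomposition. -/

noncomputable section

namespace VecZp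

/-! ## Complete families of simple idempotents -/

section SimpleFamily

variable {p : ℕ} [Fact p.Prime] {M N : Wall p} {ι : Type}

/-! Strings form the abelian group (ℤ/p)², and an annular category is the action groupoid of this
group on pairs of labels, with composition twisted by a bicharacter. It is semisimple and can be
studied through traces. The trace of the annulus [w] on the representation of an idempotent e is
e(-w) times a sum of phases over the strings that carry the labels of e to the given object
(`character`). The rank of a projection is its trace, so the dimension of the Hom space between two
idempotents is the pairing of one idempotent with the character of the other (`finrank_homSpace`).
On pairs of pants the same trace, split according to the label of the middle wall, is a sum of
products of two characters (`finrank_fusionSpace`): fusion multiplies characters like matrices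
indexed by simple objects.

The characters of the listed defects are explicit (`character_interface`), because the stabiliser of
a pair of labels is trivial, a line, or the whole group. A trivial stabiliser gives dimension at
most one at each object. On a line the twist is either 1 or the coboundary of a quadratic function
Θ, and p characters remain. On the whole group the twist is trivial and leaves p² characters, or its
commutator is nondegenerate and, as for a Heisenberg group, there is one simple representation, of
dimension p.

For the classification, the pairing of listed defects is the Kronecker delta (`pairing_eq`), so Hom
spaces have dimension one or zero; and the identity of every object is a sum of conjugates of listed
idempotents (`isResolved`). Together these say `IsSimpleFamily`, from which indecomposability,
inequivalence and exhaustion follow as in Schur's lemma and the Krull–Schmidt theorem.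

For fusion, each table entry becomes an identity between functions of w (`sum_trace_mul_trace`).
Pairing it with a listed defect gives the multiplicity (`finrank_fusionSpace_eq_count`), and
`IsSimpleFamily.nonempty_iso_biproduct` turns multiplicities into a direct sum decomposition. -/

/-- A family of pairwise orthogonal idempotents with scalar endomorphisms, through which the
identity of every object factors. -/
structure IsSimpleFamily (S : ι → Interface M N) : Prop where
  ne_zero : ∀ i, (S i).p ≠ 0
  scalar : ∀ i (f : (S i).X ⟶ (S i).X), (S i).p ≫ f = f → f ≫ (S i).p = f →
    ∃ c : ℂ, f = c • (S i).p
  orthogonal : ∀ i j, i ≠ j → ∀ f : (S i).X ⟶ (S j).X, (S i).p ≫ f = f → f ≫ (S j).p = f → f = 0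
  complete : ∀ X : Ann M N, ∃ (J : Type) (_ : Fintype J) (γ : J → ι)
    (v : ∀ j, X ⟶ (S (γ j)).X) (u : ∀ j, (S (γ j)).X ⟶ X), ∑ j, v j ≫ (S (γ j)).p ≫ u j = 𝟙 X

namespace IsSimpleFamily

variable {S : ι → Interface M N} (hS : IsSimpleFamily S)
include hS

theorem exists_smul_id (i : ι) (f : S i ⟶ S i) : ∃ c : ℂ, f.f = c • (S i).p :=
  hS.scalar i f.f (Karoubi.p_comp f) (Karoubi.comp_p f)

theorem hom_eq_zero {i j : ι} (h : i ≠ j) (f : S i ⟶ S j) : f = 0 :=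
  Karoubi.hom_ext _ _ (hS.orthogonal i j h f.f (Karoubi.p_comp f) (Karoubi.comp_p f))

theorem id_ne_zero (i : ι) : 𝟙 (S i) ≠ 0 := fun h =>
  hS.ne_zero i (congrArg Karoubi.Hom.f h)

/-- An idempotent endomorphism is a scalar c with c² = c. -/
theorem isIndecomposable (i : ι) : IsIndecomposable (S i) := by
  refine ⟨hS.id_ne_zero i, fun f hf => ?_⟩
  obtain ⟨c, hc⟩ := hS.exists_smul_id i f
  have h1 : f.f ≫ f.f = f.f := congrArg Karoubi.Hom.f hf
  rw [hc, Linear.smul_comp, Linear.comp_smul, (S i).idem, smul_smul, ← sub_eq_zero,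
    ← sub_smul] at h1
  rcases smul_eq_zero.1 h1 with h | h
  · have : c * (c - 1) = 0 := by linear_combination h
    rcases mul_eq_zero.1 this with h | h
    · left; exact Karoubi.hom_ext _ _ (by rw [hc, h, zero_smul]; rfl)
    · right; exact Karoubi.hom_ext _ _ (by rw [hc, sub_eq_zero.1 h, one_smul]; rfl)
  · exact absurd h (hS.ne_zero i)

theorem eq_of_iso {i j : ι} (e : S i ≅ S j) : i = j := by
  by_contra h
  refine hS.id_ne_zero i ?_
  rw [← e.hom_inv_id, hS.hom_eq_zero h e.hom, zero_comp]

/-- The identity of E factors through finitely many simples. Some composite from a simple through E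
to a simple is nonzero, hence invertible, which makes that simple a nonzero direct summand of E;
indecomposability does the rest. -/
theorem exists_iso (E : Interface M N) (hE : IsIndecomposable E) :
    ∃ i, Nonempty (E ≅ S i) := by
  obtain ⟨J, _, γ, v, u, hvu⟩ := hS.complete E.X
  let a : ∀ j, E ⟶ S (γ j) := fun j => ⟨E.p ≫ v j ≫ (S (γ j)).p, by simp⟩
  let b : ∀ j, S (γ j) ⟶ E := fun j => ⟨(S (γ j)).p ≫ u j ≫ E.p, by simp⟩
  -- Sandwich the resolution of the identity of the underlying object between two copies of E.p.
  have hab : ∑ j, a j ≫ b j = 𝟙 E := by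
    apply Karoubi.hom_ext
    have h1 : E.p ≫ (∑ j, v j ≫ (S (γ j)).p ≫ u j) ≫ E.p = E.p := by
      rw [hvu, Category.id_comp, E.idem]
    rw [Preadditive.sum_comp, Preadditive.comp_sum] at h1
    rw [Karoubi.id_f]
    conv_rhs => rw [← h1]
    rw [Karoubi.sum_hom]
    refine Finset.sum_congr rfl fun j _ => ?_
    simp [a, b]
  -- All pairs (i, j) are needed, not only i = j: they are the terms in the square of the resolution
  -- of the identity, which would vanish along with them.
  by_cases hz : ∀ i j, b i ≫ a j = 0
  · exfalso
    refine hE.1 ?_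
    rw [← Category.comp_id (𝟙 E), ← hab, Preadditive.sum_comp]
    refine Finset.sum_eq_zero fun i _ => ?_
    rw [Preadditive.comp_sum]
    refine Finset.sum_eq_zero fun j _ => ?_
    rw [Category.assoc, ← Category.assoc (b i), hz, zero_comp, comp_zero]
  · push Not at hz
    obtain ⟨i, j, hne⟩ := hz
    have hij : γ i = γ j := by
      by_contra hij
      exact hne (hS.hom_eq_zero hij _)
    -- Transport b i along γ i = γ j, so that the composite becomes an endomorphism of one simple
    -- and Schur's lemma applies.
    obtain ⟨b', hb'⟩ : ∃ b' : S (γ j) ⟶ E, b' ≫ a j ≠ 0 := by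
      have : ∀ (y : ι) (_ : y = γ j) (x : S y ⟶ E), x ≫ a j ≠ 0 →
          ∃ b' : S (γ j) ⟶ E, b' ≫ a j ≠ 0 := by
        rintro y rfl x hx; exact ⟨x, hx⟩
      exact this _ hij _ hne
    obtain ⟨c, hc⟩ := hS.exists_smul_id _ (b' ≫ a j)
    have hc0 : c ≠ 0 := by
      rintro rfl
      exact hb' (Karoubi.hom_ext _ _ (by rw [hc, zero_smul]; rfl))
    let b'' : S (γ j) ⟶ E := ⟨c⁻¹ • b'.f, by simp⟩
    have h1 : b'' ≫ a j = 𝟙 _ := by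
      apply Karoubi.hom_ext
      have : b'.f ≫ (a j).f = c • (S (γ j)).p := hc
      simp only [Karoubi.comp_f, b'', Linear.smul_comp, this, smul_smul, inv_mul_cancel₀ hc0,
        one_smul, Karoubi.id_f]
    refine ⟨γ j, ⟨⟨a j, b'', ?_, h1⟩⟩⟩
    -- The composite in the other order is idempotent, hence 0 or 1; it is not 0, since b'' ≫ a j is
    -- the identity of a nonzero object.
    refine (hE.2 (a j ≫ b'') ?_).resolve_left fun h0 => ?_
    · rw [Category.assoc, ← Category.assoc b'', h1, Category.id_comp]
    · refine hS.id_ne_zero (γ j) ?_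
      rw [← Category.id_comp (𝟙 (S (γ j))), ← h1, Category.assoc, ← Category.assoc (a j), h0,
        zero_comp, comp_zero]

end IsSimpleFamily

/-! ### Decomposing a representation by its fixed vectors. -/

/-- The vectors of a representation at the object of `E` that are fixed by the idempotent. -/
def fixedVectors (F : Ann M N ⥤ ModuleCat.{0} ℂ) (E : Interface M N) :
    Submodule ℂ (F.obj E.X) where
  carrier := {x | F.map E.p x = x}
  zero_mem' := map_zero (F.map E.p).hom
  add_mem' := by
    intro x y hx hy
    change (F.map E.p).hom (x + y) = x + y
    rw [map_add]; exact congrArg₂ _ hx hy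
  smul_mem' := by
    intro c x hx
    change (F.map E.p).hom (c • x) = c • x
    rw [map_smul]; exact congrArg _ hx

/-- The map of representations that sends the idempotent of `E` to a given fixed vector. -/
def ofFixedVector (F : Ann M N ⥤ ModuleCat.{0} ℂ) [F.Additive] [F.Linear ℂ] (E : Interface M N)
    (x : F.obj E.X) : rep E ⟶ F where
  app X := ModuleCat.ofHom
    { toFun := fun f => F.map f.1 x
      map_add' := fun f g => by
        change F.map (f.1 + g.1) x = _
        rw [Functor.map_add]; rfl
      map_smul' := fun c f => by
        change F.map (c • f.1) x = _
        rw [Functor.map_smul]; rfl }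
  naturality X Y g := by
    ext f
    change F.map (f.1 ≫ g) x = F.map g (F.map f.1 x)
    rw [F.map_comp]; rfl

theorem map_sum_apply (F : Ann M N ⥤ ModuleCat.{0} ℂ) [F.Additive] {X Y : Ann M N} {J : Type}
    [Fintype J] (f : J → (X ⟶ Y)) (x : F.obj X) : F.map (∑ j, f j) x = ∑ j, F.map (f j) x := by
  rw [F.map_sum]
  change (∑ j, F.map (f j)).hom x = _
  rw [ModuleCat.hom_sum, LinearMap.sum_apply]

theorem map_smul_apply (F : Ann M N ⥤ ModuleCat.{0} ℂ) [F.Additive] [F.Linear ℂ] {X Y : Ann M N}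
    (c : ℂ) (f : X ⟶ Y) (x : F.obj X) : F.map (c • f) x = c • F.map f x := by
  rw [F.map_smul]; rfl

theorem map_comp_apply (F : Ann M N ⥤ ModuleCat.{0} ℂ) {X Y Z : Ann M N}
    (f : X ⟶ Y) (g : Y ⟶ Z) (x : F.obj X) : F.map (f ≫ g) x = F.map g (F.map f x) := by
  rw [F.map_comp]; rfl

/-- A representation is the direct sum of the representations of a complete family of simple
idempotents, each occurring as often as the dimension of its space of fixed vectors. -/
theorem IsSimpleFamily.nonempty_iso_biproduct {S : ι → Interface M N} (hS : IsSimpleFamily S)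
    (F : Ann M N ⥤ ModuleCat.{0} ℂ) [F.Additive] [F.Linear ℂ] {I : Type} [Finite I] (s : I → ι)
    (b : ∀ i, Module.Basis {k // s k = i} ℂ (fixedVectors F (S i))) :
    Nonempty (F ≅ ⨁ fun k => rep (S (s k))) := by
  classical
  have := Fintype.ofFinite I
  -- Each index k lies in the fibre of s over s k and so names one basis vector of fixed vectors; by
  -- Yoneda that vector defines a map from the representation of S (s k) to F.
  let x : ∀ k, F.obj (S (s k)).X := fun k => (b (s k) ⟨k, rfl⟩).1
  let Φ : (⨁ fun k => rep (S (s k))) ⟶ F := biproduct.desc fun k => ofFixedVector F _ (x k)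
  have hΦ : ∀ X (k : I) (f : absorbing (S (s k)) X),
      Φ.app X ((biproduct.ι (fun k => rep (S (s k))) k).app X f) = F.map f.1 (x k) := by
    intro X k f
    have h1 : biproduct.ι (fun k => rep (S (s k))) k ≫ Φ = ofFixedVector F _ (x k) :=
      biproduct.ι_desc _ _
    have h2 := congrArg (fun t : rep (S (s k)) ⟶ F => (t.app X).hom f) h1
    exact h2
  have hsum : ∀ X (y : (⨁ fun k => rep (S (s k))).obj X),
      y = ∑ k, (biproduct.ι (fun k => rep (S (s k))) k).app X
        ((biproduct.π (fun k => rep (S (s k))) k).app X y) := by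
    intro X y
    have h1 := congrArg (fun t : (⨁ fun k => rep (S (s k))) ⟶ _ => (t.app X).hom y)
      (biproduct.total (f := fun k => rep (S (s k))))
    refine Eq.trans h1.symm ?_
    dsimp only
    rw [NatTrans.app_sum, ModuleCat.hom_sum, LinearMap.sum_apply]
    rfl
  have : IsIso Φ := by
    rw [NatTrans.isIso_iff_isIso_app]
    intro X
    rw [ConcreteCategory.isIso_iff_bijective]
    obtain ⟨J, _, γ, v, u, hvu⟩ := hS.complete X
    constructor
    · refine (injective_iff_map_eq_zero (Φ.app X).hom).2 fun y hy => ?_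
      rw [hsum X y] at hy ⊢
      generalize hf : (fun k => (biproduct.π (fun k => rep (S (s k))) k).app X y) = f at hy
      have hf' : ∀ k, (biproduct.π (fun k => rep (S (s k))) k).app X y = f k :=
        fun k => congrFun hf k
      simp only [hf'] at hy ⊢
      replace hy : ∑ k, F.map (show absorbing (S (s k)) X from f k).1 (x k) = 0 := by
        rw [← hy, map_sum]
        exact Finset.sum_congr rfl fun k _ => (hΦ X k _).symm
      -- Injectivity is tested by composing with morphisms into the simples, where each component of
      -- the kernel element becomes a scalar.
      have hw : ∀ (i : ι) (w : X ⟶ (S i).X), w ≫ (S i).p = w → ∀ k,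
          (show absorbing (S (s k)) X from f k).1 ≫ w = 0 := by
        intro i w hw
        have hc : ∀ k : {k // s k = i}, ∃ c : ℂ, ∀ z : fixedVectors F (S i),
            F.map ((show absorbing (S (s k.1)) X from f k.1).1 ≫ w)
              (x k.1) = c • (b i k).1 ∧
            (c = 0 → (show absorbing (S (s k.1)) X from f k.1).1 ≫ w = 0) := by
          rintro ⟨k, rfl⟩
          obtain ⟨c, hc⟩ := hS.scalar (s k) ((show absorbing (S (s k)) X from f k).1 ≫ w)
            (by rw [← Category.assoc, (show absorbing (S (s k)) X from f k).2])
            (by rw [Category.assoc, hw])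
          refine ⟨c, fun z => ⟨?_, fun h0 => by rw [hc, h0, zero_smul]⟩⟩
          rw [hc, map_smul_apply]
          exact congrArg _ (b (s k) ⟨k, rfl⟩).2
        choose c hc using hc
        have h1 : ∑ k, F.map ((show absorbing (S (s k)) X from f k).1 ≫ w) (x k) = 0 := by
          simp only [map_comp_apply]
          rw [← map_zero (F.map w).hom, ← hy, map_sum]
        have hoff : ∀ k, s k ≠ i → (show absorbing (S (s k)) X from f k).1 ≫ w = 0 :=
          fun k hk => hS.orthogonal _ _ hk _
            (by rw [← Category.assoc, (show absorbing (S (s k)) X from f k).2])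
            (by rw [Category.assoc, hw])
        have h2 : ∑ k : {k // s k = i}, c k • b i k = 0 := by
          apply Subtype.ext
          rw [← Finset.sum_filter_add_sum_filter_not _ (fun k => s k = i),
            Finset.sum_eq_zero (s := Finset.univ.filter fun k => ¬ s k = i), add_zero] at h1
          · rw [Finset.sum_subtype (p := fun k => s k = i) _ (by simp)] at h1
            rw [Submodule.coe_sum, ZeroMemClass.coe_zero, ← h1]
            exact Finset.sum_congr rfl fun k _ => ((hc k 0).1).symm
          · intro k hk
            rw [hoff k (by simpa using hk), F.map_zero]; rfl
        -- Applying w to the relation leaves only the summands of type i, and these are multiples of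
        -- distinct basis vectors.
        have h3 := Fintype.linearIndependent_iff.1 (b i).linearIndependent c h2
        intro k
        by_cases hk : s k = i
        · exact (hc ⟨k, hk⟩ 0).2 (h3 _)
        · exact hoff k hk
      refine Finset.sum_eq_zero fun k _ => ?_
      have hk : f k = 0 := by
        apply Subtype.ext
        change (show absorbing (S (s k)) X from f k).1 = 0
        rw [← Category.comp_id (show absorbing (S (s k)) X from f k).1, ← hvu,
          Preadditive.comp_sum]
        refine Finset.sum_eq_zero fun j _ => ?_
        rw [← Category.assoc (v j), ← Category.assoc, hw (γ j) (v j ≫ (S (γ j)).p) (by simp),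
          zero_comp]
      rw [hk, map_zero]
    · intro y
      have hy : y = ∑ j, F.map (u j) (F.map (S (γ j)).p (F.map (v j) y)) := by
        conv_lhs => rw [← show F.map (𝟙 X) y = y by rw [F.map_id]; rfl, ← hvu, map_sum_apply]
        simp only [map_comp_apply]
      -- Surjectivity: y is a sum of images of fixed vectors under morphisms out of the simples, and
      -- each fixed vector is a combination of the chosen basis vectors, all of which lie in the
      -- image.
      have key : ∀ (i : ι) (w : (S i).X ⟶ X) (z : F.obj (S i).X), F.map (S i).p z = z →
          F.map w z ∈ LinearMap.range (Φ.app X).hom := by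
        intro i w z hz
        have hz' := congrArg Subtype.val ((b i).sum_repr ⟨z, hz⟩)
        rw [Submodule.coe_sum] at hz'
        change _ = z at hz'
        rw [← hz']
        change (F.map w).hom _ ∈ _
        rw [map_sum]
        refine Submodule.sum_mem _ ?_
        rintro ⟨k, rfl⟩ -
        rw [Submodule.coe_smul, map_smul]
        refine Submodule.smul_mem _ _ ⟨(biproduct.ι (fun k => rep (S (s k))) k).app X
          ⟨(S (s k)).p ≫ w, by change _ ≫ _ ≫ _ = _; simp⟩, ?_⟩
        refine (hΦ X k _).trans ?_
        rw [map_comp_apply]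
        exact congrArg _ (b (s k) ⟨k, rfl⟩).2
      have : y ∈ LinearMap.range (Φ.app X).hom := by
        rw [hy]
        refine Submodule.sum_mem _ fun j _ => key _ _ _ ?_
        rw [← map_comp_apply, (S (γ j)).idem]
      exact this
  exact ⟨(asIso Φ).symm⟩

end SimpleFamily

end VecZp
end

noncomputable section

namespace VecZp

/-! ## Characters of interface defects -/

section Characters

variable {p : ℕ}

/-- The exponent of the middle associator. -/
def Wall.level : Wall p → ZMod p
  | .F q => q
  | _ => 0

variable [Fact p.Prime]

theorem Wall.assoc_eq_root (W : Wall p) (g h : ZMod p) : W.assoc g h = root (W.level * g * h) := by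
  cases W <;> simp [Wall.assoc, Wall.level, root_zero]

theorem root_neg (n : ZMod p) : root (-n) = (root n)⁻¹ := by
  refine eq_inv_of_mul_eq_one_left ?_
  rw [← root_add, neg_add_cancel, root_zero]

theorem root_sub (m n : ZMod p) : root (m - n) = root m / root n := by
  rw [sub_eq_add_neg, root_add, root_neg, div_eq_mul_inv]

/-- Only the difference of the two levels matters, so all twists come from one bicharacter, which is
trivial when the levels agree. -/
theorem phase_eq_root (M N : Wall p) (s t : Strings p) :
    phase M N s t = root ((M.level - N.level) * t.1 * s.2) := by
  rw [phase, Wall.assoc_eq_root, Wall.assoc_eq_root, ← root_sub]; congr 1; ring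

instance Wall.fintypeObj : (W : Wall p) → Fintype W.Obj
  | .T => inferInstanceAs (Fintype (ZMod p × ZMod p))
  | .L => inferInstanceAs (Fintype (ZMod p))
  | .R => inferInstanceAs (Fintype (ZMod p))
  | .F₀ => inferInstanceAs (Fintype Unit)
  | .X _ => inferInstanceAs (Fintype (ZMod p))
  | .F _ => inferInstanceAs (Fintype Unit)

variable {M N P : Wall p}

open Classical in
/-- The sum of the phases `[-w] s [w]` over the strings `s` that carry `A` to `B`. -/
def transportSum (A B : Ann M N) (w : Strings p) : ℂ :=
  ∑ s, if M.act s A.low = B.low ∧ N.act s A.up = B.up then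
    phase M N (-w) s * phase M N (s - w) w else 0

/-- The trace of the annulus `[w]` on the representation of `E` at an object. -/
def character (E : Interface M N) (B : Ann M N) (w : Strings p) : ℂ :=
  E.p.1 (-w) * transportSum E.X B w

/-- The rank of a projection is its trace, here written with the diagonal entries of its matrix. -/
theorem finrank_eq_sum_of_isProj {I : Type} [Fintype I] [DecidableEq I]
    {V : Submodule ℂ (I → ℂ)} {T : (I → ℂ) →ₗ[ℂ] (I → ℂ)} (h : LinearMap.IsProj V T) :
    (Module.finrank ℂ V : ℂ) = ∑ i, T (Pi.single i 1) i := by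
  rw [← h.trace, LinearMap.trace_eq_matrix_trace ℂ (Pi.basisFun ℂ I), Matrix.trace]
  refine Finset.sum_congr rfl fun i _ => ?_
  simp

/-- The annuli that absorb `E` on the inside and `G` on the outside. -/
def homSpace (E G : Interface M N) : Submodule ℂ (Strings p → ℂ) where
  carrier := {f | f ∈ annuli E.X G.X ∧ glue M N E.p.1 f = f ∧ glue M N f G.p.1 = f}
  zero_mem' := ⟨zero_mem _, by funext x; simp [glue], by funext x; simp [glue]⟩
  add_mem' := by
    rintro f g ⟨hf, hf1, hf2⟩ ⟨hg, hg1, hg2⟩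
    exact ⟨add_mem hf hg, by rw [glue_add, hf1, hg1], by rw [add_glue, hf2, hg2]⟩
  smul_mem' := by
    rintro c f ⟨hf, hf1, hf2⟩
    exact ⟨Submodule.smul_mem _ c hf, by rw [glue_smul, hf1], by rw [smul_glue, hf2]⟩

open Classical in
/-- The projection to the combinations of the elements of a set. -/
def restrict {I : Type} (S : Set I) : (I → ℂ) →ₗ[ℂ] (I → ℂ) where
  toFun f := S.indicator f
  map_add' := Set.indicator_add S
  map_smul' c f := Set.indicator_const_smul S c f

theorem restrict_single {I : Type} [DecidableEq I] (S : Set I) (i : I) [Decidable (i ∈ S)] :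
    restrict S (Pi.single i 1) = (if i ∈ S then (1 : ℂ) else 0) • Pi.single i 1 := by
  funext j
  change S.indicator _ j = _
  by_cases hj : j = i
  · subst hj; simp [Set.indicator_apply]
  · simp [Pi.single_eq_of_ne hj]

/-- The strings that carry `A` to `B`. -/
def stringSet (A B : Ann M N) : Set (Strings p) :=
  {s | M.act s A.low = B.low ∧ N.act s A.up = B.up}

omit [Fact p.Prime] in
theorem restrict_stringSet_mem (A B : Ann M N) (f : Strings p → ℂ) :
    restrict (stringSet A B) f ∈ annuli A B :=
  fun _ hs => Set.mem_of_indicator_ne_zero (s := stringSet A B) hs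

omit [Fact p.Prime] in
theorem restrict_stringSet_eq {A B : Ann M N} {f : Strings p → ℂ} (hf : f ∈ annuli A B) :
    restrict (stringSet A B) f = f :=
  Set.indicator_eq_self.2 fun s hs => hf s hs

/-- The projection to the annuli that absorb `E` on the inside and `G` on the outside. -/
def homProj (E G : Interface M N) : (Strings p → ℂ) →ₗ[ℂ] (Strings p → ℂ) where
  toFun f := glue M N (glue M N E.p.1 (restrict (stringSet E.X G.X) f)) G.p.1
  map_add' f g := by rw [map_add, glue_add, add_glue]
  map_smul' c f := by rw [map_smul, glue_smul, smul_glue]; rfl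

theorem p_glue_p (E : Interface M N) : glue M N E.p.1 E.p.1 = E.p.1 :=
  congrArg Subtype.val E.idem

/-- Truncating to the admissible strings makes the operator defined on all combinations. Gluing the
idempotents afterwards respects the labels and absorbs a second copy of each idempotent. -/
theorem homProj_isProj (E G : Interface M N) : LinearMap.IsProj (homSpace E G) (homProj E G) where
  map_mem f := by
    refine ⟨glue_mem (glue_mem E.p.2 (restrict_stringSet_mem _ _ _)) G.p.2, ?_, ?_⟩
    · change glue M N E.p.1 (glue M N (glue M N E.p.1 _) G.p.1) = glue M N (glue M N E.p.1 _) G.p.1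
      rw [← glue_assoc, ← glue_assoc, p_glue_p]
    · change glue M N (glue M N (glue M N E.p.1 _) G.p.1) G.p.1 = glue M N (glue M N E.p.1 _) G.p.1
      rw [glue_assoc, p_glue_p]
  map_id f hf := by
    change glue M N (glue M N E.p.1 (restrict (stringSet E.X G.X) f)) G.p.1 = f
    rw [restrict_stringSet_eq hf.1, hf.2.1, hf.2.2]

theorem glue_single_apply (e : Strings p → ℂ) (s t : Strings p) :
    glue M N e (Pi.single s 1) t = phase M N (t - s) s * e (t - s) := by
  rw [glue, Finset.sum_eq_single (t - s)]
  · simp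
  · intro r _ hr
    rw [Pi.single_eq_of_ne, mul_zero]
    rintro rfl; simp at hr
  · simp

/-- Trace of `homProj`. The diagonal entry at s collects the terms in which a string w of G outside
is undone by the string -w of E inside; exchanging the sums over s and w gives the character. -/
theorem finrank_homSpace (E G : Interface M N) :
    (Module.finrank ℂ (homSpace E G) : ℂ) = ∑ w, G.p.1 w * character E G.X w := by
  classical
  rw [finrank_eq_sum_of_isProj (homProj_isProj E G)]
  simp only [character, transportSum, Finset.mul_sum]
  rw [Finset.sum_comm]
  refine Finset.sum_congr rfl fun s _ => ?_
  change glue M N (glue M N E.p.1 (restrict (stringSet E.X G.X) (Pi.single s 1))) G.p.1 s = _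
  rw [restrict_single, glue_smul, smul_glue, Pi.smul_apply, glue, Finset.smul_sum]
  -- The outer string is w = s - t when the string before gluing G is t.
  refine Fintype.sum_equiv (Equiv.subLeft s) _ _ fun t => ?_
  simp only [glue_single_apply, Equiv.subLeft_apply, stringSet, Set.mem_ofPred_eq, smul_eq_mul]
  rw [show -(s - t) = t - s by abel, show s - (s - t) = t by abel]
  by_cases h : M.act s E.X.low = G.X.low ∧ N.act s E.X.up = G.X.up
  · simp only [h, and_self, if_true]; ring
  · simp only [h, if_false]; ring

/-! ### Traces on pairs of pants. -/

/-- The pairs of strings on pairs of pants with given labels. -/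
def pantsSet (A : Ann M N) (B : Ann N P) (X : Ann M P) : Set (Strings p × Strings p) :=
  {x | M.act x.1 A.low = X.low ∧ N.act x.1 A.up = N.act x.2 B.low ∧ P.act x.2 B.up = X.up}

omit [Fact p.Prime] in
theorem restrict_pantsSet_mem (A : Ann M N) (B : Ann N P) (X : Ann M P) (f : PantsDiagram p) :
    restrict (pantsSet A B X) f ∈ pants A B X :=
  fun _ _ hs => Set.mem_of_indicator_ne_zero (s := pantsSet A B X) hs

omit [Fact p.Prime] in
theorem restrict_pantsSet_eq {A : Ann M N} {B : Ann N P} {X : Ann M P} {f : PantsDiagram p}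
    (hf : f ∈ pants A B X) : restrict (pantsSet A B X) f = f :=
  Set.indicator_eq_self.2 fun s hs => hf s.1 s.2 hs

theorem glueLow_mem {A : Ann M N} {B : Ann N P} {X : Ann M P} {e : Strings p → ℂ}
    {f : PantsDiagram p} (he : e ∈ annuli A A) (hf : f ∈ pants A B X) :
    glueLow M N e f ∈ pants A B X := by
  intro a b hab
  obtain ⟨s, -, hs⟩ := Finset.exists_ne_zero_of_sum_ne_zero hab
  have h1 := hf (a - s) b (by intro h; simp [h] at hs)
  have h2 := he s (by intro h; simp [h] at hs)
  have h3 : a = s + (a - s) := by abel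
  rw [h3, Wall.act_add, Wall.act_add, h2.1, h2.2]
  exact h1

theorem glueUp_mem {A : Ann M N} {B : Ann N P} {X : Ann M P} {e : Strings p → ℂ}
    {f : PantsDiagram p} (he : e ∈ annuli B B) (hf : f ∈ pants A B X) :
    glueUp N P e f ∈ pants A B X := by
  intro a b hab
  obtain ⟨s, -, hs⟩ := Finset.exists_ne_zero_of_sum_ne_zero hab
  have h1 := hf a (b - s) (by intro h; simp [h] at hs)
  have h2 := he s (by intro h; simp [h] at hs)
  have h3 : b = s + (b - s) := by abel
  rw [h3, Wall.act_add, Wall.act_add, h2.1, h2.2]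
  exact h1

/-- With the strings of the other leg frozen, this is associativity of gluing annuli. -/
theorem glueLow_glue (e e' : Strings p → ℂ) (f : PantsDiagram p) :
    glueLow M N (glue M N e e') f = glueLow M N e (glueLow M N e' f) := by
  funext x
  exact congrFun (glue_assoc (M := M) (N := N) e e' fun a => f (a, x.2)) x.1

theorem glueUp_glue (e e' : Strings p → ℂ) (f : PantsDiagram p) :
    glueUp N P (glue N P e e') f = glueUp N P e (glueUp N P e' f) := by
  funext x
  exact congrFun (glue_assoc (M := N) (N := P) e e' fun b => f (x.1, b)) x.2

theorem glueLow_glueUp (e e' : Strings p → ℂ) (f : PantsDiagram p) :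
    glueLow M N e (glueUp N P e' f) = glueUp N P e' (glueLow M N e f) := by
  funext x
  simp only [glueLow, glueUp, Finset.mul_sum]
  rw [Finset.sum_comm]
  exact Finset.sum_congr rfl fun s _ => Finset.sum_congr rfl fun t _ => by ring

/-- The projection to the pairs of pants that absorb `E` and `E'` on the legs and `G` on the
waist. -/
def fusionProj (E : Interface M N) (E' : Interface N P) (G : Interface M P) :
    PantsDiagram p →ₗ[ℂ] PantsDiagram p where
  toFun f := glueWaist M N P (glueLow M N E.p.1 (glueUp N P E'.p.1
    (restrict (pantsSet E.X E'.X G.X) f))) G.p.1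
  map_add' f g := by rw [map_add, glueUp_add, glueLow_add, glueWaist_add]
  map_smul' c f := by rw [map_smul, glueUp_smul, glueLow_smul, glueWaist_smul]; rfl

theorem fusionProj_isProj (E : Interface M N) (E' : Interface N P) (G : Interface M P) :
    LinearMap.IsProj (fusionSpace E E' G) (fusionProj E E' G) where
  map_mem f := by
    refine ⟨⟨glueWaist_mem (glueLow_mem E.p.2 (glueUp_mem E'.p.2
      (restrict_pantsSet_mem _ _ _ _))) G.p.2, ?_, ?_⟩, ?_⟩
    · change glueLow M N E.p.1 (glueWaist M N P (glueLow M N E.p.1 (glueUp N P E'.p.1 _)) G.p.1) =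
        glueWaist M N P (glueLow M N E.p.1 (glueUp N P E'.p.1 _)) G.p.1
      rw [glueLow_glueWaist, ← glueLow_glue, p_glue_p]
    · change glueUp N P E'.p.1 (glueWaist M N P (glueLow M N E.p.1 (glueUp N P E'.p.1 _)) G.p.1) =
        glueWaist M N P (glueLow M N E.p.1 (glueUp N P E'.p.1 _)) G.p.1
      rw [glueUp_glueWaist, ← glueLow_glueUp, ← glueUp_glue, p_glue_p]
    · change glueWaist M N P (glueWaist M N P (glueLow M N E.p.1 (glueUp N P E'.p.1 _)) G.p.1)
        G.p.1 = glueWaist M N P (glueLow M N E.p.1 (glueUp N P E'.p.1 _)) G.p.1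
      rw [← glueWaist_glue, p_glue_p]
  map_id f hf := by
    change glueWaist M N P (glueLow M N E.p.1 (glueUp N P E'.p.1
      (restrict (pantsSet E.X E'.X G.X) f))) G.p.1 = f
    rw [restrict_pantsSet_eq hf.1.1, hf.1.2.2, hf.1.2.1, hf.2]

theorem glueUp_single_apply (e : Strings p → ℂ) (x y : Strings p × Strings p) :
    glueUp N P e (Pi.single x 1) y =
      if y.1 = x.1 then phase N P (y.2 - x.2) x.2 * e (y.2 - x.2) else 0 := by
  have h : ∀ b : Strings p, (Pi.single x 1 : PantsDiagram p) (y.1, b) =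
      if y.1 = x.1 then (Pi.single x.2 1 : Strings p → ℂ) b else 0 := by
    intro b
    simp only [Pi.single_apply, Prod.ext_iff]
    split_ifs <;> simp_all
  rw [glueUp]
  simp only [h]
  split_ifs
  · exact glue_single_apply e x.2 y.2
  · simp

theorem glueLow_glueUp_single_apply (e e' : Strings p → ℂ) (x y : Strings p × Strings p) :
    glueLow M N e (glueUp N P e' (Pi.single x 1)) y =
      phase M N (y.1 - x.1) x.1 * e (y.1 - x.1) * (phase N P (y.2 - x.2) x.2 * e' (y.2 - x.2)) := by
  rw [← glue_single_apply e x.1 y.1, glueLow, glue, Finset.sum_mul]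
  refine Finset.sum_congr rfl fun s _ => ?_
  rw [glueUp_single_apply]
  by_cases h : y.1 - s = x.1
  · simp [h]
  · simp [h]

/-- Trace of `fusionProj`. A string w on the waist must be undone by -w on both legs, so the
diagonal entry factors over the legs; the only link between them is the common label n of the middle
wall. -/
theorem finrank_fusionSpace (E : Interface M N) (E' : Interface N P) (G : Interface M P) :
    (Module.finrank ℂ (fusionSpace E E' G) : ℂ) = ∑ w, G.p.1 w * ∑ n : N.Obj,
      character E ⟨G.X.low, n⟩ w * character E' ⟨n, G.X.up⟩ w := by
  classical
  rw [finrank_eq_sum_of_isProj (fusionProj_isProj E E' G)]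
  have h1 : ∀ x : Strings p × Strings p, fusionProj E E' G (Pi.single x 1) x =
      ∑ w, G.p.1 w * ((if x ∈ pantsSet E.X E'.X G.X then 1 else 0) *
        ((E.p.1 (-w) * (phase M N (-w) x.1 * phase M N (x.1 - w) w)) *
        (E'.p.1 (-w) * (phase N P (-w) x.2 * phase N P (x.2 - w) w)))) := by
    intro x
    change glueWaist M N P (glueLow M N E.p.1 (glueUp N P E'.p.1
      (restrict (pantsSet E.X E'.X G.X) (Pi.single x 1)))) G.p.1 x = _
    rw [restrict_single, glueUp_smul, glueLow_smul, glueWaist_smul, Pi.smul_apply, glueWaist,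
      Finset.smul_sum]
    refine Finset.sum_congr rfl fun w _ => ?_
    simp only [glueLow_glueUp_single_apply, smul_eq_mul]
    rw [show x.1 - w - x.1 = -w by abel, show x.2 - w - x.2 = -w by abel]
    ring
  simp only [h1]
  rw [Finset.sum_comm]
  refine Finset.sum_congr rfl fun w _ => ?_
  rw [← Finset.mul_sum]
  congr 1
  rw [Fintype.sum_prod_type]
  -- Summing the product of the two leg conditions over n recovers the single condition that the
  -- labels in the middle agree.
  have h2 : ∀ n : N.Obj, character E ⟨G.X.low, n⟩ w * character E' ⟨n, G.X.up⟩ w =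
      ∑ a, ∑ b, (if M.act a E.X.low = G.X.low ∧ N.act a E.X.up = n then 1 else 0) *
        (if N.act b E'.X.low = n ∧ P.act b E'.X.up = G.X.up then 1 else 0) *
        ((E.p.1 (-w) * (phase M N (-w) a * phase M N (a - w) w)) *
        (E'.p.1 (-w) * (phase N P (-w) b * phase N P (b - w) w))) := by
    intro n
    rw [character, character, transportSum, transportSum, Finset.mul_sum, Finset.mul_sum,
      Finset.sum_mul_sum]
    refine Finset.sum_congr rfl fun a _ => Finset.sum_congr rfl fun b _ => ?_
    simp only [ite_mul, mul_ite, mul_zero, zero_mul, one_mul]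
  simp only [h2]
  conv_rhs => rw [Finset.sum_comm]
  refine Finset.sum_congr rfl fun a _ => ?_
  conv_rhs => rw [Finset.sum_comm]
  refine Finset.sum_congr rfl fun b _ => ?_
  rw [← Finset.sum_mul]
  congr 1
  rw [Finset.sum_eq_single (N.act a E.X.up)]
  · simp only [pantsSet, Set.mem_ofPred_eq]
    by_cases h1 : M.act a E.X.low = G.X.low <;>
      by_cases h2 : N.act a E.X.up = N.act b E'.X.low <;>
      by_cases h3 : P.act b E'.X.up = G.X.up <;>
      simp [h1, h2, h3, eq_comm (a := N.act b E'.X.low)]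
  · intro n _ hn
    simp [Ne.symm hn]
  · simp

end Characters

end VecZp
end

noncomputable section

namespace VecZp

/-! ## The characters of the simple defects -/

section Traces

variable {p : ℕ}

/-- The indicator function of zero. -/
def ind (x : ZMod p) : ℂ := if x = 0 then 1 else 0

theorem ind_zero : ind (0 : ZMod p) = 1 := if_pos rfl

theorem ind_of_ne {x : ZMod p} (h : x ≠ 0) : ind x = 0 := if_neg h

/-- The equation `g ▹ a ◃ h = b` in coordinates. -/
def Wall.ActEq : (W : Wall p) → Strings p → W.Obj → W.Obj → Prop
  | .T => fun t (a b : ZMod p × ZMod p) => a.1 + t.1 = b.1 ∧ a.2 + t.2 = b.2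
  | .L => fun t (a b : ZMod p) => a + t.2 = b
  | .R => fun t (a b : ZMod p) => a + t.1 = b
  | .F₀ => fun _ _ _ => True
  | .X k => fun t (a b : ZMod p) => a + t.1 + (k : ZMod p) * t.2 = b
  | .F _ => fun _ _ _ => True

theorem Wall.act_eq_iff (W : Wall p) (t : Strings p) (a b : W.Obj) :
    W.act t a = b ↔ W.ActEq t a b := by
  cases W
  case T => exact Prod.ext_iff
  all_goals first | exact Iff.rfl | exact iff_true_intro rfl

variable [Fact p.Prime]

/-- Orthogonality of the additive characters of ℤ/p, from primitivity of the standard character. -/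
theorem sum_root_mul (a : ZMod p) : ∑ n : ZMod p, root (a * n) = p * ind a := by
  by_cases h : a = 0
  · subst h; simp [root_zero, ind_zero, ZMod.card]
  · rw [ind_of_ne h, mul_zero]
    have h1 := AddChar.sum_mulShift (R := ZMod p) (R' := ℂ) (ψ := ZMod.stdAddChar) a
      (ZMod.isPrimitive_stdAddChar p)
    rw [if_neg h] at h1
    rw [Nat.cast_zero] at h1
    refine Eq.trans (Finset.sum_congr rfl fun n _ => ?_) h1
    rw [root, mul_comm]

/-- The trace of the annulus `[w]` on the representation of a simple defect at `(m, n)`. -/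
def Defect.trace : {M N : Wall p} → Defect p M N → M.Obj → N.Obj → Strings p → ℂ
  | _, _, .TT a b => fun (m n : ZMod p × ZMod p) w =>
      ind w.1 * ind w.2 * (ind (n.1 - m.1 - a) * ind (n.2 - m.2 - b))
  | _, _, .TL a => fun (m : ZMod p × ZMod p) (n : ZMod p) w =>
      ind w.1 * ind w.2 * ind (n - m.2 - a)
  | _, _, .TR a => fun (m : ZMod p × ZMod p) (n : ZMod p) w =>
      ind w.1 * ind w.2 * ind (n - m.1 - a)
  | _, _, .TX l a => fun (m : ZMod p × ZMod p) (n : ZMod p) w =>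
      ind w.1 * ind w.2 * ind (n - m.1 - (l : ZMod p) * m.2 - a)
  | _, _, .LT a => fun (m : ZMod p) (n : ZMod p × ZMod p) w =>
      ind w.1 * ind w.2 * ind (n.2 - m - a)
  | _, _, .RT a => fun (m : ZMod p) (n : ZMod p × ZMod p) w =>
      ind w.1 * ind w.2 * ind (n.1 - m - a)
  | _, _, .XT k a => fun (m : ZMod p) (n : ZMod p × ZMod p) w =>
      ind w.1 * ind w.2 * ind (n.1 + (k : ZMod p) * n.2 - m - a)
  | _, _, .LL a x => fun (m n : ZMod p) w => ind w.2 * ind (n - m - a) * root (-w.1 * x)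
  | _, _, .LF₀ x => fun _ _ w => ind w.2 * root (-w.1 * x)
  | _, _, .LF r x => fun (m : ZMod p) _ w => ind w.2 * root (-w.1 * (x + (r : ZMod p) * m))
  | _, _, .F₀L x => fun _ _ w => ind w.2 * root (-w.1 * x)
  | _, _, .FL q x => fun _ (n : ZMod p) w => ind w.2 * root (-w.1 * (x - (q : ZMod p) * n))
  | _, _, .RR a x => fun (m n : ZMod p) w => ind w.1 * ind (n - m - a) * root (w.2 * x)
  | _, _, .RF₀ x => fun _ _ w => ind w.1 * root (w.2 * x)
  | _, _, .RF r x => fun (m : ZMod p) _ w => ind w.1 * root (w.2 * (x + (r : ZMod p) * m))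
  | _, _, .F₀R x => fun _ _ w => ind w.1 * root (w.2 * x)
  | _, _, .FR q x => fun _ (n : ZMod p) w => ind w.1 * root (w.2 * (x - (q : ZMod p) * n))
  | _, _, .XX k _ _ a x => fun (m n : ZMod p) w =>
      ind (w.1 + (k : ZMod p) * w.2) * ind (n - m - a) * root (w.2 * x)
  | _, _, .XF₀ k x => fun _ _ w => ind (w.1 + (k : ZMod p) * w.2) * root (-w.1 * x)
  | _, _, .F₀X l x => fun _ _ w => ind (w.1 + (l : ZMod p) * w.2) * root (-w.1 * x)
  | _, _, .XF k r x => fun (m : ZMod p) _ w =>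
      ind (w.1 + (k : ZMod p) * w.2) * Theta x ((k : ZMod p).val * (r : ZMod p).val) w.2 *
        root ((r : ZMod p) * w.2 * (m - (k : ZMod p) * w.2))
  | _, _, .FX q l x => fun _ (n : ZMod p) w =>
      ind (w.1 + (l : ZMod p) * w.2) * Theta x (-((q : ZMod p).val * (l : ZMod p).val)) w.2 *
        root (-(q : ZMod p) * w.2 * (n - (l : ZMod p) * w.2))
  | _, _, .F₀F₀ x y => fun _ _ w => root (-w.1 * x + w.2 * y)
  | _, _, .FF _ _ _ x y => fun _ _ w => root (-w.1 * x + w.2 * y)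
  | _, _, .F₀F _ => fun _ _ w => p * (ind w.1 * ind w.2)
  | _, _, .FF₀ _ => fun _ _ w => p * (ind w.1 * ind w.2)
  | _, _, .FF' _ _ _ => fun _ _ w => p * (ind w.1 * ind w.2)
  | _, _, _ => fun _ _ w => ind w.1 * ind w.2

variable {M N : Wall p}

/-- The two phases combine into an alternating form in w and s, the commutator, and a term that
depends on w alone. The predicate C holds the solved form of the label equations. -/
theorem transportSum_eq (A B : Ann M N) (w : Strings p) (C : Strings p → Prop) [DecidablePred C]
    (hC : ∀ s, M.ActEq s A.low B.low ∧ N.ActEq s A.up B.up ↔ C s) :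
    transportSum A B w = ∑ s, if C s then
      root ((M.level - N.level) * (w.1 * s.2 - s.1 * w.2 - w.1 * w.2)) else 0 := by
  rw [transportSum]
  refine Finset.sum_congr rfl fun s _ => ?_
  simp only [Wall.act_eq_iff, hC]
  congr 1
  rw [phase_eq_root, phase_eq_root, ← root_add]
  congr 1
  simp only [Prod.snd_neg, Prod.snd_sub]
  ring

omit [Fact p.Prime] in
theorem average_apply {G : Type} [Fintype G] (φ : G → Strings p) (χ : G → ℂ)
    (hφ : Function.Injective φ) (g : G) : average φ χ (φ g) = (Fintype.card G : ℂ)⁻¹ * χ g := by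
  rw [average, Pi.smul_apply, Finset.sum_apply, Finset.sum_eq_single g]
  · simp
  · intro b _ hb
    simp [Pi.single_eq_of_ne (fun h => hb (hφ h).symm)]
  · simp

omit [Fact p.Prime] in
theorem average_apply_of_notMem {G : Type} [Fintype G] (φ : G → Strings p) (χ : G → ℂ)
    {s : Strings p} (hs : ∀ g, s ≠ φ g) : average φ χ s = 0 := by
  rw [average, Pi.smul_apply, Finset.sum_apply, Finset.sum_eq_zero]
  · simp
  · intro b _
    simp [Pi.single_eq_of_ne (hs b)]

theorem line_injective {u v : ZMod p} (h : u ≠ 0 ∨ v ≠ 0) :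
    Function.Injective fun g : ZMod p => ((u * g, v * g) : Strings p) := by
  intro a b hab
  rcases h with h | h
  · exact mul_left_cancel₀ h (congrArg Prod.fst hab)
  · exact mul_left_cancel₀ h (congrArg Prod.snd hab)

/-- Trivial stabiliser: the idempotent lives at 0, so the trace vanishes for w ≠ 0 and at w = 0
counts strings. There is at most one, s, and Q is the condition that it exists. -/
theorem character_of_single (γ : Defect p M N) (hγ : γ.diagram = Pi.single 0 1) (B : Ann M N)
    (w : Strings p) (s : Strings p) (Q : Prop) [Decidable Q] (e : ℂ) (he : (if Q then 1 else 0) = e)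
    (hQ : ∀ t, M.ActEq t γ.obj.low B.low ∧ N.ActEq t γ.obj.up B.up ↔ t = s ∧ Q) :
    character γ.interface B w = ind w.1 * ind w.2 * e := by
  subst he
  change γ.diagram (-w) * transportSum γ.obj B w = _
  rw [hγ]
  by_cases hw : w = 0
  · subst hw
    rw [transportSum_eq _ _ _ _ hQ, Finset.sum_eq_single s]
    · simp [ind_zero, root_zero]
    · intro t _ ht; simp [ht]
    · simp
  · rw [Pi.single_eq_of_ne (neg_ne_zero.2 hw), zero_mul]
    have : w.1 ≠ 0 ∨ w.2 ≠ 0 := by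
      by_contra! h; exact hw (Prod.ext h.1 h.2)
    rcases this with h | h <;> simp [ind_of_ne h]

/-- Stabiliser the line through (u, v): the strings with the right labels form the coset of s, if Q
holds, with parameter recovered by τ. The element c vanishes exactly when -w lies on the line, and g
is then its parameter. -/
theorem character_of_line (γ : Defect p M N) (u v : ZMod p) (χ : ZMod p → ℂ)
    (hγ : γ.diagram = lineAverage u v χ) (huv : u ≠ 0 ∨ v ≠ 0) (B : Ann M N)
    (w : Strings p) (s : Strings p) (Q : Prop) [Decidable Q] (e : ℂ) (he : (if Q then 1 else 0) = e)
    (τ : Strings p → ZMod p)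
    (hτ : ∀ t, M.ActEq t γ.obj.low B.low → N.ActEq t γ.obj.up B.up →
      s.1 + u * τ t = t.1 ∧ s.2 + v * τ t = t.2 ∧ Q)
    (hQ : Q → ∀ g, M.ActEq (s.1 + u * g, s.2 + v * g) γ.obj.low B.low ∧
      N.ActEq (s.1 + u * g, s.2 + v * g) γ.obj.up B.up) (c g : ZMod p)
    (hc : c = 0 → -w = (u * g, v * g)) (hc' : ∀ g', -w = (u * g', v * g') → c = 0) :
    character γ.interface B w = ind c * e * χ g *
      root ((M.level - N.level) * (g * (v * s.1 - u * s.2) - u * v * g ^ 2)) := by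
  classical
  subst he
  replace hQ : ∀ t, M.ActEq t γ.obj.low B.low ∧ N.ActEq t γ.obj.up B.up ↔
      (∃ g, t = (s.1 + u * g, s.2 + v * g)) ∧ Q := fun t =>
    ⟨fun h => ⟨⟨τ t, Prod.ext (hτ t h.1 h.2).1.symm (hτ t h.1 h.2).2.1.symm⟩, (hτ t h.1 h.2).2.2⟩,
      fun ⟨⟨g, hg⟩, h⟩ => hg ▸ hQ h g⟩
  change γ.diagram (-w) * transportSum γ.obj B w = _
  rw [hγ, lineAverage]
  by_cases h : c = 0
  · have hw := hc h
    rw [hw, average_apply _ _ (line_injective huv), transportSum_eq _ _ _ _ hQ, h, ind_zero]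
    have hp : (p : ℂ) ≠ 0 := by exact_mod_cast (Fact.out : p.Prime).ne_zero
    by_cases hq : Q
    · simp only [hq, and_true, if_true, ← Finset.sum_filter]
      have himg : (Finset.univ.filter fun t : Strings p =>
          ∃ g, t = (s.1 + u * g, s.2 + v * g)) =
          Finset.univ.image fun g => (s.1 + u * g, s.2 + v * g) := by
        ext t; simp [eq_comm]
      rw [himg, Finset.sum_image]
      · have hw1 : w.1 = -(u * g) := by rw [← neg_neg w.1]; exact congrArg (-·) (congrArg Prod.fst hw)
        have hw2 : w.2 = -(v * g) := by rw [← neg_neg w.2]; exact congrArg (-·) (congrArg Prod.snd hw)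
        -- The commutator of two multiples of (u, v) is zero, so the phase is constant along the
        -- coset and its p equal terms cancel the factor 1/p.
        rw [Finset.sum_congr rfl fun t _ => show root _ =
          root ((M.level - N.level) * (g * (v * s.1 - u * s.2) - u * v * g ^ 2)) by
            congr 1; rw [hw1, hw2]; ring, Finset.sum_const, Finset.card_univ, ZMod.card,
            nsmul_eq_mul]
        field_simp
      · intro a _ b _ hab
        refine line_injective huv (Prod.ext ?_ ?_)
        · exact add_left_cancel (congrArg Prod.fst hab)
        · exact add_left_cancel (congrArg Prod.snd hab)
    · simp [hq]
  · rw [average_apply_of_notMem _ _ fun g' h' => h (hc' g' h'), ind_of_ne h]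
    simp

/-- Full stabiliser and equal levels: the p² strings all contribute phase 1, which cancels the
normalisation and leaves the character evaluated at -w. -/
theorem character_of_plane (γ : Defect p M N) (x y : ZMod p)
    (hγ : γ.diagram = average (fun g : ZMod p × ZMod p => (g.1, -g.2))
      fun g => root (g.1 * x + g.2 * y)) (B : Ann M N) (w : Strings p)
    (hQ : ∀ t, M.ActEq t γ.obj.low B.low ∧ N.ActEq t γ.obj.up B.up)
    (hl : M.level = N.level) :
    character γ.interface B w = root (-w.1 * x + w.2 * y) := by
  change γ.diagram (-w) * transportSum γ.obj B w = _
  rw [hγ, transportSum_eq _ _ _ (fun _ => True) (fun t => iff_true_intro (hQ t))]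
  have h := average_apply (fun g : ZMod p × ZMod p => ((g.1, -g.2) : Strings p))
    (fun g => root (g.1 * x + g.2 * y))
    (fun a b hab => Prod.ext (Prod.ext_iff.1 hab).1 (neg_injective (Prod.ext_iff.1 hab).2))
    (-w.1, w.2)
  have hp : (p : ℂ) ≠ 0 := by exact_mod_cast (Fact.out : p.Prime).ne_zero
  rw [show -w = (-w.1, -w.2) from rfl]
  refine (congrArg (· * _) h).trans ?_
  simp only [hl, sub_self, zero_mul, root_zero, if_true, Finset.sum_const, Finset.card_univ,
    Fintype.card_prod, ZMod.card, nsmul_eq_mul]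
  push_cast
  field_simp

/-- Full stabiliser and different levels: the idempotent forces w.1 = 0, and then the sum of
commutators over all strings vanishes unless w.2 = 0. At w = 0 the value p is the dimension of the
unique simple representation. -/
theorem character_of_halfPlane (γ : Defect p M N)
    (hγ : γ.diagram = lineAverage 0 (-1) fun _ => 1) (B : Ann M N) (w : Strings p)
    (hQ : ∀ t, M.ActEq t γ.obj.low B.low ∧ N.ActEq t γ.obj.up B.up)
    (hl : M.level ≠ N.level) :
    character γ.interface B w = p * (ind w.1 * ind w.2) := by
  change γ.diagram (-w) * transportSum γ.obj B w = _
  rw [hγ, transportSum_eq _ _ _ (fun _ => True) (fun t => iff_true_intro (hQ t)), lineAverage]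
  have hp : (p : ℂ) ≠ 0 := by exact_mod_cast (Fact.out : p.Prime).ne_zero
  by_cases h : w.1 = 0
  · have hw : -w = (0 * w.2, -1 * w.2) := by ext <;> simp [h]
    rw [hw, average_apply _ _ (line_injective (Or.inr (neg_ne_zero.2 one_ne_zero))), h, ind_zero,
      Fintype.sum_prod_type]
    simp only [if_true, zero_mul, zero_sub, sub_zero, Finset.sum_const, Finset.card_univ,
      ZMod.card, ← Finset.smul_sum]
    rw [Finset.sum_congr rfl fun t _ => show root ((M.level - N.level) * -(t * w.2)) =
      root (-((M.level - N.level) * w.2) * t) by congr 1; ring, sum_root_mul]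
    by_cases h2 : w.2 = 0
    · simp [h2, ind_zero]; field_simp
    · rw [ind_of_ne h2, ind_of_ne (neg_ne_zero.2 (mul_ne_zero (sub_ne_zero.2 hl) h2))]; simp
  · rw [average_apply_of_notMem, ind_of_ne h]
    · simp
    · intro g hg
      have := congrArg Prod.fst hg
      simp at this
      exact h this

end Traces

end VecZp
end

noncomputable section

namespace VecZp

/-! ### Computing the characters of all listed defects. -/

section TraceFormula

variable {p : ℕ} [Fact p.Prime] {M N : Wall p}

theorem level_ne {q r : (ZMod p)ˣ} (h : q ≠ r) : (q : ZMod p) ≠ r := fun h' => h (Units.ext h')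

-- The stabiliser selects one of the four preceding computations. Each case supplies a particular
-- string s from the labels of the defect to (m, n) and, where a label is a relative position, the
-- condition for s to exist.
set_option maxHeartbeats 1000000 in
theorem character_interface (γ : Defect p M N) (B : Ann M N) (w : Strings p) :
    character γ.interface B w = γ.trace B.low B.up w := by
  obtain ⟨m, n⟩ := B
  obtain ⟨g, h⟩ := w
  have h1 : (-1 : ZMod p) ≠ 0 := neg_ne_zero.2 one_ne_zero
  cases γ
  case TT a b =>
    change ZMod p × ZMod p at m n
    obtain ⟨m1, m2⟩ := m; obtain ⟨n1, n2⟩ := n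
    refine (character_of_single _ rfl _ _ (m1, m2) (n1 - m1 - a = 0 ∧ n2 - m2 - b = 0)
      (ind (n1 - m1 - a) * ind (n2 - m2 - b)) (by simp only [ind]; split_ifs <;> simp_all) ?_)
    rintro ⟨t1, t2⟩
    simp only [Wall.ActEq, Defect.obj, Wall.base, Prod.mk.injEq]
    grind
  case XX' k l hkl =>
    change ZMod p at m n
    have hd := sub_ne_zero.2 (level_ne hkl)
    have hd' := mul_inv_cancel₀ hd
    -- The string solves t₁ + k t₂ = m and t₁ + l t₂ = n, a system whose determinant is a unit
    -- because k ≠ l.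
    refine (character_of_single _ rfl _ _ (m - (k : ZMod p) * ((m - n) * ((k : ZMod p) - l)⁻¹),
      (m - n) * ((k : ZMod p) - l)⁻¹) True 1 (if_pos trivial) ?_).trans (mul_one _)
    rintro ⟨t1, t2⟩
    simp only [Wall.ActEq, Defect.obj, Wall.base, Prod.mk.injEq]
    generalize ((k : ZMod p) - l)⁻¹ = d at *
    grind
  case TL a =>
    change ZMod p × ZMod p at m
    change ZMod p at n
    obtain ⟨m1, m2⟩ := m
    refine character_of_single _ rfl _ _ (m1, m2) (n - m2 - a = 0) (ind (n - m2 - a)) rfl ?_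
    rintro ⟨t1, t2⟩
    simp only [Wall.ActEq, Defect.obj, Wall.base, Prod.mk.injEq]
    grind
  case TR a =>
    change ZMod p × ZMod p at m
    change ZMod p at n
    obtain ⟨m1, m2⟩ := m
    refine character_of_single _ rfl _ _ (m1, m2) (n - m1 - a = 0) (ind (n - m1 - a)) rfl ?_
    rintro ⟨t1, t2⟩
    simp only [Wall.ActEq, Defect.obj, Wall.base, Prod.mk.injEq]
    grind
  case TX l a =>
    change ZMod p × ZMod p at m
    change ZMod p at n
    obtain ⟨m1, m2⟩ := m
    refine character_of_single _ rfl _ _ (m1, m2) (n - m1 - (l : ZMod p) * m2 - a = 0) (ind (n - m1 - (l : ZMod p) * m2 - a)) rfl ?_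
    rintro ⟨t1, t2⟩
    simp only [Wall.ActEq, Defect.obj, Wall.base, Prod.mk.injEq]
    grind
  case TF₀ =>
    change ZMod p × ZMod p at m
    obtain ⟨m1, m2⟩ := m
    refine (character_of_single _ rfl _ _ (m1, m2) True 1 (if_pos trivial) ?_).trans (mul_one _)
    rintro ⟨t1, t2⟩
    simp only [Wall.ActEq, Defect.obj, Wall.base, Prod.mk.injEq]
    grind
  case TF r =>
    change ZMod p × ZMod p at m
    obtain ⟨m1, m2⟩ := m
    refine (character_of_single _ rfl _ _ (m1, m2) True 1 (if_pos trivial) ?_).trans (mul_one _)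
    rintro ⟨t1, t2⟩
    simp only [Wall.ActEq, Defect.obj, Wall.base, Prod.mk.injEq]
    grind
  case LT a =>
    change ZMod p at m
    change ZMod p × ZMod p at n
    obtain ⟨n1, n2⟩ := n
    refine character_of_single _ rfl _ _ (n1, m) (n2 - m - a = 0) (ind (n2 - m - a)) rfl ?_
    rintro ⟨t1, t2⟩
    simp only [Wall.ActEq, Defect.obj, Wall.base, Prod.mk.injEq]
    grind
  case RT a =>
    change ZMod p at m
    change ZMod p × ZMod p at n
    obtain ⟨n1, n2⟩ := n
    refine character_of_single _ rfl _ _ (m, n2) (n1 - m - a = 0) (ind (n1 - m - a)) rfl ?_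
    rintro ⟨t1, t2⟩
    simp only [Wall.ActEq, Defect.obj, Wall.base, Prod.mk.injEq]
    grind
  case XT k a =>
    change ZMod p at m
    change ZMod p × ZMod p at n
    obtain ⟨n1, n2⟩ := n
    refine character_of_single _ rfl _ _ (n1 - a, n2) (n1 + (k : ZMod p) * n2 - m - a = 0) (ind (n1 + (k : ZMod p) * n2 - m - a)) rfl ?_
    rintro ⟨t1, t2⟩
    simp only [Wall.ActEq, Defect.obj, Wall.base, Prod.mk.injEq]
    grind
  case F₀T =>
    change ZMod p × ZMod p at n
    obtain ⟨n1, n2⟩ := n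
    refine (character_of_single _ rfl _ _ (n1, n2) True 1 (if_pos trivial) ?_).trans (mul_one _)
    rintro ⟨t1, t2⟩
    simp only [Wall.ActEq, Defect.obj, Wall.base, Prod.mk.injEq]
    grind
  case FT q =>
    change ZMod p × ZMod p at n
    obtain ⟨n1, n2⟩ := n
    refine (character_of_single _ rfl _ _ (n1, n2) True 1 (if_pos trivial) ?_).trans (mul_one _)
    rintro ⟨t1, t2⟩
    simp only [Wall.ActEq, Defect.obj, Wall.base, Prod.mk.injEq]
    grind
  case LR =>
    change ZMod p at m n
    refine (character_of_single _ rfl _ _ (n, m) True 1 (if_pos trivial) ?_).trans (mul_one _)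
    rintro ⟨t1, t2⟩
    simp only [Wall.ActEq, Defect.obj, Wall.base, Prod.mk.injEq]
    grind
  case RL =>
    change ZMod p at m n
    refine (character_of_single _ rfl _ _ (m, n) True 1 (if_pos trivial) ?_).trans (mul_one _)
    rintro ⟨t1, t2⟩
    simp only [Wall.ActEq, Defect.obj, Wall.base, Prod.mk.injEq]
    grind
  case LX l =>
    change ZMod p at m n
    refine (character_of_single _ rfl _ _ (n - (l : ZMod p) * m, m) True 1 (if_pos trivial) ?_).trans (mul_one _)
    rintro ⟨t1, t2⟩
    simp only [Wall.ActEq, Defect.obj, Wall.base, Prod.mk.injEq]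
    grind
  case RX k =>
    change ZMod p at m n
    have hk := k.mul_inv
    refine (character_of_single _ rfl _ _ (m, ((k⁻¹ : (ZMod p)ˣ) : ZMod p) * (n - m)) True 1 (if_pos trivial) ?_).trans (mul_one _)
    rintro ⟨t1, t2⟩
    simp only [Wall.ActEq, Defect.obj, Wall.base, Prod.mk.injEq]
    grind
  case XL k =>
    change ZMod p at m n
    refine (character_of_single _ rfl _ _ (m - (k : ZMod p) * n, n) True 1 (if_pos trivial) ?_).trans (mul_one _)
    rintro ⟨t1, t2⟩
    simp only [Wall.ActEq, Defect.obj, Wall.base, Prod.mk.injEq]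
    grind
  case XR k =>
    change ZMod p at m n
    have hk := k.mul_inv
    refine (character_of_single _ rfl _ _ (n, ((k⁻¹ : (ZMod p)ˣ) : ZMod p) * (m - n)) True 1 (if_pos trivial) ?_).trans (mul_one _)
    rintro ⟨t1, t2⟩
    simp only [Wall.ActEq, Defect.obj, Wall.base, Prod.mk.injEq]
    grind
  case LL a x =>
    change ZMod p at m n
    refine (character_of_line _ 1 0 _ rfl (Or.inl one_ne_zero) _ _ (0, m) (n - m - a = 0)
      (ind (n - m - a)) rfl (fun t => t.1) ?_ ?_ (h) (-g) ?_ ?_).trans ?_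
    · rintro ⟨t1, t2⟩
      simp only [Wall.ActEq, Defect.obj, Wall.base]
      grind
    · simp only [Wall.ActEq, Defect.obj, Wall.base]
      grind
    · simp only [Prod.neg_mk, Prod.mk.injEq]
      grind
    · simp only [Prod.neg_mk, Prod.mk.injEq]
      grind
    · simp only [Wall.level, sub_self, zero_mul, root_zero, mul_one]; rfl
  case LF₀ x =>
    change ZMod p at m
    refine (character_of_line _ 1 0 _ rfl (Or.inl one_ne_zero) _ _ (0, m) True
      1 (if_pos trivial) (fun t => t.1) ?_ ?_ (h) (-g) ?_ ?_).trans ?_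
    · rintro ⟨t1, t2⟩
      simp only [Wall.ActEq, Defect.obj, Wall.base]
      grind
    · simp only [Wall.ActEq, Defect.obj, Wall.base]
      grind
    · simp only [Prod.neg_mk, Prod.mk.injEq]
      grind
    · simp only [Prod.neg_mk, Prod.mk.injEq]
      grind
    · simp only [Wall.level, sub_self, zero_mul, root_zero, mul_one]; rfl
  case F₀L x =>
    change ZMod p at n
    refine (character_of_line _ 1 0 _ rfl (Or.inl one_ne_zero) _ _ (0, n) True
      1 (if_pos trivial) (fun t => t.1) ?_ ?_ (h) (-g) ?_ ?_).trans ?_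
    · rintro ⟨t1, t2⟩
      simp only [Wall.ActEq, Defect.obj, Wall.base]
      grind
    · simp only [Wall.ActEq, Defect.obj, Wall.base]
      grind
    · simp only [Prod.neg_mk, Prod.mk.injEq]
      grind
    · simp only [Prod.neg_mk, Prod.mk.injEq]
      grind
    · simp only [Wall.level, sub_self, zero_mul, root_zero, mul_one]; rfl
  case LF r x =>
    change ZMod p at m
    refine (character_of_line _ 1 0 _ rfl (Or.inl one_ne_zero) _ _ (0, m) True
      1 (if_pos trivial) (fun t => t.1) ?_ ?_ (h) (-g) ?_ ?_).trans ?_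
    · rintro ⟨t1, t2⟩
      simp only [Wall.ActEq, Defect.obj, Wall.base]
      grind
    · simp only [Wall.ActEq, Defect.obj, Wall.base]
      grind
    · simp only [Prod.neg_mk, Prod.mk.injEq]
      grind
    · simp only [Prod.neg_mk, Prod.mk.injEq]
      grind
    -- The levels differ, so the commutator with the string (0, m) survives and shifts the label x
    -- by r m.
    · simp only [Wall.level, mul_one, ← root_add, mul_assoc]
      refine congrArg₂ (· * ·) (rfl : ind h = ind h) (congrArg root (?_ : _ = -g * (x + (r : ZMod p) * m)))
      ring
  case FL q x =>
    change ZMod p at n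
    refine (character_of_line _ 1 0 _ rfl (Or.inl one_ne_zero) _ _ (0, n) True
      1 (if_pos trivial) (fun t => t.1) ?_ ?_ (h) (-g) ?_ ?_).trans ?_
    · rintro ⟨t1, t2⟩
      simp only [Wall.ActEq, Defect.obj, Wall.base]
      grind
    · simp only [Wall.ActEq, Defect.obj, Wall.base]
      grind
    · simp only [Prod.neg_mk, Prod.mk.injEq]
      grind
    · simp only [Prod.neg_mk, Prod.mk.injEq]
      grind
    · simp only [Wall.level, mul_one, ← root_add, mul_assoc]
      refine congrArg₂ (· * ·) (rfl : ind h = ind h) (congrArg root (?_ : _ = -g * (x - (q : ZMod p) * n)))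
      ring
  case RR a x =>
    change ZMod p at m n
    refine (character_of_line _ 0 (-1) _ rfl (Or.inr h1) _ _ (m, 0) (n - m - a = 0)
      (ind (n - m - a)) rfl (fun t => - t.2) ?_ ?_ (g) (h) ?_ ?_).trans ?_
    · rintro ⟨t1, t2⟩
      simp only [Wall.ActEq, Defect.obj, Wall.base]
      grind
    · simp only [Wall.ActEq, Defect.obj, Wall.base]
      grind
    · simp only [Prod.neg_mk, Prod.mk.injEq]
      grind
    · simp only [Prod.neg_mk, Prod.mk.injEq]
      grind
    · simp only [Wall.level, sub_self, zero_mul, root_zero, mul_one]; rfl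
  case RF₀ x =>
    change ZMod p at m
    refine (character_of_line _ 0 (-1) _ rfl (Or.inr h1) _ _ (m, 0) True
      1 (if_pos trivial) (fun t => - t.2) ?_ ?_ (g) (h) ?_ ?_).trans ?_
    · rintro ⟨t1, t2⟩
      simp only [Wall.ActEq, Defect.obj, Wall.base]
      grind
    · simp only [Wall.ActEq, Defect.obj, Wall.base]
      grind
    · simp only [Prod.neg_mk, Prod.mk.injEq]
      grind
    · simp only [Prod.neg_mk, Prod.mk.injEq]
      grind
    · simp only [Wall.level, sub_self, zero_mul, root_zero, mul_one]; rfl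
  case F₀R x =>
    change ZMod p at n
    refine (character_of_line _ 0 (-1) _ rfl (Or.inr h1) _ _ (n, 0) True
      1 (if_pos trivial) (fun t => - t.2) ?_ ?_ (g) (h) ?_ ?_).trans ?_
    · rintro ⟨t1, t2⟩
      simp only [Wall.ActEq, Defect.obj, Wall.base]
      grind
    · simp only [Wall.ActEq, Defect.obj, Wall.base]
      grind
    · simp only [Prod.neg_mk, Prod.mk.injEq]
      grind
    · simp only [Prod.neg_mk, Prod.mk.injEq]
      grind
    · simp only [Wall.level, sub_self, zero_mul, root_zero, mul_one]; rfl
  case RF r x =>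
    change ZMod p at m
    refine (character_of_line _ 0 (-1) _ rfl (Or.inr h1) _ _ (m, 0) True
      1 (if_pos trivial) (fun t => - t.2) ?_ ?_ (g) (h) ?_ ?_).trans ?_
    · rintro ⟨t1, t2⟩
      simp only [Wall.ActEq, Defect.obj, Wall.base]
      grind
    · simp only [Wall.ActEq, Defect.obj, Wall.base]
      grind
    · simp only [Prod.neg_mk, Prod.mk.injEq]
      grind
    · simp only [Prod.neg_mk, Prod.mk.injEq]
      grind
    · simp only [Wall.level, mul_one, ← root_add, mul_assoc]
      refine congrArg₂ (· * ·) (rfl : ind g = ind g) (congrArg root (?_ : _ = h * (x + (r : ZMod p) * m)))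
      ring
  case FR q x =>
    change ZMod p at n
    refine (character_of_line _ 0 (-1) _ rfl (Or.inr h1) _ _ (n, 0) True
      1 (if_pos trivial) (fun t => - t.2) ?_ ?_ (g) (h) ?_ ?_).trans ?_
    · rintro ⟨t1, t2⟩
      simp only [Wall.ActEq, Defect.obj, Wall.base]
      grind
    · simp only [Wall.ActEq, Defect.obj, Wall.base]
      grind
    · simp only [Prod.neg_mk, Prod.mk.injEq]
      grind
    · simp only [Prod.neg_mk, Prod.mk.injEq]
      grind
    · simp only [Wall.level, mul_one, ← root_add, mul_assoc]
      refine congrArg₂ (· * ·) (rfl : ind g = ind g) (congrArg root (?_ : _ = h * (x - (q : ZMod p) * n)))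
      ring
  case XX k l hkl a x =>
    change ZMod p at m n
    subst hkl
    refine (character_of_line _ k (-1) _ rfl (Or.inr h1) _ _ (m, 0) (n - m - a = 0)
      (ind (n - m - a)) rfl (fun t => - t.2) ?_ ?_ (g + (k : ZMod p) * h) (h) ?_ ?_).trans ?_
    · rintro ⟨t1, t2⟩
      simp only [Wall.ActEq, Defect.obj, Wall.base]
      grind
    · simp only [Wall.ActEq, Defect.obj, Wall.base]
      grind
    · simp only [Prod.neg_mk, Prod.mk.injEq]
      grind
    · simp only [Prod.neg_mk, Prod.mk.injEq]
      grind
    · simp only [Wall.level, sub_self, zero_mul, root_zero, mul_one]; rfl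
  case XF₀ k x =>
    change ZMod p at m
    have hk := k.mul_inv
    refine (character_of_line _ 1 (-((k⁻¹ : (ZMod p)ˣ) : ZMod p)) _ rfl (Or.inl one_ne_zero) _ _ (m, 0) True
      1 (if_pos trivial) (fun t => t.1 - m) ?_ ?_ (g + (k : ZMod p) * h) (-g) ?_ ?_).trans ?_
    · rintro ⟨t1, t2⟩
      simp only [Wall.ActEq, Defect.obj, Wall.base]
      grind
    · simp only [Wall.ActEq, Defect.obj, Wall.base]
      grind
    · simp only [Prod.neg_mk, Prod.mk.injEq]
      grind
    · simp only [Prod.neg_mk, Prod.mk.injEq]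
      grind
    · simp only [Wall.level, sub_self, zero_mul, root_zero, mul_one]; rfl
  case F₀X k x =>
    change ZMod p at n
    have hk := k.mul_inv
    refine (character_of_line _ 1 (-((k⁻¹ : (ZMod p)ˣ) : ZMod p)) _ rfl (Or.inl one_ne_zero) _ _ (n, 0) True
      1 (if_pos trivial) (fun t => t.1 - n) ?_ ?_ (g + (k : ZMod p) * h) (-g) ?_ ?_).trans ?_
    · rintro ⟨t1, t2⟩
      simp only [Wall.ActEq, Defect.obj, Wall.base]
      grind
    · simp only [Wall.ActEq, Defect.obj, Wall.base]
      grind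
    · simp only [Prod.neg_mk, Prod.mk.injEq]
      grind
    · simp only [Prod.neg_mk, Prod.mk.injEq]
      grind
    · simp only [Wall.level, sub_self, zero_mul, root_zero, mul_one]; rfl
  case XF k r x =>
    change ZMod p at m
    refine (character_of_line _ k (-1) _ rfl (Or.inr h1) _ _ (m, 0) True
      1 (if_pos trivial) (fun t => - t.2) ?_ ?_ (g + (k : ZMod p) * h) (h) ?_ ?_).trans ?_
    · rintro ⟨t1, t2⟩
      simp only [Wall.ActEq, Defect.obj, Wall.base]
      grind
    · simp only [Wall.ActEq, Defect.obj, Wall.base]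
      grind
    · simp only [Prod.neg_mk, Prod.mk.injEq]
      grind
    · simp only [Prod.neg_mk, Prod.mk.injEq]
      grind
    -- Both the commutator with (m, 0) and the term quadratic in the parameter survive; together
    -- they form the second phase of the trace.
    · simp only [Wall.level, mul_one]
      refine congrArg₂ _ rfl (congrArg _ ?_)
      ring
  case FX q l x =>
    change ZMod p at n
    refine (character_of_line _ l (-1) _ rfl (Or.inr h1) _ _ (n, 0) True
      1 (if_pos trivial) (fun t => - t.2) ?_ ?_ (g + (l : ZMod p) * h) (h) ?_ ?_).trans ?_
    · rintro ⟨t1, t2⟩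
      simp only [Wall.ActEq, Defect.obj, Wall.base]
      grind
    · simp only [Wall.ActEq, Defect.obj, Wall.base]
      grind
    · simp only [Prod.neg_mk, Prod.mk.injEq]
      grind
    · simp only [Prod.neg_mk, Prod.mk.injEq]
      grind
    · simp only [Wall.level, mul_one]
      refine congrArg₂ _ rfl (congrArg _ ?_)
      ring
  case F₀F₀ x y => exact character_of_plane _ x y rfl _ _ (fun _ => ⟨trivial, trivial⟩) rfl
  case FF q r hqr x y =>
    subst hqr
    exact character_of_plane _ x y rfl _ _ (fun _ => ⟨trivial, trivial⟩) rfl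
  case F₀F r =>
    exact character_of_halfPlane _ rfl _ _ (fun _ => ⟨trivial, trivial⟩) r.ne_zero.symm
  case FF₀ q =>
    exact character_of_halfPlane _ rfl _ _ (fun _ => ⟨trivial, trivial⟩) q.ne_zero
  case FF' q r hqr =>
    exact character_of_halfPlane _ rfl _ _ (fun _ => ⟨trivial, trivial⟩) (level_ne hqr)

end TraceFormula

end VecZp
end

noncomputable section

set_option linter.unusedSimpArgs false

namespace VecZp

/-! ## Orthogonality and completeness of the simple defects -/

section Orthogonality

variable {p : ℕ} [Fact p.Prime] {M N : Wall p}

theorem natCast_prime_ne_zero : (p : ℂ) ≠ 0 := by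
  exact_mod_cast (Fact.out : p.Prime).ne_zero

theorem ind_neg (x : ZMod p) : ind (-x) = ind x := by simp [ind]

theorem root_one_two : root (1 : ZMod 2) = -1 := by
  have := ZMod.stdAddChar_coe (N := 2) 1
  simp only [Int.cast_one, Nat.cast_ofNat, mul_one] at this
  rw [root, this, mul_assoc, mul_div_cancel_left₀ _ (two_ne_zero), Complex.exp_pi_mul_I]

/-! ### The quadratic functions Θ. -/

theorem Theta_zero (x : ZMod p) (a : ℤ) : Theta x a 0 = 1 := by
  unfold Theta
  split_ifs with hp
  · simp
  · simp [root_zero]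

/-- The label enters Θ only through a linear character, also for p = 2, where the sign (-1)^(g x) is
ω^(g x). Labels can therefore be split off and the quadratic part treated separately. -/
theorem Theta_add (x y : ZMod p) (a : ℤ) (g : ZMod p) :
    Theta (x + y) a g = root (g * x) * Theta y a g := by
  unfold Theta
  split_ifs with hp
  · subst hp
    have v0 : (0 : ZMod 2).val = 0 := rfl
    have v1 : (1 : ZMod 2).val = 1 := rfl
    have v2 : (1 : ZMod 2) + 1 = 0 := rfl
    rw [← mul_assoc]
    congr 1
    rcases zero_or_one g with rfl | rfl <;> rcases zero_or_one x with rfl | rfl <;>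
      rcases zero_or_one y with rfl | rfl <;>
      simp [v0, v1, v2, root_zero, root_one_two]
  · rw [← root_add]; congr 1; ring

theorem Theta_eq (x : ZMod p) (a : ℤ) (g : ZMod p) :
    Theta x a g = root (g * x) * Theta 0 a g := by
  rw [← Theta_add, add_zero]

theorem Theta_mul_neg (x : ZMod p) (a : ℤ) (g : ZMod p) :
    Theta x a g * Theta x a (-g) = root ((a : ZMod p) * g ^ 2) := by
  have h := Theta_mul x a g (-g)
  rw [add_neg_cancel, Theta_zero] at h
  rw [eq_inv_of_mul_eq_one_left h, ← root_neg]
  congr 1; ring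

/-! ### Pairing idempotents with traces. -/

theorem sum_single_mul (f : Strings p → ℂ) :
    ∑ w, (Pi.single 0 1 : Strings p → ℂ) w * f w = f 0 := by
  rw [Finset.sum_eq_single 0]
  · simp
  · intro w _ hw; simp [Pi.single_eq_of_ne hw]
  · simp

theorem sum_average_mul {G : Type} [Fintype G] (φ : G → Strings p) (χ : G → ℂ)
    (f : Strings p → ℂ) :
    ∑ w, average φ χ w * f w = (Fintype.card G : ℂ)⁻¹ * ∑ g, χ g * f (φ g) := by
  simp only [average, Pi.smul_apply, Finset.sum_apply, smul_eq_mul, mul_assoc, ← Finset.mul_sum,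
    Finset.sum_mul]
  rw [Finset.sum_comm]
  congr 1
  refine Finset.sum_congr rfl fun g _ => ?_
  rw [Finset.sum_eq_single (φ g)]
  · simp
  · intro w _ hw; simp [Pi.single_eq_of_ne hw]
  · simp

theorem sum_lineAverage_mul (u v : ZMod p) (χ : ZMod p → ℂ) (f : Strings p → ℂ) :
    ∑ w, lineAverage u v χ w * f w = (p : ℂ)⁻¹ * ∑ g, χ g * f (u * g, v * g) := by
  rw [lineAverage, sum_average_mul, ZMod.card]

theorem inv_mul_sum_root (a b : ZMod p) (e : ℂ) (f : ZMod p → ℂ)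
    (hf : ∀ g, f g = root ((b - a) * g) * e) :
    (p : ℂ)⁻¹ * ∑ g, f g = ind (b - a) * e := by
  simp only [hf]
  rw [← Finset.sum_mul, sum_root_mul]
  have := natCast_prime_ne_zero (p := p)
  field_simp

/-- The pairing of the idempotent of `γ'` with the trace of `γ`. -/
def Defect.pairing (γ γ' : Defect p M N) : ℂ :=
  ∑ w, γ'.diagram w * γ.trace γ'.obj.low γ'.obj.up w

theorem pairing_of_single (γ γ' : Defect p M N) (hγ : γ'.diagram = Pi.single 0 1) :
    γ.pairing γ' = γ.trace γ'.obj.low γ'.obj.up 0 := by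
  rw [Defect.pairing, hγ, sum_single_mul]

/-- On the support of γ' the summand is a linear character whose exponent is the difference of the
labels, so its average is a delta function; e collects what does not depend on g. -/
theorem pairing_of_line (γ γ' : Defect p M N) (u v : ZMod p) (χ : ZMod p → ℂ)
    (hγ : γ'.diagram = lineAverage u v χ) (a b : ZMod p) (e : ℂ)
    (h : ∀ g, χ g * γ.trace γ'.obj.low γ'.obj.up (u * g, v * g) = root ((b - a) * g) * e) :
    γ.pairing γ' = ind (b - a) * e := by
  rw [Defect.pairing, hγ, sum_lineAverage_mul, inv_mul_sum_root a b e _ h]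

theorem pairing_of_plane (γ γ' : Defect p M N) (x y x' y' : ZMod p)
    (hγ : γ'.diagram = average (fun g : ZMod p × ZMod p => (g.1, -g.2))
      fun g => root (g.1 * x' + g.2 * y'))
    (h : ∀ w, γ.trace γ'.obj.low γ'.obj.up w = root (-w.1 * x + w.2 * y)) :
    γ.pairing γ' = ind (x' - x) * ind (y' - y) := by
  rw [Defect.pairing, hγ, sum_average_mul]
  have h1 : ∀ g : ZMod p × ZMod p, root (g.1 * x' + g.2 * y') *
      γ.trace γ'.obj.low γ'.obj.up (g.1, -g.2) =
      root ((x' - x) * g.1) * root ((y' - y) * g.2) := by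
    intro g
    rw [h, ← root_add, ← root_add]; congr 1; ring
  simp only [h1, Fintype.sum_prod_type, ← Finset.sum_mul_sum, sum_root_mul, Fintype.card_prod,
    ZMod.card]
  have := natCast_prime_ne_zero (p := p)
  push_cast
  field_simp

/-- The trace is p at w = 0 and zero elsewhere, while the idempotent has coefficient 1/p there. -/
theorem pairing_of_halfPlane (γ γ' : Defect p M N)
    (hγ : γ'.diagram = lineAverage 0 (-1) fun _ => 1)
    (h : ∀ w, γ.trace γ'.obj.low γ'.obj.up w = p * (ind w.1 * ind w.2)) : γ.pairing γ' = 1 := by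
  rw [Defect.pairing, hγ, sum_lineAverage_mul, Finset.sum_eq_single 0]
  · have := natCast_prime_ne_zero (p := p)
    rw [h]; simp only [mul_zero, ind_zero]; field_simp
  · intro g _ hg
    rw [h]; simp [ind_of_ne (neg_ne_zero.2 hg)]
  · simp

theorem ind_sub (a b : ZMod p) : ind (b - a) = if a = b then 1 else 0 := by
  simp only [ind, sub_eq_zero, eq_comm]

-- Orthogonality of characters at the object of γ': delta functions of position labels are read off
-- directly, and those of character labels arise from averaging.
set_option maxHeartbeats 1000000 in
theorem pairing_eq (γ γ' : Defect p M N) : γ.pairing γ' = if γ = γ' then 1 else 0 := by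
  cases γ
  case TT a b =>
    cases γ'
    rename_i a' b'
    rw [pairing_of_single _ _ rfl]
    change ind 0 * ind 0 * (ind (a' - 0 - a) * ind (b' - 0 - b)) = _
    simp only [ind_zero, sub_zero, ind_sub, Defect.TT.injEq, mul_one, one_mul]
    split_ifs <;> simp_all
  case TL a =>
    cases γ'
    rename_i a'
    rw [pairing_of_single _ _ rfl]
    change ind 0 * ind 0 * ind (a' - 0 - a) = _
    simp only [ind_zero, sub_zero, mul_zero, add_zero, ind_sub, Defect.TL.injEq, mul_one, one_mul, true_and]
  case TR a =>
    cases γ'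
    rename_i a'
    rw [pairing_of_single _ _ rfl]
    change ind 0 * ind 0 * ind (a' - 0 - a) = _
    simp only [ind_zero, sub_zero, mul_zero, add_zero, ind_sub, Defect.TR.injEq, mul_one, one_mul, true_and]
  case TX l a =>
    cases γ'
    rename_i a'
    rw [pairing_of_single _ _ rfl]
    change ind 0 * ind 0 * ind (a' - 0 - (l : ZMod p) * 0 - a) = _
    simp only [ind_zero, sub_zero, mul_zero, add_zero, ind_sub, Defect.TX.injEq, mul_one, one_mul, true_and]
  case LT a =>
    cases γ'
    rename_i a'
    rw [pairing_of_single _ _ rfl]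
    change ind 0 * ind 0 * ind (a' - 0 - a) = _
    simp only [ind_zero, sub_zero, mul_zero, add_zero, ind_sub, Defect.LT.injEq, mul_one, one_mul, true_and]
  case RT a =>
    cases γ'
    rename_i a'
    rw [pairing_of_single _ _ rfl]
    change ind 0 * ind 0 * ind (a' - 0 - a) = _
    simp only [ind_zero, sub_zero, mul_zero, add_zero, ind_sub, Defect.RT.injEq, mul_one, one_mul, true_and]
  case XT k a =>
    cases γ'
    rename_i a'
    rw [pairing_of_single _ _ rfl]
    change ind 0 * ind 0 * ind (a' + (k : ZMod p) * 0 - 0 - a) = _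
    simp only [ind_zero, sub_zero, mul_zero, add_zero, ind_sub, Defect.XT.injEq, mul_one, one_mul, true_and]
  case TF₀  =>
    cases γ'
    rw [pairing_of_single _ _ rfl]
    rw [if_pos rfl]
    change ind 0 * ind 0 = _
    rw [ind_zero, mul_one]
  case TF r =>
    cases γ'
    rw [pairing_of_single _ _ rfl]
    rw [if_pos rfl]
    change ind 0 * ind 0 = _
    rw [ind_zero, mul_one]
  case LR  =>
    cases γ'
    rw [pairing_of_single _ _ rfl]
    rw [if_pos rfl]
    change ind 0 * ind 0 = _
    rw [ind_zero, mul_one]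
  case RL  =>
    cases γ'
    rw [pairing_of_single _ _ rfl]
    rw [if_pos rfl]
    change ind 0 * ind 0 = _
    rw [ind_zero, mul_one]
  case LX l =>
    cases γ'
    rw [pairing_of_single _ _ rfl]
    rw [if_pos rfl]
    change ind 0 * ind 0 = _
    rw [ind_zero, mul_one]
  case RX l =>
    cases γ'
    rw [pairing_of_single _ _ rfl]
    rw [if_pos rfl]
    change ind 0 * ind 0 = _
    rw [ind_zero, mul_one]
  case XL k =>
    cases γ'
    rw [pairing_of_single _ _ rfl]
    rw [if_pos rfl]
    change ind 0 * ind 0 = _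
    rw [ind_zero, mul_one]
  case XR k =>
    cases γ'
    rw [pairing_of_single _ _ rfl]
    rw [if_pos rfl]
    change ind 0 * ind 0 = _
    rw [ind_zero, mul_one]
  case F₀T  =>
    cases γ'
    rw [pairing_of_single _ _ rfl]
    rw [if_pos rfl]
    change ind 0 * ind 0 = _
    rw [ind_zero, mul_one]
  case FT q =>
    cases γ'
    rw [pairing_of_single _ _ rfl]
    rw [if_pos rfl]
    change ind 0 * ind 0 = _
    rw [ind_zero, mul_one]
  case XX' k l h =>
    cases γ'
    · contradiction
    · rw [pairing_of_single _ _ rfl, if_pos rfl]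
      change ind 0 * ind 0 = _
      rw [ind_zero, mul_one]
  case LL a x =>
    cases γ'
    rename_i a' x'
    rw [pairing_of_line _ _ 1 0 _ rfl x x' (ind (a' - 0 - a))]
    · simp only [sub_zero, ind_sub, Defect.LL.injEq, mul_one, true_and]
      split_ifs <;> simp_all
    · intro g
      change root (g * x') * (ind ((0 * g)) * (ind (a' - 0 - a)) * root (-(1 * g) * x)) = _
      have hc : (0 * g) = 0 := by ring
      have hr : root ((x' - x) * g) = root (g * x') * root (-(1 * g) * x) := by
        rw [← root_add]; congr 1; ring
      rw [hc, ind_zero, hr]; ring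
  case LF₀ x =>
    cases γ'
    rename_i x'
    rw [pairing_of_line _ _ 1 0 _ rfl x x' 1]
    · simp only [sub_zero, ind_sub, Defect.LF₀.injEq, mul_one, true_and]
    · intro g
      change root (g * x') * (ind ((0 * g)) * root (-(1 * g) * x)) = _
      have hc : (0 * g) = 0 := by ring
      have hr : root ((x' - x) * g) = root (g * x') * root (-(1 * g) * x) := by
        rw [← root_add]; congr 1; ring
      rw [hc, ind_zero, hr]; ring
  case F₀L x =>
    cases γ'
    rename_i x'
    rw [pairing_of_line _ _ 1 0 _ rfl x x' 1]
    · simp only [sub_zero, ind_sub, Defect.F₀L.injEq, mul_one, true_and]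
    · intro g
      change root (g * x') * (ind ((0 * g)) * root (-(1 * g) * x)) = _
      have hc : (0 * g) = 0 := by ring
      have hr : root ((x' - x) * g) = root (g * x') * root (-(1 * g) * x) := by
        rw [← root_add]; congr 1; ring
      rw [hc, ind_zero, hr]; ring
  case LF r x =>
    cases γ'
    rename_i x'
    rw [pairing_of_line _ _ 1 0 _ rfl x x' 1]
    · simp only [sub_zero, ind_sub, Defect.LF.injEq, mul_one, true_and]
    · intro g
      change root (g * x') * (ind ((0 * g)) * root (-(1 * g) * (x + (r : ZMod p) * 0))) = _
      have hc : (0 * g) = 0 := by ring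
      have hr : root ((x' - x) * g) = root (g * x') * root (-(1 * g) * (x + (r : ZMod p) * 0)) := by
        rw [← root_add]; congr 1; ring
      rw [hc, ind_zero, hr]; ring
  case FL q x =>
    cases γ'
    rename_i x'
    rw [pairing_of_line _ _ 1 0 _ rfl x x' 1]
    · simp only [sub_zero, ind_sub, Defect.FL.injEq, mul_one, true_and]
    · intro g
      change root (g * x') * (ind ((0 * g)) * root (-(1 * g) * (x - (q : ZMod p) * 0))) = _
      have hc : (0 * g) = 0 := by ring
      have hr : root ((x' - x) * g) = root (g * x') * root (-(1 * g) * (x - (q : ZMod p) * 0)) := by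
        rw [← root_add]; congr 1; ring
      rw [hc, ind_zero, hr]; ring
  case RR a x =>
    cases γ'
    rename_i a' x'
    rw [pairing_of_line _ _ 0 (-1) _ rfl x x' (ind (a' - 0 - a))]
    · simp only [sub_zero, ind_sub, Defect.RR.injEq, mul_one, true_and]
      split_ifs <;> simp_all
    · intro g
      change root (g * x') * (ind ((0 * g)) * (ind (a' - 0 - a)) * root (((-1) * g) * x)) = _
      have hc : (0 * g) = 0 := by ring
      have hr : root ((x' - x) * g) = root (g * x') * root (((-1) * g) * x) := by
        rw [← root_add]; congr 1; ring
      rw [hc, ind_zero, hr]; ring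
  case RF₀ x =>
    cases γ'
    rename_i x'
    rw [pairing_of_line _ _ 0 (-1) _ rfl x x' 1]
    · simp only [sub_zero, ind_sub, Defect.RF₀.injEq, mul_one, true_and]
    · intro g
      change root (g * x') * (ind ((0 * g)) * root (((-1) * g) * x)) = _
      have hc : (0 * g) = 0 := by ring
      have hr : root ((x' - x) * g) = root (g * x') * root (((-1) * g) * x) := by
        rw [← root_add]; congr 1; ring
      rw [hc, ind_zero, hr]; ring
  case F₀R x =>
    cases γ'
    rename_i x'
    rw [pairing_of_line _ _ 0 (-1) _ rfl x x' 1]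
    · simp only [sub_zero, ind_sub, Defect.F₀R.injEq, mul_one, true_and]
    · intro g
      change root (g * x') * (ind ((0 * g)) * root (((-1) * g) * x)) = _
      have hc : (0 * g) = 0 := by ring
      have hr : root ((x' - x) * g) = root (g * x') * root (((-1) * g) * x) := by
        rw [← root_add]; congr 1; ring
      rw [hc, ind_zero, hr]; ring
  case RF r x =>
    cases γ'
    rename_i x'
    rw [pairing_of_line _ _ 0 (-1) _ rfl x x' 1]
    · simp only [sub_zero, ind_sub, Defect.RF.injEq, mul_one, true_and]
    · intro g
      change root (g * x') * (ind ((0 * g)) * root (((-1) * g) * (x + (r : ZMod p) * 0))) = _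
      have hc : (0 * g) = 0 := by ring
      have hr : root ((x' - x) * g) = root (g * x') * root (((-1) * g) * (x + (r : ZMod p) * 0)) := by
        rw [← root_add]; congr 1; ring
      rw [hc, ind_zero, hr]; ring
  case FR q x =>
    cases γ'
    rename_i x'
    rw [pairing_of_line _ _ 0 (-1) _ rfl x x' 1]
    · simp only [sub_zero, ind_sub, Defect.FR.injEq, mul_one, true_and]
    · intro g
      change root (g * x') * (ind ((0 * g)) * root (((-1) * g) * (x - (q : ZMod p) * 0))) = _
      have hc : (0 * g) = 0 := by ring
      have hr : root ((x' - x) * g) = root (g * x') * root (((-1) * g) * (x - (q : ZMod p) * 0)) := by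
        rw [← root_add]; congr 1; ring
      rw [hc, ind_zero, hr]; ring
  case XX k l h a x =>
    subst h
    cases γ'
    swap
    · contradiction
    rename_i a' x' _
    rw [pairing_of_line _ _ (k : ZMod p) (-1) _ rfl x x' (ind (a' - 0 - a))]
    · simp only [sub_zero, ind_sub, Defect.XX.injEq, mul_one, true_and]
      split_ifs <;> simp_all
    · intro g
      change root (g * x') * (ind (((k : ZMod p) * g) + (k : ZMod p) * ((-1) * g)) * (ind (a' - 0 - a)) * root (((-1) * g) * x)) = _
      have hc : ((k : ZMod p) * g) + (k : ZMod p) * ((-1) * g) = 0 := by ring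
      have hr : root ((x' - x) * g) = root (g * x') * root (((-1) * g) * x) := by
        rw [← root_add]; congr 1; ring
      rw [hc, ind_zero, hr]; ring
  case XF₀ k x =>
    cases γ'
    rename_i x'
    rw [pairing_of_line _ _ 1 (-((k⁻¹ : (ZMod p)ˣ) : ZMod p)) _ rfl x x' 1]
    · simp only [sub_zero, ind_sub, Defect.XF₀.injEq, mul_one, true_and]
    · intro g
      change root (g * x') * (ind ((1 * g) + (k : ZMod p) * ((-((k⁻¹ : (ZMod p)ˣ) : ZMod p)) * g)) * root (-(1 * g) * x)) = _
      have hk := k.mul_inv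
      have hc : (1 * g) + (k : ZMod p) * ((-((k⁻¹ : (ZMod p)ˣ) : ZMod p)) * g) = 0 := by grind
      have hr : root ((x' - x) * g) = root (g * x') * root (-(1 * g) * x) := by
        rw [← root_add]; congr 1; ring
      rw [hc, ind_zero, hr]; ring
  case F₀X k x =>
    cases γ'
    rename_i x'
    rw [pairing_of_line _ _ 1 (-((k⁻¹ : (ZMod p)ˣ) : ZMod p)) _ rfl x x' 1]
    · simp only [sub_zero, ind_sub, Defect.F₀X.injEq, mul_one, true_and]
    · intro g
      change root (g * x') * (ind ((1 * g) + (k : ZMod p) * ((-((k⁻¹ : (ZMod p)ˣ) : ZMod p)) * g)) * root (-(1 * g) * x)) = _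
      have hk := k.mul_inv
      have hc : (1 * g) + (k : ZMod p) * ((-((k⁻¹ : (ZMod p)ˣ) : ZMod p)) * g) = 0 := by grind
      have hr : root ((x' - x) * g) = root (g * x') * root (-(1 * g) * x) := by
        rw [← root_add]; congr 1; ring
      rw [hc, ind_zero, hr]; ring
  case XF k r x =>
    cases γ'
    rename_i x'
    rw [pairing_of_line _ _ (k : ZMod p) (-1) _ rfl x x' 1]
    · simp only [sub_zero, ind_sub, Defect.XF.injEq, mul_one, true_and]
    · intro g
      change Theta x' ((k : ZMod p).val * (r : ZMod p).val) g * (ind (((k : ZMod p) * g) + (k : ZMod p) * ((-1) * g)) * Theta x ((k : ZMod p).val * (r : ZMod p).val) ((-1) * g) *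
        root ((r : ZMod p) * ((-1) * g) * (0 - (k : ZMod p) * ((-1) * g)))) = _
      have hc : ((k : ZMod p) * g) + (k : ZMod p) * ((-1) * g) = 0 := by ring
      have ht := Theta_mul_neg x ((k : ZMod p).val * (r : ZMod p).val) g
      have hr : root ((x' - x) * g) * root (g * x) = root (g * x') := by
        rw [← root_add]; congr 1; ring
      -- The quadratic phase of Θ(g) Θ(-g) cancels the one that the associator puts into the trace,
      -- so only linear characters remain.
      have hs : root ((((k : ZMod p).val * (r : ZMod p).val : ℤ) : ZMod p) * g ^ 2) * root ((r : ZMod p) * ((-1) * g) * (0 - (k : ZMod p) * ((-1) * g))) = 1 := by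
        rw [← root_add, ← root_zero (p := p)]; congr 1; push_cast; simp only [ZMod.natCast_val, ZMod.cast_id]; ring
      rw [Theta_eq x] at ht
      rw [hc, ind_zero, Theta_eq x', neg_one_mul, mul_one, ← hr]
      rw [neg_one_mul, ← ht] at hs
      linear_combination root ((x' - x) * g) * hs
  case FX q l x =>
    cases γ'
    rename_i x'
    rw [pairing_of_line _ _ (l : ZMod p) (-1) _ rfl x x' 1]
    · simp only [sub_zero, ind_sub, Defect.FX.injEq, mul_one, true_and]
    · intro g
      change Theta x' (-((q : ZMod p).val * (l : ZMod p).val)) g * (ind (((l : ZMod p) * g) + (l : ZMod p) * ((-1) * g)) * Theta x (-((q : ZMod p).val * (l : ZMod p).val)) ((-1) * g) *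
        root (-(q : ZMod p) * ((-1) * g) * (0 - (l : ZMod p) * ((-1) * g)))) = _
      have hc : ((l : ZMod p) * g) + (l : ZMod p) * ((-1) * g) = 0 := by ring
      have ht := Theta_mul_neg x (-((q : ZMod p).val * (l : ZMod p).val)) g
      have hr : root ((x' - x) * g) * root (g * x) = root (g * x') := by
        rw [← root_add]; congr 1; ring
      have hs : root (((-((q : ZMod p).val * (l : ZMod p).val) : ℤ) : ZMod p) * g ^ 2) * root (-(q : ZMod p) * ((-1) * g) * (0 - (l : ZMod p) * ((-1) * g))) = 1 := by
        rw [← root_add, ← root_zero (p := p)]; congr 1; push_cast; simp only [ZMod.natCast_val, ZMod.cast_id]; ring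
      rw [Theta_eq x] at ht
      rw [hc, ind_zero, Theta_eq x', neg_one_mul, mul_one, ← hr]
      rw [neg_one_mul, ← ht] at hs
      linear_combination root ((x' - x) * g) * hs
  case F₀F₀ x y =>
    cases γ'
    rw [pairing_of_plane _ _ x y _ _ rfl (fun _ => rfl)]
    simp only [ind_sub, Defect.F₀F₀.injEq]
    split_ifs <;> simp_all
  case FF q r h x y =>
    subst h
    cases γ'
    · rw [pairing_of_plane _ _ x y _ _ rfl (fun _ => rfl)]
      simp only [ind_sub, Defect.FF.injEq, true_and]
      split_ifs <;> simp_all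
    · contradiction
  case F₀F r =>
    cases γ'
    exact (pairing_of_halfPlane _ _ rfl (fun _ => rfl)).trans (if_pos rfl).symm
  case FF₀ r =>
    cases γ'
    exact (pairing_of_halfPlane _ _ rfl (fun _ => rfl)).trans (if_pos rfl).symm
  case FF' q r h =>
    cases γ'
    · contradiction
    · exact (pairing_of_halfPlane _ _ rfl (fun _ => rfl)).trans (if_pos rfl).symm

theorem finrank_homSpace_interface (γ γ' : Defect p M N) :
    Module.finrank ℂ (homSpace γ.interface γ'.interface) = if γ = γ' then 1 else 0 := by
  have h := finrank_homSpace γ.interface γ'.interface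
  simp only [character_interface] at h
  have h1 := h.trans (pairing_eq γ γ')
  split_ifs at h1 ⊢ <;> exact_mod_cast h1

end Orthogonality

end VecZp
end

noncomputable section

set_option linter.unusedSimpArgs false

namespace VecZp

/-! ### Every object is resolved by listed defects. -/

section Completeness

variable {p : ℕ} [Fact p.Prime] {M N : Wall p}

/-- The identity of `X` is a combination of conjugates of idempotents of simple defects by
strings. -/
def IsResolved (X : Ann M N) : Prop :=
  ∃ (J : Type) (_ : Fintype J) (γ : J → Defect p M N) (s : J → Strings p),
    (∀ j, M.ActEq (s j) (γ j).obj.low X.low ∧ N.ActEq (s j) (γ j).obj.up X.up) ∧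
    ∀ w, ∑ j, (γ j).diagram w *
      root ((M.level - N.level) * ((s j).1 * w.2 - w.1 * (s j).2)) =
        (Pi.single 0 1 : Strings p → ℂ) w

theorem single_zero_apply (w : Strings p) :
    (Pi.single 0 1 : Strings p → ℂ) w = ind w.1 * ind w.2 := by
  obtain ⟨g, h⟩ := w
  by_cases hw : ((g, h) : Strings p) = 0
  · rw [hw, Pi.single_eq_same]; simp [ind_zero]
  · rw [Pi.single_eq_of_ne hw]
    have : g ≠ 0 ∨ h ≠ 0 := by by_contra! h'; exact hw (Prod.ext h'.1 h'.2)
    rcases this with h | h <;> simp [ind_of_ne h]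

theorem isResolved_of_single {X : Ann M N} (γ : Defect p M N) (hγ : γ.diagram = Pi.single 0 1)
    (s : Strings p) (hs : M.ActEq s γ.obj.low X.low ∧ N.ActEq s γ.obj.up X.up) :
    IsResolved X := by
  refine ⟨Unit, inferInstance, fun _ => γ, fun _ => s, fun _ => hs, fun w => ?_⟩
  simp only [Finset.univ_unique, Finset.sum_singleton, hγ]
  by_cases hw : w = 0
  · subst hw; simp [root_zero]
  · rw [Pi.single_eq_of_ne hw, zero_mul]

/-- Fourier inversion on the stabiliser: the idempotents of all its characters add up to the unit.
One string s serves for all labels, so the phase from conjugation factors out and equals 1 at w = 0.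
-/
theorem isResolved_of_average {X : Ann M N} {J G : Type} [Fintype J] [AddCommGroup G] [Fintype G]
    [DecidableEq G] (γ : J → Defect p M N) (φ : G → Strings p) (χ : J → G → ℂ)
    (hγ : ∀ j, (γ j).diagram = average φ (χ j)) (hφ : Function.Injective φ) (hφ0 : φ 0 = 0)
    (hχ : ∀ g, ∑ j, χ j g = Fintype.card G * if g = 0 then 1 else 0)
    (s : Strings p) (hs : ∀ j, M.ActEq s (γ j).obj.low X.low ∧ N.ActEq s (γ j).obj.up X.up) :
    IsResolved X := by
  refine ⟨J, inferInstance, γ, fun _ => s, hs, fun w => ?_⟩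
  simp only [hγ, ← Finset.sum_mul]
  have hc : (Fintype.card G : ℂ) ≠ 0 := by simp
  by_cases hw : ∃ g, w = φ g
  · obtain ⟨g, rfl⟩ := hw
    simp only [average_apply φ _ hφ, ← Finset.mul_sum, hχ]
    by_cases hg : g = 0
    · subst hg
      simp [hφ0, root_zero, hc]
    · rw [Pi.single_eq_of_ne (fun h => hg (hφ (h.trans hφ0.symm)))]
      simp [hg]
  · push Not at hw
    simp only [average_apply_of_notMem φ _ hw, Finset.sum_const_zero, zero_mul]
    rw [Pi.single_eq_of_ne]
    rintro rfl
    exact hw 0 hφ0.symm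

/-- The function ξ is the part common to all labels: 1, or Θ with label 0 when the line is twisted.
Only its value at 0 survives the sum over labels. -/
theorem isResolved_of_line {X : Ann M N} (γ : ZMod p → Defect p M N) (u v : ZMod p)
    (χ : ZMod p → ZMod p → ℂ) (hγ : ∀ x, (γ x).diagram = lineAverage u v (χ x))
    (huv : u ≠ 0 ∨ v ≠ 0) (ξ : ZMod p → ℂ) (hξ : ξ 0 = 1) (hχ : ∀ x g, χ x g = root (g * x) * ξ g)
    (s : Strings p) (hs : ∀ x, M.ActEq s (γ x).obj.low X.low ∧ N.ActEq s (γ x).obj.up X.up) :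
    IsResolved X := by
  refine isResolved_of_average γ _ χ hγ (line_injective huv) (by simp) (fun g => ?_) s hs
  simp only [hχ, ← Finset.sum_mul, sum_root_mul, ZMod.card, ind]
  split_ifs with h
  · rw [h, hξ, mul_one]
  · simp

theorem isResolved_of_plane {X : Ann M N} (γ : ZMod p → ZMod p → Defect p M N)
    (hγ : ∀ x y, (γ x y).diagram = average (fun g : ZMod p × ZMod p => (g.1, -g.2))
      fun g => root (g.1 * x + g.2 * y))
    (hs : ∀ x y, M.ActEq 0 (γ x y).obj.low X.low ∧ N.ActEq 0 (γ x y).obj.up X.up) :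
    IsResolved X := by
  refine isResolved_of_average (J := ZMod p × ZMod p) (fun x => γ x.1 x.2)
    (fun g : ZMod p × ZMod p => (g.1, -g.2)) (fun x g => root (g.1 * x.1 + g.2 * x.2))
    (fun x => hγ x.1 x.2)
    (fun a b hab => Prod.ext (Prod.ext_iff.1 hab).1 (neg_injective (Prod.ext_iff.1 hab).2))
    (by simp) (fun g => ?_) 0 (fun x => hs x.1 x.2)
  simp only [root_add, Fintype.sum_prod_type, ← Finset.sum_mul_sum, sum_root_mul,
    Fintype.card_prod, ZMod.card, ind, Prod.ext_iff, Prod.fst_zero, Prod.snd_zero]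
  push_cast
  split_ifs <;> simp_all

/-- The unique simple has dimension p, so p conjugates of one idempotent are needed. Conjugation by
(j, 0) multiplies it by a character of w.2; the sum over j leaves w.2 = 0, and the idempotent itself
requires w.1 = 0. -/
theorem isResolved_of_halfPlane {X : Ann M N} (γ : Defect p M N)
    (hγ : γ.diagram = lineAverage 0 (-1) fun _ => 1)
    (hs : ∀ s, M.ActEq s γ.obj.low X.low ∧ N.ActEq s γ.obj.up X.up) (hl : M.level ≠ N.level) :
    IsResolved X := by
  refine ⟨ZMod p, inferInstance, fun _ => γ, fun j => (j, 0), fun j => hs _, fun w => ?_⟩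
  rw [single_zero_apply, ← Finset.mul_sum, Finset.sum_congr rfl fun j _ => show root _ =
    root ((M.level - N.level) * w.2 * j) by congr 1; simp only; ring, sum_root_mul, hγ, lineAverage]
  have hp := natCast_prime_ne_zero (p := p)
  by_cases h : w.1 = 0
  · have hw : w = (0 * -w.2, -1 * -w.2) := by ext <;> simp [h]
    rw [hw, average_apply _ _ (line_injective (Or.inr (neg_ne_zero.2 one_ne_zero))), ← hw, h]
    by_cases h2 : w.2 = 0
    · simp [h2, ind_zero, hp]
    · rw [ind_of_ne h2, ind_of_ne (mul_ne_zero (sub_ne_zero.2 hl) h2)]; simp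
  · rw [average_apply_of_notMem, ind_of_ne h]
    · simp
    · intro g hg
      have := congrArg Prod.fst hg
      simp at this
      exact h this

theorem sum_val {A B : Ann M N} {J : Type} [Fintype J] (f : J → (A ⟶ B)) (w : Strings p) :
    (∑ j, f j).1 w = ∑ j, (f j).1 w := by
  have h := map_sum (annuli A B).subtype f Finset.univ
  exact (congrFun h w).trans (Finset.sum_apply _ _ _)

theorem glue_single (f : Strings p → ℂ) (s w : Strings p) :
    glue M N f (Pi.single s 1) w = phase M N (w - s) s * f (w - s) := glue_single_apply f s w

theorem single_glue (f : Strings p → ℂ) (s w : Strings p) :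
    glue M N (Pi.single s 1) f w = phase M N s (w - s) * f (w - s) := by
  rw [glue, Finset.sum_eq_single s]
  · simp
  · intro t _ ht; simp [Pi.single_eq_of_ne ht]
  · simp

theorem IsResolved.exists_sum_eq_id {X : Ann M N} (h : IsResolved X) :
    ∃ (J : Type) (_ : Fintype J) (γ : J → Defect p M N)
      (v : ∀ j, X ⟶ (γ j).interface.X) (u : ∀ j, (γ j).interface.X ⟶ X),
      ∑ j, v j ≫ (γ j).interface.p ≫ u j = 𝟙 X := by
  obtain ⟨J, _, γ, s, hs, hsum⟩ := h
  simp only [← Wall.act_eq_iff] at hs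
  have hu : ∀ j, (Pi.single (s j) 1 : Strings p → ℂ) ∈ annuli (γ j).obj X := by
    intro j t ht
    have : t = s j := by by_contra h; exact ht (Pi.single_eq_of_ne h _)
    rw [this]; exact hs j
  -- The factor makes this the inverse of the annulus [s j], because [-s] inside [s] has phase
  -- inverse to that of (s, s).
  have hv : ∀ j, phase M N (s j) (s j) • (Pi.single (-s j) 1 : Strings p → ℂ) ∈
      annuli X (γ j).obj := by
    intro j
    refine Submodule.smul_mem _ _ fun t ht => ?_
    have : t = -s j := by by_contra h; exact ht (Pi.single_eq_of_ne h _)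
    rw [this, ← (hs j).1, ← (hs j).2, ← Wall.act_add, ← Wall.act_add, add_neg_cancel,
      Wall.act_zero, Wall.act_zero]
    exact ⟨rfl, rfl⟩
  refine ⟨J, inferInstance, γ, fun j => ⟨_, hv j⟩, fun j => ⟨_, hu j⟩, Subtype.ext ?_⟩
  funext w
  rw [sum_val]
  refine Eq.trans (Finset.sum_congr rfl fun j _ => ?_) (hsum w)
  change glue M N (phase M N (s j) (s j) • (Pi.single (-s j) 1 : Strings p → ℂ))
    (glue M N (γ j).diagram (Pi.single (s j) 1)) w = _
  rw [smul_glue, Pi.smul_apply, single_glue, glue_single, show w - -s j - s j = w by abel,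
    smul_eq_mul, mul_comm ((γ j).diagram w), ← mul_assoc, ← mul_assoc]
  congr 1
  rw [phase_eq_root, phase_eq_root, phase_eq_root, ← root_add, ← root_add]
  congr 1
  simp only [Prod.snd_neg, Prod.fst_sub, Prod.fst_neg]
  ring

-- For each pair of walls the position labels are fixed by the orbit of X, s carries the labels of
-- the defect to X, and the remaining character labels are summed over. Different levels on the
-- one-object walls require p conjugates instead.
set_option maxHeartbeats 1000000 in
theorem isResolved (X : Ann M N) : IsResolved X := by
  obtain ⟨m, n⟩ := X
  have h1 : (-1 : ZMod p) ≠ 0 := neg_ne_zero.2 one_ne_zero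
  cases M <;> cases N
  case T.T =>
    obtain ⟨m1, m2⟩ := m; obtain ⟨n1, n2⟩ := n
    refine isResolved_of_single (.TT (n1 - m1) (n2 - m2)) rfl (m1, m2) ?_
    simp only [Wall.ActEq, Defect.obj, Wall.base]
    grind
  case T.L =>
    obtain ⟨m1, m2⟩ := m
    change ZMod p at n
    refine isResolved_of_single (.TL (n - m2)) rfl (m1, m2) ?_
    simp only [Wall.ActEq, Defect.obj, Wall.base]
    grind
  case T.R =>
    obtain ⟨m1, m2⟩ := m
    change ZMod p at n
    refine isResolved_of_single (.TR (n - m1)) rfl (m1, m2) ?_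
    simp only [Wall.ActEq, Defect.obj, Wall.base]
    grind
  case T.X l =>
    obtain ⟨m1, m2⟩ := m
    change ZMod p at n
    refine isResolved_of_single (.TX l (n - m1 - (l : ZMod p) * m2)) rfl (m1, m2) ?_
    simp only [Wall.ActEq, Defect.obj, Wall.base]
    grind
  case T.F₀ =>
    obtain ⟨m1, m2⟩ := m
    refine isResolved_of_single (.TF₀) rfl (m1, m2) ?_
    simp only [Wall.ActEq, Defect.obj, Wall.base]
    grind
  case T.F r =>
    obtain ⟨m1, m2⟩ := m
    refine isResolved_of_single (.TF r) rfl (m1, m2) ?_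
    simp only [Wall.ActEq, Defect.obj, Wall.base]
    grind
  case L.T =>
    change ZMod p at m
    obtain ⟨n1, n2⟩ := n
    refine isResolved_of_single (.LT (n2 - m)) rfl (n1, m) ?_
    simp only [Wall.ActEq, Defect.obj, Wall.base]
    grind
  case R.T =>
    change ZMod p at m
    obtain ⟨n1, n2⟩ := n
    refine isResolved_of_single (.RT (n1 - m)) rfl (m, n2) ?_
    simp only [Wall.ActEq, Defect.obj, Wall.base]
    grind
  case X.T k =>
    change ZMod p at m
    obtain ⟨n1, n2⟩ := n
    refine isResolved_of_single (.XT k (n1 + (k : ZMod p) * n2 - m)) rfl (m - (k : ZMod p) * n2, n2) ?_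
    simp only [Wall.ActEq, Defect.obj, Wall.base]
    grind
  case F₀.T =>
    obtain ⟨n1, n2⟩ := n
    refine isResolved_of_single (.F₀T) rfl (n1, n2) ?_
    simp only [Wall.ActEq, Defect.obj, Wall.base]
    grind
  case F.T q =>
    obtain ⟨n1, n2⟩ := n
    refine isResolved_of_single (.FT q) rfl (n1, n2) ?_
    simp only [Wall.ActEq, Defect.obj, Wall.base]
    grind
  case L.R =>
    change ZMod p at m
    change ZMod p at n
    refine isResolved_of_single (.LR) rfl (n, m) ?_
    simp only [Wall.ActEq, Defect.obj, Wall.base]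
    grind
  case R.L =>
    change ZMod p at m
    change ZMod p at n
    refine isResolved_of_single (.RL) rfl (m, n) ?_
    simp only [Wall.ActEq, Defect.obj, Wall.base]
    grind
  case L.X l =>
    change ZMod p at m
    change ZMod p at n
    refine isResolved_of_single (.LX l) rfl (n - (l : ZMod p) * m, m) ?_
    simp only [Wall.ActEq, Defect.obj, Wall.base]
    grind
  case R.X k =>
    change ZMod p at m
    change ZMod p at n
    have hk := k.mul_inv
    refine isResolved_of_single (.RX k) rfl (m, ((k⁻¹ : (ZMod p)ˣ) : ZMod p) * (n - m)) ?_
    simp only [Wall.ActEq, Defect.obj, Wall.base]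
    grind
  case X.L k =>
    change ZMod p at m
    change ZMod p at n
    refine isResolved_of_single (.XL k) rfl (m - (k : ZMod p) * n, n) ?_
    simp only [Wall.ActEq, Defect.obj, Wall.base]
    grind
  case X.R k =>
    change ZMod p at m
    change ZMod p at n
    have hk := k.mul_inv
    refine isResolved_of_single (.XR k) rfl (n, ((k⁻¹ : (ZMod p)ˣ) : ZMod p) * (m - n)) ?_
    simp only [Wall.ActEq, Defect.obj, Wall.base]
    grind
  case L.L =>
    change ZMod p at m
    change ZMod p at n
    refine isResolved_of_line (fun x => .LL (n - m) x) 1 0 _ (fun _ => rfl) (Or.inl one_ne_zero)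
      (fun _ => 1) rfl
      (fun x g => (mul_one _).symm) (0, m) fun x => ?_
    simp only [Wall.ActEq, Defect.obj, Wall.base]
    grind
  case L.F₀ =>
    change ZMod p at m
    refine isResolved_of_line (fun x => .LF₀ x) 1 0 _ (fun _ => rfl) (Or.inl one_ne_zero)
      (fun _ => 1) rfl
      (fun x g => (mul_one _).symm) (0, m) fun x => ?_
    simp only [Wall.ActEq, Defect.obj, Wall.base]
    grind
  case L.F r =>
    change ZMod p at m
    refine isResolved_of_line (fun x => .LF r x) 1 0 _ (fun _ => rfl) (Or.inl one_ne_zero)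
      (fun _ => 1) rfl
      (fun x g => (mul_one _).symm) (0, m) fun x => ?_
    simp only [Wall.ActEq, Defect.obj, Wall.base]
    grind
  case F₀.L =>
    change ZMod p at n
    refine isResolved_of_line (fun x => .F₀L x) 1 0 _ (fun _ => rfl) (Or.inl one_ne_zero)
      (fun _ => 1) rfl
      (fun x g => (mul_one _).symm) (0, n) fun x => ?_
    simp only [Wall.ActEq, Defect.obj, Wall.base]
    grind
  case F.L q =>
    change ZMod p at n
    refine isResolved_of_line (fun x => .FL q x) 1 0 _ (fun _ => rfl) (Or.inl one_ne_zero)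
      (fun _ => 1) rfl
      (fun x g => (mul_one _).symm) (0, n) fun x => ?_
    simp only [Wall.ActEq, Defect.obj, Wall.base]
    grind
  case R.R =>
    change ZMod p at m
    change ZMod p at n
    refine isResolved_of_line (fun x => .RR (n - m) x) 0 (-1) _ (fun _ => rfl) (Or.inr h1)
      (fun _ => 1) rfl
      (fun x g => (mul_one _).symm) (m, 0) fun x => ?_
    simp only [Wall.ActEq, Defect.obj, Wall.base]
    grind
  case R.F₀ =>
    change ZMod p at m
    refine isResolved_of_line (fun x => .RF₀ x) 0 (-1) _ (fun _ => rfl) (Or.inr h1)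
      (fun _ => 1) rfl
      (fun x g => (mul_one _).symm) (m, 0) fun x => ?_
    simp only [Wall.ActEq, Defect.obj, Wall.base]
    grind
  case R.F r =>
    change ZMod p at m
    refine isResolved_of_line (fun x => .RF r x) 0 (-1) _ (fun _ => rfl) (Or.inr h1)
      (fun _ => 1) rfl
      (fun x g => (mul_one _).symm) (m, 0) fun x => ?_
    simp only [Wall.ActEq, Defect.obj, Wall.base]
    grind
  case F₀.R =>
    change ZMod p at n
    refine isResolved_of_line (fun x => .F₀R x) 0 (-1) _ (fun _ => rfl) (Or.inr h1)
      (fun _ => 1) rfl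
      (fun x g => (mul_one _).symm) (n, 0) fun x => ?_
    simp only [Wall.ActEq, Defect.obj, Wall.base]
    grind
  case F.R q =>
    change ZMod p at n
    refine isResolved_of_line (fun x => .FR q x) 0 (-1) _ (fun _ => rfl) (Or.inr h1)
      (fun _ => 1) rfl
      (fun x g => (mul_one _).symm) (n, 0) fun x => ?_
    simp only [Wall.ActEq, Defect.obj, Wall.base]
    grind
  case X.F₀ k =>
    change ZMod p at m
    refine isResolved_of_line (fun x => .XF₀ k x) 1 (-((k⁻¹ : (ZMod p)ˣ) : ZMod p)) _ (fun _ => rfl) (Or.inl one_ne_zero)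
      (fun _ => 1) rfl
      (fun x g => (mul_one _).symm) (m, 0) fun x => ?_
    simp only [Wall.ActEq, Defect.obj, Wall.base]
    grind
  case F₀.X k =>
    change ZMod p at n
    refine isResolved_of_line (fun x => .F₀X k x) 1 (-((k⁻¹ : (ZMod p)ˣ) : ZMod p)) _ (fun _ => rfl) (Or.inl one_ne_zero)
      (fun _ => 1) rfl
      (fun x g => (mul_one _).symm) (n, 0) fun x => ?_
    simp only [Wall.ActEq, Defect.obj, Wall.base]
    grind
  case X.F k r =>
    change ZMod p at m
    refine isResolved_of_line (fun x => .XF k r x) k (-1) _ (fun _ => rfl) (Or.inr h1)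
      _ (Theta_zero 0 _) (fun x g => Theta_eq x _ g) (m, 0) fun x => ?_
    simp only [Wall.ActEq, Defect.obj, Wall.base]
    grind
  case F.X q l =>
    change ZMod p at n
    refine isResolved_of_line (fun x => .FX q l x) l (-1) _ (fun _ => rfl) (Or.inr h1)
      _ (Theta_zero 0 _) (fun x g => Theta_eq x _ g) (n, 0) fun x => ?_
    simp only [Wall.ActEq, Defect.obj, Wall.base]
    grind
  case X.X k l =>
    change ZMod p at m n
    by_cases hkl : k = l
    · subst hkl
      refine isResolved_of_line (fun x => .XX k k rfl (n - m) x) k (-1) _ (fun _ => rfl)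
        (Or.inr h1) (fun _ => 1) rfl (fun x g => (mul_one _).symm) (m, 0) fun x => ?_
      simp only [Wall.ActEq, Defect.obj, Wall.base]
      grind
    · have hd' := mul_inv_cancel₀ (sub_ne_zero.2 (level_ne hkl))
      refine isResolved_of_single (.XX' k l hkl) rfl
        (m - (k : ZMod p) * ((m - n) * ((k : ZMod p) - l)⁻¹), (m - n) * ((k : ZMod p) - l)⁻¹) ?_
      simp only [Wall.ActEq, Defect.obj, Wall.base]
      generalize ((k : ZMod p) - l)⁻¹ = d at *
      grind
  case F₀.F r =>
    exact isResolved_of_halfPlane (.F₀F r) rfl (fun _ => ⟨trivial, trivial⟩) r.ne_zero.symm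
  case F.F q r =>
    by_cases hqr : q = r
    · subst hqr
      exact isResolved_of_plane (fun x y => .FF q q rfl x y) (fun _ _ => rfl)
        fun _ _ => ⟨trivial, trivial⟩
    · exact isResolved_of_halfPlane (.FF' q r hqr) rfl (fun _ => ⟨trivial, trivial⟩)
        (level_ne hqr)
  case F₀.F₀ =>
    exact isResolved_of_plane (fun x y => .F₀F₀ x y) (fun _ _ => rfl) fun _ _ => ⟨trivial, trivial⟩
  case F.F₀ q =>
    exact isResolved_of_halfPlane (.FF₀ q) rfl (fun _ => ⟨trivial, trivial⟩) q.ne_zero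

theorem mem_homSpace {E G : Interface M N} {f : E.X ⟶ G.X} (h : E.p ≫ f = f) (h' : f ≫ G.p = f) :
    f.1 ∈ homSpace E G :=
  ⟨f.2, congrArg Subtype.val h, congrArg Subtype.val h'⟩

variable (M N) in
/-- The simple defects form a complete family of simple idempotents. -/
theorem isSimpleFamily_interface :
    IsSimpleFamily fun γ : Defect p M N => γ.interface := by
  -- A zero idempotent would absorb only zero, against an endomorphism space of dimension one.
  have hne : ∀ γ : Defect p M N, γ.interface.p ≠ 0 := by
    intro γ h
    have h1 := finrank_homSpace_interface γ γ
    rw [if_pos rfl] at h1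
    have h2 : homSpace γ.interface γ.interface = ⊥ := by
      rw [eq_bot_iff]
      intro f hf
      have h3 := hf.2.1
      rw [show γ.interface.p.1 = 0 from congrArg Subtype.val h] at h3
      rw [Submodule.mem_bot, ← h3]
      funext x; simp [glue]
    rw [h2, finrank_bot] at h1
    exact zero_ne_one h1
  refine ⟨hne, fun γ f h h' => ?_, fun γ γ' hγ f h h' => ?_, fun X => ?_⟩
  · have h1 := finrank_homSpace_interface γ γ
    rw [if_pos rfl] at h1
    -- The endomorphism space is one-dimensional and contains the nonzero idempotent, which
    -- therefore spans it.
    have h2 := (finrank_eq_one_iff_of_nonzero'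
      (⟨γ.interface.p.1, mem_homSpace γ.interface.idem γ.interface.idem⟩ :
        homSpace γ.interface γ.interface)
      (fun h0 => hne γ (Subtype.ext (by have := congrArg Subtype.val h0; exact this)))).1 h1 ⟨f.1, mem_homSpace h h'⟩
    obtain ⟨c, hc⟩ := h2
    exact ⟨c, Subtype.ext (by have := congrArg Subtype.val hc; exact this.symm)⟩
  · have h1 := finrank_homSpace_interface γ γ'
    rw [if_neg hγ] at h1
    rw [Submodule.finrank_eq_zero] at h1
    have h2 := mem_homSpace h h'
    rw [h1, Submodule.mem_bot] at h2
    exact Subtype.ext h2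
  · exact (isResolved X).exists_sum_eq_id

end Completeness

end VecZp
end

noncomputable section

set_option linter.unusedSimpArgs false

namespace VecZp

/-! ## Traces along the fusion tables -/

section FusionTables

variable {p : ℕ} [Fact p.Prime] {M N P : Wall p}

/-! ### Sums of delta functions and characters over ℤ/p. -/

theorem sum_ind_mul_of_add (f : ZMod p → ZMod p) (G : ZMod p → ℂ) (h : ∀ n, f n = n + f 0) :
    ∑ n, ind (f n) * G n = G (-f 0) := by
  rw [Finset.sum_eq_single (-f 0)]
  · rw [h, neg_add_cancel, ind_zero, one_mul]
  · intro n _ hn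
    rw [h, ind_of_ne (fun h' => hn (eq_neg_of_add_eq_zero_left h')), zero_mul]
  · simp

theorem sum_ind_mul_of_sub (f : ZMod p → ZMod p) (G : ZMod p → ℂ) (h : ∀ n, f n = f 0 - n) :
    ∑ n, ind (f n) * G n = G (f 0) := by
  rw [Finset.sum_eq_single (f 0)]
  · rw [h, sub_self, ind_zero, one_mul]
  · intro n _ hn
    rw [h, ind_of_ne (fun h' => hn (sub_eq_zero.1 h').symm), zero_mul]
  · simp

theorem sum_ind_of_add (f : ZMod p → ZMod p) (h : ∀ n, f n = n + f 0) : ∑ n, ind (f n) = 1 := by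
  simpa using sum_ind_mul_of_add f (fun _ => 1) h

theorem sum_ind_of_sub (f : ZMod p → ZMod p) (h : ∀ n, f n = f 0 - n) : ∑ n, ind (f n) = 1 := by
  simpa using sum_ind_mul_of_sub f (fun _ => 1) h

theorem sum_root_of_linear (f : ZMod p → ZMod p) (h : ∀ n, f n = (f 1 - f 0) * n + f 0) :
    ∑ n, root (f n) = p * (ind (f 1 - f 0) * root (f 0)) := by
  rw [Finset.sum_congr rfl fun n _ => (congrArg root (h n)).trans (root_add _ _), ← Finset.sum_mul,
    sum_root_mul, mul_assoc]

theorem sum_obj_T (f : (Wall.T : Wall p).Obj → ℂ) :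
    ∑ n, f n = ∑ a : ZMod p, ∑ b : ZMod p, f (a, b) :=
  Fintype.sum_prod_type (α₁ := ZMod p) (α₂ := ZMod p) f

theorem sum_obj_L (f : (Wall.L : Wall p).Obj → ℂ) : ∑ n, f n = ∑ a : ZMod p, f a := rfl

theorem sum_obj_R (f : (Wall.R : Wall p).Obj → ℂ) : ∑ n, f n = ∑ a : ZMod p, f a := rfl

theorem sum_obj_X (k : (ZMod p)ˣ) (f : (Wall.X k : Wall p).Obj → ℂ) :
    ∑ n, f n = ∑ a : ZMod p, f a := rfl

theorem sum_obj_F₀ (f : (Wall.F₀ : Wall p).Obj → ℂ) : ∑ n, f n = f () :=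
  Fintype.sum_unique (ι := Unit) f

theorem sum_obj_F (q : (ZMod p)ˣ) (f : (Wall.F q : Wall p).Obj → ℂ) : ∑ n, f n = f () :=
  Fintype.sum_unique (ι := Unit) f

theorem sum_map_each (f : ZMod p → Defect p M N) (F : Defect p M N → ℂ) :
    ((each f).map F).sum = ∑ x, F (f x) := by
  simp [each]

theorem sum_map_each₂ (f : ZMod p → ZMod p → Defect p M N) (F : Defect p M N → ℂ) :
    ((each₂ f).map F).sum = ∑ x, ∑ y, F (f x y) := by
  simp [each₂, ← Fintype.sum_prod_type']

theorem sum_map_singleton (f : Defect p M N) (F : Defect p M N → ℂ) :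
    (({f} : Multiset _).map F).sum = F f := by simp

theorem sum_map_smul (n : ℕ) (f : Defect p M N) (F : Defect p M N → ℂ) :
    ((n • ({f} : Multiset _)).map F).sum = n * F f := by
  rw [Multiset.map_nsmul, Multiset.sum_nsmul]; simp

theorem ind_unit_mul (k : (ZMod p)ˣ) (x : ZMod p) : ind ((k : ZMod p) * x) = ind x := by
  simp [ind]

theorem ind_mul_unit (k : (ZMod p)ˣ) (x : ZMod p) : ind (x * (k : ZMod p)) = ind x := by
  simp [ind]

theorem sum_const_zmod (c : ℂ) : ∑ _ : ZMod p, c = p * c := by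
  simp [ZMod.card]

theorem sum_ind_first_mul (b c : ZMod p) (G : ZMod p → ℂ) :
    ∑ n, ind (n - b - c) * G n = G (b + c) := by
  rw [sum_ind_mul_of_add _ _ fun n => by ring]; congr 1; ring

theorem sum_ind_middle_mul (b c : ZMod p) (G : ZMod p → ℂ) :
    ∑ n, ind (b - n - c) * G n = G (b - c) := by
  rw [sum_ind_mul_of_sub _ _ fun n => by ring]; congr 1; ring

theorem sum_ind_last_mul (b : ZMod p) (G : ZMod p → ℂ) :
    ∑ n, ind (b - n) * G n = G b := by
  rw [sum_ind_mul_of_sub _ _ fun n => by ring]; congr 1; ring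

theorem sum_ind_first (b c : ZMod p) : ∑ n, ind (n - b - c) = 1 :=
  sum_ind_of_add _ fun n => by ring

theorem sum_ind_middle (b c : ZMod p) : ∑ n, ind (b - n - c) = 1 :=
  sum_ind_of_sub _ fun n => by ring

theorem sum_ind_last (b : ZMod p) : ∑ n, ind (b - n) = 1 :=
  sum_ind_of_sub _ fun n => by ring

theorem sum_root_mul_add (a c : ZMod p) :
    ∑ n, root (a * (n + c)) = p * (ind a * root (a * c)) := by
  rw [sum_root_of_linear _ fun n => by ring]; ring_nf

theorem sum_root_mul_add_unit (a c : ZMod p) (r : (ZMod p)ˣ) :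
    ∑ n, root (a * (c + (r : ZMod p) * n)) = p * (ind a * root (a * c)) := by
  rw [sum_root_of_linear _ fun n => by ring]; ring_nf; rw [ind_mul_unit]; ring

theorem sum_root_mul_sub_unit (a c : ZMod p) (r : (ZMod p)ˣ) :
    ∑ n, root (a * (c - (r : ZMod p) * n)) = p * (ind a * root (a * c)) := by
  rw [sum_root_of_linear _ fun n => by ring]; ring_nf; rw [ind_neg, ind_mul_unit]; ring

theorem sum_root_add_mul (a b : ZMod p) :
    ∑ n, root (b + a * n) = p * (ind a * root b) := by
  rw [sum_root_of_linear _ fun n => by ring]; ring_nf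

theorem sum_root_mul_add' (a b : ZMod p) :
    ∑ n, root (a * n + b) = p * (ind a * root b) := by
  rw [sum_root_of_linear _ fun n => by ring]; ring_nf

theorem sum_Theta (a : ℤ) (g : ZMod p) : ∑ x, Theta x a g = p * (ind g * Theta 0 a g) := by
  rw [Finset.sum_congr rfl fun x _ => Theta_eq x a g, ← Finset.sum_mul, sum_root_mul, mul_assoc]

/-- Opposite quadratic parts cancel. For p = 2 this uses that the integers are exactly opposite,
since powers of i see them modulo 4. -/
theorem Theta_mul_Theta_neg (x y : ZMod p) (a : ℤ) (g : ZMod p) :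
    Theta x a g * Theta y (-a) g = root (g * (x + y)) := by
  have h : Theta 0 a g * Theta 0 (-a) g = 1 := by
    unfold Theta
    split_ifs with hp
    · simp only [ZMod.val_zero, mul_zero, pow_zero, one_mul]
      rw [neg_mul, zpow_neg, mul_inv_cancel₀ (zpow_ne_zero _ Complex.I_ne_zero)]
    · rw [← root_add]
      refine (congrArg root ?_).trans root_zero
      push_cast; ring
  rw [Theta_eq x, Theta_eq y, mul_mul_mul_comm, h, mul_one, ← root_add, mul_add]

/-- Two different lines through the origin meet only there. This separates k = m from k ≠ m in the
fusion tables. -/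
theorem ind_mul_ind_of_ne {k m : (ZMod p)ˣ} (hkm : k ≠ m) (g h : ZMod p) :
    ind (g + (k : ZMod p) * h) * ind (g + (m : ZMod p) * h) = ind g * ind h := by
  rcases eq_or_ne h 0 with rfl | hh
  · simp [ind]
  · rw [ind_of_ne hh, mul_zero]
    by_cases h1 : g + k * h = 0
    · rw [ind_of_ne (x := g + (m : ZMod p) * h), mul_zero]
      intro h2
      exact hkm (Units.ext (mul_right_cancel₀ hh (add_left_cancel (h1.trans h2.symm))))
    · rw [ind_of_ne h1, zero_mul]

theorem ind_add_mul_self (k : (ZMod p)ˣ) (g h : ZMod p) :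
    ind (g + (k : ZMod p) * h) * ind h = ind g * ind h := by
  rcases eq_or_ne h 0 with rfl | hh
  · simp
  · simp [ind_of_ne hh]

/-- Both branches have the same trace: for k = l the sum over characters concentrates the line at 0
with weight p and the sum over positions removes the delta function. -/
theorem sum_sumXX_trace (k l : (ZMod p)ˣ) (m t : ZMod p)
    (g h : ZMod p) :
    ((sumXX k l).map fun γ => γ.trace m t (g, h)).sum = p * (ind g * ind h) := by
  by_cases hkl : k = l
  · subst hkl
    simp only [sumXX, dite_true, sum_map_each₂]
    dsimp only [Defect.trace]
    simp only [← Finset.mul_sum, sum_root_mul]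
    rw [← Finset.sum_mul, ← Finset.mul_sum, sum_ind_last, mul_one, mul_left_comm,
      ind_add_mul_self]
  · simp only [sumXX, hkl, dite_false, sum_map_smul]
    rfl

/-- The p² characters of the plane and p copies of the p-dimensional simple have the same trace, p²
at the origin and zero elsewhere. -/
theorem sum_sumFF_trace (q s : (ZMod p)ˣ) (m : (Wall.F q).Obj) (t : (Wall.F s).Obj)
    (g h : ZMod p) :
    ((sumFF q s).map fun γ => γ.trace m t (g, h)).sum = p * (p * (ind g * ind h)) := by
  by_cases hkl : q = s
  · subst hkl
    simp only [sumFF, dite_true, sum_map_each₂]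
    dsimp only [Defect.trace]
    simp only [root_add, ← Finset.mul_sum, ← Finset.sum_mul, sum_root_mul, ind_neg]
    ring
  · simp only [sumFF, hkl, dite_false, sum_map_smul]
    rfl

theorem sum_lineXX_trace (k l : (ZMod p)ˣ) (f : ZMod p → ZMod p × ZMod p) (m t g h : ZMod p) :
    ((lineXX k l f).map fun γ => γ.trace m t (g, h)).sum =
      if k = l then ∑ x, ind (g + (k : ZMod p) * h) * (ind (t - m - (f x).1) * root (h * (f x).2))
      else ind g * ind h := by
  by_cases hkl : k = l
  · subst hkl
    simp only [lineXX, dite_true, sum_map_each, if_true, ← mul_assoc]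
    rfl
  · simp only [lineXX, hkl, dite_false, sum_map_singleton, if_false]
    rfl

theorem sum_lineFF_trace (q s : (ZMod p)ˣ) (f : ZMod p → ZMod p × ZMod p)
    (m : (Wall.F q).Obj) (t : (Wall.F s).Obj) (g h : ZMod p) :
    ((lineFF q s f).map fun γ => γ.trace m t (g, h)).sum =
      if q = s then ∑ x, root (-g * (f x).1 + h * (f x).2) else p * (ind g * ind h) := by
  by_cases hqs : q = s
  · subst hqs
    simp only [lineFF, dite_true, sum_map_each, if_true]
    rfl
  · simp only [lineFF, hqs, dite_false, sum_map_singleton, if_false]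
    rfl

theorem root_mul_ind_mul (a b : ZMod p) (c : ℂ) : root a * (ind b * c) = ind b * (root a * c) :=
  mul_left_comm _ _ _

theorem Theta_mul_ind_mul (x : ZMod p) (n : ℤ) (a b : ZMod p) (c : ℂ) :
    Theta x n a * (ind b * c) = ind b * (Theta x n a * c) :=
  mul_left_comm _ _ _

theorem sum_root_mul_sub (a c : ZMod p) :
    ∑ n, root (a * (n - c)) = p * (ind a * root (-(a * c))) := by
  rw [sum_root_of_linear _ fun n => by ring]; ring_nf

theorem sum_ind_of_linear {c : ZMod p} (hc : c ≠ 0) (f : ZMod p → ZMod p)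
    (h : ∀ n, f n = c * n + f 0) : ∑ n, ind (f n) = 1 := by
  rw [Finset.sum_eq_single (-(c⁻¹ * f 0))]
  · rw [h, mul_neg, mul_inv_cancel_left₀ hc, neg_add_cancel, ind_zero]
  · intro n _ hn
    refine ind_of_ne fun h0 => hn ?_
    rw [h] at h0
    rw [eq_neg_of_add_eq_zero_right h0, mul_neg, inv_mul_cancel_left₀ hc, neg_neg]
  · simp

theorem sum_sum_mul_ind (b c b' c' : ZMod p) (F : ZMod p → ZMod p → ℂ) :
    ∑ x, ∑ y, F x y * (ind (b - x - c) * ind (b' - y - c')) = F (b - c) (b' - c') := by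
  have h (x y : ZMod p) : F x y * (ind (b - x - c) * ind (b' - y - c')) =
      ind (b - x - c) * (ind (b' - y - c') * F x y) := by ring
  simp only [h, ← Finset.mul_sum, sum_ind_middle_mul]

theorem sum_ind_first₃_mul (b c d : ZMod p) (G : ZMod p → ℂ) :
    ∑ n, ind (n - b - c - d) * G n = G (b + c + d) := by
  rw [sum_ind_mul_of_add _ _ fun n => by ring]; congr 1; ring

theorem sum_ind_first₃ (b c d : ZMod p) : ∑ n, ind (n - b - c - d) = 1 :=
  sum_ind_of_add _ fun n => by ring

theorem sum_root_mul_mul_sub (a b c : ZMod p) :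
    ∑ n, root (a * (b * (n - c))) = p * (ind (a * b) * root (-(a * (b * c)))) := by
  rw [sum_root_of_linear _ fun n => by ring]; ring_nf

theorem ind_neg_unit_mul (q : (ZMod p)ˣ) (h : ZMod p) : ind (-(q : ZMod p) * h) = ind h := by
  rw [neg_mul, ind_neg, ind_unit_mul]

/-- The middle label n enters with slope (r - q) a. Equal levels make the summand constant;
otherwise the sum forces a = 0. -/
theorem sum_root_mul_root (a x z : ZMod p) (q r : (ZMod p)ˣ) :
    ∑ n, root (a * (x - (q : ZMod p) * n)) * root (a * (z + (r : ZMod p) * n)) =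
      if q = r then p * root (a * (x + z)) else p * ind a := by
  simp only [← root_add]
  rw [sum_root_of_linear _ fun n => by ring]
  split_ifs with hqr
  · subst hqr
    ring_nf
    rw [ind_zero]; ring
  · rcases eq_or_ne a 0 with rfl | ha
    · simp [root_zero]
    · rw [ind_of_ne ha, ind_of_ne]
      · simp
      · intro h
        have h1 : a * ((r : ZMod p) - q) = 0 := by linear_combination h
        exact hqr (Units.ext (sub_eq_zero.1 ((mul_eq_zero.1 h1).resolve_left ha)).symm)

theorem ind_mul_congr {a : ZMod p} {x y : ℂ} (h : a = 0 → x = y) : ind a * x = ind a * y := by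
  rcases eq_or_ne a 0 with ha | ha
  · rw [h ha]
  · rw [ind_of_ne ha, zero_mul, zero_mul]

theorem ind_mul_self_mul (a : ZMod p) (x : ℂ) : ind a * (ind a * x) = ind a * x := by
  rcases eq_or_ne a 0 with rfl | ha
  · rw [ind_zero, one_mul]
  · rw [ind_of_ne ha, zero_mul, zero_mul]

theorem ind_mul_ind_mul_of_ne {k m : (ZMod p)ˣ} (hkm : k ≠ m) (g h : ZMod p) (x : ℂ) :
    ind (g + (k : ZMod p) * h) * (ind (g + (m : ZMod p) * h) * x) = ind g * (ind h * x) := by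
  rw [← mul_assoc, ind_mul_ind_of_ne hkm, mul_assoc]

-- Traces with T on one side are supported at w = 0, so everything reduces to counting middle labels
-- (a, b) that satisfy two affine conditions.
set_option maxHeartbeats 4000000 in
theorem fuseT_trace (α : Defect p M .T) (β : Defect p .T P) (m : M.Obj) (t : P.Obj)
    (w : Strings p) : ∑ n : (Wall.T : Wall p).Obj, α.trace m n w * β.trace n t w =
      ((fuseT α β).map fun γ => γ.trace m t w).sum := by
  obtain ⟨g, h⟩ := w
  cases α <;> (try change ZMod p at m) <;> (try change ZMod p × ZMod p at m) <;>
  cases β <;> (try change ZMod p at t) <;> (try change ZMod p × ZMod p at t) <;>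
  simp only [fuseT, sum_map_each, sum_map_each₂, sum_map_singleton, sum_map_smul,
    sum_sumXX_trace, sum_sumFF_trace, sum_lineXX_trace, sum_lineFF_trace, sum_obj_T] <;>
  dsimp only [Defect.trace] <;>
  rcases eq_or_ne g 0 with rfl | hg <;> rcases eq_or_ne h 0 with rfl | hh <;>
  (try simp only [ind_zero, ind_of_ne, mul_zero, zero_mul, one_mul, mul_one, root_zero, neg_zero,
      ind_neg, add_zero, zero_add, Finset.sum_const_zero, *, ne_eq, not_false_eq_true]) <;>
  (try simp only [ind_zero, ind_of_ne, mul_zero, zero_mul, one_mul, mul_one, root_zero, neg_zero,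
      ind_neg, add_zero, zero_add, Finset.sum_const_zero, ite_self, ind_unit_mul,
      sum_Theta, Theta_zero, sum_ind_first, sum_ind_middle, sum_ind_last,
      sum_ind_first_mul, sum_ind_middle_mul, sum_ind_last_mul, sum_const_zmod, sum_root_mul,
      sum_root_mul_add, sum_root_mul_sub, sum_root_mul_add', sum_root_mul_root, ind_mul_self_mul,
      root_mul_ind_mul, Theta_mul_ind_mul, sum_root_mul_add_unit,
      sum_root_mul_sub_unit, sum_root_add_mul, ← Finset.mul_sum, ← Finset.sum_mul, mul_assoc,
      ne_eq, not_false_eq_true, neg_eq_zero, *]) <;>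
  (try (ring_nf; done))
  case LT.TX.inl.inl => exact sum_ind_of_sub _ fun n => by ring
  case RT.TX.inl.inl l _ => exact sum_ind_of_linear (neg_ne_zero.2 l.ne_zero) _ fun n => by ring
  case XT.TT.inl.inl => rw [sum_sum_mul_ind]; ring_nf
  case XT.TL.inl.inl =>
    rw [Finset.sum_comm]
    simp only [← Finset.sum_mul]
    rw [Finset.sum_congr rfl fun y _ => congrArg (· * _) (sum_ind_of_add _ fun n => by ring)]
    simp only [one_mul, sum_ind_middle]
  case XT.TR.inl.inl k _ _ =>
    rw [Finset.sum_congr rfl fun y _ => congrArg (· * _)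
      (sum_ind_of_linear k.ne_zero _ fun n => by ring)]
    simp only [one_mul, sum_ind_middle]
  case XT.TX.inl.inl k a l c =>
    -- After the first coordinate is eliminated, the condition on the second has slope k - l: for k
    -- = l it is constant and counted p times, otherwise it has exactly one solution.
    rw [Finset.sum_comm, Finset.sum_congr rfl fun y _ => sum_ind_mul_of_add _ _ fun n => by ring]
    split_ifs with hkl
    · subst hkl
      rw [← sum_const_zmod]
      refine Finset.sum_congr rfl fun y _ => ?_
      congr 1; ring
    · refine sum_ind_of_linear (c := (k : ZMod p) - (l : ZMod p))
        (sub_ne_zero.2 fun h => hkl (Units.ext h)) _ fun n => by ring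
  all_goals
    rw [Finset.sum_comm, ← mul_one (p : ℂ), ← sum_const_zmod]
    refine Finset.sum_congr rfl fun y _ => ?_
    first
      | (refine sum_ind_of_add _ fun n => ?_; ring1)
      | (refine sum_ind_of_sub _ fun n => ?_; ring1)

-- The dependence on q = s comes from F_q L followed by L F_s, where the phases of the middle label
-- cancel exactly when q = s (`sum_root_mul_root`).
set_option maxHeartbeats 4000000 in
theorem fuseL_trace (α : Defect p M .L) (β : Defect p .L P) (m : M.Obj) (t : P.Obj)
    (w : Strings p) : ∑ n : (Wall.L : Wall p).Obj, α.trace m n w * β.trace n t w =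
      ((fuseL α β).map fun γ => γ.trace m t w).sum := by
  obtain ⟨g, h⟩ := w
  cases α <;> (try change ZMod p at m) <;> (try change ZMod p × ZMod p at m) <;>
  cases β <;> (try change ZMod p at t) <;> (try change ZMod p × ZMod p at t) <;>
  simp only [fuseL, sum_map_each, sum_map_each₂, sum_map_singleton, sum_map_smul,
    sum_sumXX_trace, sum_sumFF_trace, sum_lineXX_trace, sum_lineFF_trace, sum_obj_L] <;>
  dsimp only [Defect.trace] <;>
  rcases eq_or_ne g 0 with rfl | hg <;> rcases eq_or_ne h 0 with rfl | hh <;>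
  (try simp only [ind_zero, ind_of_ne, mul_zero, zero_mul, one_mul, mul_one, root_zero, neg_zero,
      ind_neg, add_zero, zero_add, Finset.sum_const_zero, *, ne_eq, not_false_eq_true]) <;>
  (try simp only [ind_zero, ind_of_ne, mul_zero, zero_mul, one_mul, mul_one, root_zero, neg_zero,
      ind_neg, add_zero, zero_add, Finset.sum_const_zero, ite_self, ind_unit_mul,
      sum_Theta, Theta_zero, sum_ind_first, sum_ind_middle, sum_ind_last,
      sum_ind_first_mul, sum_ind_middle_mul, sum_ind_last_mul, sum_const_zmod, sum_root_mul,
      sum_root_mul_add, sum_root_mul_sub, sum_root_mul_add', sum_root_mul_root, ind_mul_self_mul,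
      root_mul_ind_mul, Theta_mul_ind_mul, sum_root_mul_add_unit,
      sum_root_mul_sub_unit, sum_root_add_mul, ← Finset.mul_sum, ← Finset.sum_mul, mul_assoc,
      ne_eq, not_false_eq_true, neg_eq_zero, *]) <;>
  (try ((try simp only [← root_add]); ring_nf; done)) <;>
  (try (ring_nf; simp only [sub_eq_add_neg, root_add]; ring_nf; done))

set_option maxHeartbeats 4000000 in
theorem fuseR_trace (α : Defect p M .R) (β : Defect p .R P) (m : M.Obj) (t : P.Obj)
    (w : Strings p) : ∑ n : (Wall.R : Wall p).Obj, α.trace m n w * β.trace n t w =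
      ((fuseR α β).map fun γ => γ.trace m t w).sum := by
  obtain ⟨g, h⟩ := w
  cases α <;> (try change ZMod p at m) <;> (try change ZMod p × ZMod p at m) <;>
  cases β <;> (try change ZMod p at t) <;> (try change ZMod p × ZMod p at t) <;>
  simp only [fuseR, sum_map_each, sum_map_each₂, sum_map_singleton, sum_map_smul,
    sum_sumXX_trace, sum_sumFF_trace, sum_lineXX_trace, sum_lineFF_trace, sum_obj_R] <;>
  dsimp only [Defect.trace] <;>
  rcases eq_or_ne g 0 with rfl | hg <;> rcases eq_or_ne h 0 with rfl | hh <;>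
  (try simp only [ind_zero, ind_of_ne, mul_zero, zero_mul, one_mul, mul_one, root_zero, neg_zero,
      ind_neg, add_zero, zero_add, Finset.sum_const_zero, *, ne_eq, not_false_eq_true]) <;>
  (try simp only [ind_zero, ind_of_ne, mul_zero, zero_mul, one_mul, mul_one, root_zero, neg_zero,
      ind_neg, add_zero, zero_add, Finset.sum_const_zero, ite_self, ind_unit_mul,
      sum_Theta, Theta_zero, sum_ind_first, sum_ind_middle, sum_ind_last,
      sum_ind_first_mul, sum_ind_middle_mul, sum_ind_last_mul, sum_const_zmod, sum_root_mul,
      sum_root_mul_add, sum_root_mul_sub, sum_root_mul_add', sum_root_mul_root, ind_mul_self_mul,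
      root_mul_ind_mul, Theta_mul_ind_mul, sum_root_mul_add_unit,
      sum_root_mul_sub_unit, sum_root_add_mul, ← Finset.mul_sum, ← Finset.sum_mul, mul_assoc,
      ne_eq, not_false_eq_true, neg_eq_zero, *]) <;>
  (try ((try simp only [← root_add]); ring_nf; done)) <;>
  (try (ring_nf; simp only [sub_eq_add_neg, root_add]; ring_nf; done))

-- The middle wall has one object, so traces multiply pointwise. Where a line remains, exponents
-- need to agree only on it, after substituting for g.
set_option maxHeartbeats 4000000 in
theorem fuseF₀_trace (α : Defect p M .F₀) (β : Defect p .F₀ P) (m : M.Obj) (t : P.Obj)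
    (w : Strings p) : ∑ n : (Wall.F₀ : Wall p).Obj, α.trace m n w * β.trace n t w =
      ((fuseF₀ α β).map fun γ => γ.trace m t w).sum := by
  obtain ⟨g, h⟩ := w
  cases α <;> (try change ZMod p at m) <;> (try change ZMod p × ZMod p at m) <;>
  cases β <;> (try change ZMod p at t) <;> (try change ZMod p × ZMod p at t) <;>
  simp only [fuseF₀, sum_map_each, sum_map_each₂, sum_map_singleton, sum_map_smul,
    sum_sumXX_trace, sum_sumFF_trace, sum_lineXX_trace, sum_lineFF_trace, sum_obj_F₀] <;>
  dsimp only [Defect.trace] <;>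
  rcases eq_or_ne g 0 with rfl | hg <;> rcases eq_or_ne h 0 with rfl | hh <;>
  (try simp only [ind_zero, ind_of_ne, mul_zero, zero_mul, one_mul, mul_one, root_zero, neg_zero,
      ind_neg, add_zero, zero_add, Finset.sum_const_zero, *, ne_eq, not_false_eq_true]) <;>
  (try simp only [ind_zero, ind_of_ne, mul_zero, zero_mul, one_mul, mul_one, root_zero, neg_zero,
      ind_neg, add_zero, zero_add, Finset.sum_const_zero, ite_self, ind_unit_mul,
      sum_Theta, Theta_zero, sum_ind_first, sum_ind_middle, sum_ind_last,
      sum_ind_first_mul, sum_ind_middle_mul, sum_ind_last_mul, sum_const_zmod, sum_root_mul,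
      sum_root_mul_add, sum_root_mul_sub, sum_root_mul_add', sum_root_mul_root, ind_mul_self_mul,
      root_mul_ind_mul, Theta_mul_ind_mul, sum_root_mul_add_unit,
      sum_root_mul_sub_unit, sum_root_add_mul, ← Finset.mul_sum, ← Finset.sum_mul, mul_assoc,
      ne_eq, not_false_eq_true, neg_eq_zero, *]) <;>
  (try ((try simp only [← root_add]); ring_nf; done))
  case F₀F₀.F₀X.inr.inr x y l z =>
    refine ind_mul_congr fun hgh => ?_
    obtain rfl := eq_neg_of_add_eq_zero_left hgh
    simp only [← root_add]
    congr 1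
    linear_combination (-(h * y)) * l.mul_inv
  case XF₀.F₀F₀.inr.inr k x z w =>
    refine ind_mul_congr fun hgh => ?_
    obtain rfl := eq_neg_of_add_eq_zero_left hgh
    simp only [← root_add]
    congr 1
    linear_combination (-(h * w)) * k.mul_inv
  case XF₀.F₀X.inr.inr k x l z =>
    split_ifs with hkl
    · subst hkl
      rw [ind_mul_self_mul]
      refine ind_mul_congr fun hgh => ?_
      obtain rfl := eq_neg_of_add_eq_zero_left hgh
      simp only [← root_add]
      congr 1; ring
    · rw [ind_mul_ind_mul_of_ne hkl, ind_of_ne hg, zero_mul]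

-- The supporting line is that of X_l. Labels are taken out of Θ by `Theta_eq`, so that shifts by
-- middle labels become linear characters.
set_option maxHeartbeats 4000000 in
theorem fuseX_trace {l : (ZMod p)ˣ} (α : Defect p M (.X l)) (β : Defect p (.X l) P) (m : M.Obj)
      (t : P.Obj)
    (w : Strings p) : ∑ n : (Wall.X l).Obj, α.trace m n w * β.trace n t w =
      ((fuseX α β).map fun γ => γ.trace m t w).sum := by
  obtain ⟨g, h⟩ := w
  cases α <;> (try change ZMod p at m) <;> (try change ZMod p × ZMod p at m) <;>
  cases β <;> (try change ZMod p at t) <;> (try change ZMod p × ZMod p at t) <;>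
  simp only [fuseX, sum_map_each, sum_map_each₂, sum_map_singleton, sum_map_smul,
    sum_sumXX_trace, sum_sumFF_trace, sum_lineXX_trace, sum_lineFF_trace, sum_obj_X] <;>
  dsimp only [Defect.trace] <;>
  rcases eq_or_ne g 0 with rfl | hg <;> rcases eq_or_ne h 0 with rfl | hh <;>
  (try simp only [ind_zero, ind_of_ne, mul_zero, zero_mul, one_mul, mul_one, root_zero, neg_zero,
      ind_neg, add_zero, zero_add, Finset.sum_const_zero, *, ne_eq, not_false_eq_true]) <;>
  (try simp only [ind_zero, ind_of_ne, mul_zero, zero_mul, one_mul, mul_one, root_zero, neg_zero,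
      ind_neg, add_zero, zero_add, Finset.sum_const_zero, ite_self, ind_unit_mul,
      sum_Theta, Theta_zero, sum_ind_first₃, sum_ind_first₃_mul, sum_root_mul_mul_sub,
      ind_neg_unit_mul, sum_ind_first, sum_ind_middle, sum_ind_last,
      sum_ind_first_mul, sum_ind_middle_mul, sum_ind_last_mul, sum_const_zmod, sum_root_mul,
      sum_root_mul_add, sum_root_mul_sub, sum_root_mul_add', sum_root_mul_root, ind_mul_self_mul,
      root_mul_ind_mul, Theta_mul_ind_mul, sum_root_mul_add_unit,
      sum_root_mul_sub_unit, sum_root_add_mul, ← Finset.mul_sum, ← Finset.sum_mul, mul_assoc,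
      ne_eq, not_false_eq_true, neg_eq_zero, *]) <;>
  (try ((try simp only [← root_add]); ring_nf; done))
  case TX.XT.inl.inl =>
    rw [Finset.sum_congr rfl fun _ _ => mul_comm _ _, sum_ind_last_mul]
    congr 1; ring
  case F₀X.XF₀.inr.inr x z =>
    rw [Finset.sum_congr rfl fun n _ => congrArg root (show _ =
      (g * (l⁻¹ : (ZMod p)ˣ) + h) * n + -g * (x + z) by ring), sum_root_mul_add', 
      -- The sum over characters has slope l⁻¹ g + h, which is a unit multiple of the equation g + l
      -- h = 0 of the line.
      ← ind_unit_mul l (_ * _ + _),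
      show (l : ZMod p) * (g * (l⁻¹ : (ZMod p)ˣ) + h) = g + l * h by
        linear_combination g * l.mul_inv, mul_add (-g), root_add]
    ring
  case F₀X.XX.inr.inr x l a z hl =>
    refine ind_mul_congr fun hgh => ?_
    obtain rfl := eq_neg_of_add_eq_zero_left hgh
    simp only [← root_add]
    congr 1
    linear_combination (-(h * z)) * l.mul_inv
  case XX.XF₀.inr.inr k a x hk z =>
    refine ind_mul_congr fun hgh => ?_
    obtain rfl := eq_neg_of_add_eq_zero_left hgh
    simp only [← root_add]
    congr 1
    linear_combination (-(h * x)) * l.mul_inv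
  case XX.XF.inr.inr k a x hk s z =>
    rw [Theta_eq z, Theta_eq (_ + _)]
    simp only [mul_left_comm (root _) (Theta _ _ _), mul_assoc, ← root_add]
    congr 3; ring
  case FX.XX.inr.inr q x l a z hl =>
    rw [Theta_eq x, Theta_eq (_ + _)]
    simp only [mul_left_comm (root _) (Theta _ _ _), mul_assoc, ← root_add]
    congr 3; ring
  case FX.XF.inr.inr q x s z =>
    simp only [mul_left_comm (root _) (Theta _ _ _), ← Finset.mul_sum, ← root_add]
    -- For q = s the associator phases cancel and the two quadratic functions combine to a
    -- character; for q ≠ s the slope (s - q) h in the middle label is nonzero and the sum vanishes.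
    split_ifs with hqs
    · subst hqs
      rw [Finset.sum_congr rfl fun n _ => (congrArg root (show _ = (0 : ZMod p) by ring)).trans
        root_zero, sum_const_zmod, Finset.sum_congr rfl fun n _ => congrArg root (show _ =
        (-(g + l * h)) * n + h * (x + z) by ring), sum_root_mul_add', ind_neg,
        add_comm x z, mul_comm ((l : ZMod p).val : ℤ),
        ← Theta_mul_Theta_neg z x ((q : ZMod p).val * (l : ZMod p).val)]
      ring
    · rw [Finset.sum_congr rfl fun n _ => congrArg root (show _ =
        (((s : ZMod p) - q) * h) * n + -((s - q) * (h * (l * h))) by ring), sum_root_mul_add',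
        ind_of_ne (mul_ne_zero (sub_ne_zero.2 (level_ne hqs).symm) hh)]
      simp only [mul_zero, zero_mul]

-- Again traces multiply pointwise. In X_k F_r followed by F_r X_m, equal lines carry opposite
-- quadratic functions, and different lines meet only at the origin.
set_option maxHeartbeats 4000000 in
theorem fuseF_trace {l : (ZMod p)ˣ} (α : Defect p M (.F l)) (β : Defect p (.F l) P) (m : M.Obj)
      (t : P.Obj)
    (w : Strings p) : ∑ n : (Wall.F l).Obj, α.trace m n w * β.trace n t w =
      ((fuseF α β).map fun γ => γ.trace m t w).sum := by
  obtain ⟨g, h⟩ := w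
  cases α <;> (try change ZMod p at m) <;> (try change ZMod p × ZMod p at m) <;>
  cases β <;> (try change ZMod p at t) <;> (try change ZMod p × ZMod p at t) <;>
  simp only [fuseF, sum_map_each, sum_map_each₂, sum_map_singleton, sum_map_smul,
    sum_sumXX_trace, sum_sumFF_trace, sum_lineXX_trace, sum_lineFF_trace, sum_obj_F] <;>
  dsimp only [Defect.trace] <;>
  rcases eq_or_ne g 0 with rfl | hg <;> rcases eq_or_ne h 0 with rfl | hh <;>
  (try simp only [ind_zero, ind_of_ne, mul_zero, zero_mul, one_mul, mul_one, root_zero, neg_zero,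
      ind_neg, add_zero, zero_add, Finset.sum_const_zero, *, ne_eq, not_false_eq_true]) <;>
  (try simp only [ind_zero, ind_of_ne, mul_zero, zero_mul, one_mul, mul_one, root_zero, neg_zero,
      ind_neg, add_zero, zero_add, Finset.sum_const_zero, ite_self, ind_unit_mul,
      sum_Theta, Theta_zero, sum_ind_first, sum_ind_middle, sum_ind_last,
      sum_ind_first_mul, sum_ind_middle_mul, sum_ind_last_mul, sum_const_zmod, sum_root_mul,
      sum_root_mul_add, sum_root_mul_sub, sum_root_mul_add', sum_root_mul_root, ind_mul_self_mul,
      root_mul_ind_mul, Theta_mul_ind_mul, sum_root_mul_add_unit,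
      sum_root_mul_sub_unit, sum_root_add_mul, ← Finset.mul_sum, ← Finset.sum_mul, mul_assoc,
      ne_eq, not_false_eq_true, neg_eq_zero, *]) <;>
  (try ((try simp only [← root_add]); ring_nf; done))
  case XF.FX.inr.inr k x l z =>
    split_ifs with hkl
    · subst hkl
      rw [ind_mul_self_mul, mul_left_comm (root _), ← mul_assoc (Theta _ _ _), mul_comm ((l :
      ZMod p).val : ℤ),
        Theta_mul_Theta_neg]
      simp only [← root_add]
      congr 2; ring
    · rw [ind_mul_ind_mul_of_ne hkl, ind_of_ne hg, zero_mul]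
  case XF.FF.inr.inr k x s z w hs =>
    refine ind_mul_congr fun hgh => ?_
    obtain rfl := eq_neg_of_add_eq_zero_left hgh
    rw [Theta_eq x, Theta_eq (_ + _)]
    simp only [mul_left_comm (root _) (Theta _ _ _), mul_assoc, ← root_add]
    congr 2; ring
  case FF.FX.inr.inr x y l z =>
    refine ind_mul_congr fun hgh => ?_
    obtain rfl := eq_neg_of_add_eq_zero_left hgh
    rw [Theta_eq z, Theta_eq (_ + _)]
    simp only [mul_left_comm (root _) (Theta _ _ _), mul_assoc, ← root_add]
    congr 2; ring

/-- Traces are multiplicative along the fusion tables. -/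
theorem sum_trace_mul_trace (α : Defect p M N) (β : Defect p N P) (m : M.Obj) (t : P.Obj)
    (w : Strings p) : ∑ n : N.Obj, α.trace m n w * β.trace n t w =
      ((fusionTable α β).map fun γ => γ.trace m t w).sum := by
  cases N with
  | T => exact fuseT_trace α β m t w
  | L => exact fuseL_trace α β m t w
  | R => exact fuseR_trace α β m t w
  | F₀ => exact fuseF₀_trace α β m t w
  | X l => exact fuseX_trace α β m t w
  | F r => exact fuseF_trace α β m t w

end FusionTables

end VecZp

end

noncomputable section

namespace VecZp

/-! ## The fusion rules -/

section Fusion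

variable {p : ℕ} [Fact p.Prime] {M N P : Wall p}

theorem glueWaist_add_right (f : PantsDiagram p) (g g' : Strings p → ℂ) :
    glueWaist M N P f (g + g') = glueWaist M N P f g + glueWaist M N P f g' := by
  funext x; simp [glueWaist, mul_add, Finset.sum_add_distrib]

theorem glueWaist_smul_right (c : ℂ) (f : PantsDiagram p) (g : Strings p → ℂ) :
    glueWaist M N P f (c • g) = c • glueWaist M N P f g := by
  funext x
  simp only [glueWaist, Pi.smul_apply, smul_eq_mul, Finset.mul_sum]
  exact Finset.sum_congr rfl fun s _ => by ring

instance (E : Interface M N) (E' : Interface N P) : (verticalFusion E E').Additive where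
  map_add {_ _ g g'} := ModuleCat.hom_ext (LinearMap.ext fun f =>
    Subtype.ext (glueWaist_add_right f.1 g.1 g'.1))

instance (E : Interface M N) (E' : Interface N P) : (verticalFusion E E').Linear ℂ where
  map_smul g c := ModuleCat.hom_ext (LinearMap.ext fun f =>
    Subtype.ext (glueWaist_smul_right c f.1 g.1))

/-- The fixed vectors of the fusion are the pairs of pants that absorb on all three boundaries. -/
def fixedVectorsEquiv (E : Interface M N) (E' : Interface N P) (G : Interface M P) :
    fixedVectors (verticalFusion E E') G ≃ₗ[ℂ] fusionSpace E E' G where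
  toFun x := ⟨(show legPants E E' G.X from x.1).1, (show legPants E E' G.X from x.1).2,
    congrArg Subtype.val x.2⟩
  map_add' _ _ := rfl
  map_smul' _ _ := rfl
  invFun y := ⟨(⟨y.1, y.2.1⟩ : legPants E E' G.X), Subtype.ext y.2.2⟩
  left_inv _ := rfl
  right_inv _ := rfl

/-- The fusion has the trace of the sum in the table, and pairing γ with the trace of a summand δ
gives 1 exactly when δ = γ. -/
theorem finrank_fusionSpace_eq_count (α : Defect p M N) (β : Defect p N P) (γ : Defect p M P) :
    Module.finrank ℂ (fusionSpace α.interface β.interface γ.interface) =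
      (fusionTable α β).count γ := by
  have h := finrank_fusionSpace α.interface β.interface γ.interface
  simp only [character_interface, sum_trace_mul_trace] at h
  have h1 : ∀ S : Multiset (Defect p M P), ∑ w, γ.interface.p.1 w *
      (S.map fun δ => δ.trace γ.interface.X.low γ.interface.X.up w).sum = (S.count γ : ℂ) := by
    intro S
    induction S using Multiset.induction_on with
    | empty => simp
    | cons δ S ih =>
      simp only [Multiset.map_cons, Multiset.sum_cons, mul_add, Finset.sum_add_distrib, ih,
        Multiset.count_cons]
      refine (congrArg (· + _) (pairing_eq δ γ)).trans ?_
      push_cast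
      rw [add_comm]
      simp only [eq_comm]
  rw [h1] at h
  exact_mod_cast h

theorem nonempty_verticalFusion_iso (α : Defect p M N) (β : Defect p N P) :
    Nonempty (verticalFusion α.interface β.interface ≅
      ⨁ fun i : fusionTable α β => rep i.1.interface) := by
  refine (isSimpleFamily_interface M P).nonempty_iso_biproduct
    (verticalFusion α.interface β.interface) (fun i : fusionTable α β => i.1) fun γ => ?_
  refine (Module.finBasisOfFinrankEq ℂ _ (finrank_fusionSpace_eq_count α β γ)).map
    (fixedVectorsEquiv _ _ _).symm |>.reindex ?_
  -- An element of the multiset is a defect with an index below its multiplicity, so the fibre over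
  -- γ is the index set of the basis.
  exact
    { toFun := fun i => ⟨⟨γ, i⟩, rfl⟩
      invFun := fun k => k.2 ▸ k.1.2
      left_inv := fun i => rfl
      right_inv := by rintro ⟨⟨γ, i⟩, rfl⟩; rfl }

end Fusion

end VecZp

theorem mainTheorem4 (p : ℕ) [Fact p.Prime] :
    (∀ M N : VecZp.Wall p,
      (∀ γ : VecZp.Defect p M N, VecZp.IsIndecomposable γ.interface) ∧
      (∀ γ γ' : VecZp.Defect p M N, Nonempty (γ.interface ≅ γ'.interface) → γ = γ') ∧
      (∀ E : VecZp.Interface M N, VecZp.IsIndecomposable E →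
        ∃ γ : VecZp.Defect p M N, Nonempty (E ≅ γ.interface))) ∧
    (∀ (M N P : VecZp.Wall p) (α : VecZp.Defect p M N) (β : VecZp.Defect p N P),
      Nonempty (VecZp.verticalFusion α.interface β.interface ≅
        ⨁ fun i : VecZp.fusionTable α β => VecZp.rep i.1.interface) ∧
      ∀ γ : VecZp.Defect p M P,
        Module.finrank ℂ (VecZp.fusionSpace α.interface β.interface γ.interface) =
          (VecZp.fusionTable α β).count γ) :=
  ⟨fun M N =>
    have h := VecZp.isSimpleFamily_interface M N
    ⟨h.isIndecomposable, fun _ _ ⟨e⟩ => h.eq_of_iso e, h.exists_iso⟩,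
  fun _ _ _ α β => ⟨VecZp.nonempty_verticalFusion_iso α β,
    VecZp.finrank_fusionSpace_eq_count α β⟩⟩

end
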